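/- Let $p$ be a prime, let $F$ be a field of characteristic $p$, and let $n\ge 0$ be an integer. Let $F^{\mathrm{sep}}$ be a separable closure of $F$, and let $\mu_m\subset F^{\mathrm{sep}}$ be the group of $m$-th roots of unity. Define groups $H_m^{n+1}(F)$ for all integers $m\ge 1$ as follows. (a) If $m$ is prime to $p$, then $H_m^{n+1}(F)=H^{n+1}(F,\mu_m^{\otimes n})$ is the (continuous) cohomology of $\mathrm{Gal}(F^{\mathrm{sep}}/F)$ with coefficients in the discrete module $\mu_m^{\otimes n}$ (tensor power over $\mathbb Z/m$, so that $\mu_m^{\otimes 0}=\mathbb Z/m$). (b) If $m=p^i$, then $H_{p^i}^{n+1}(F)=\bigl(W_i(F)\otimes \underbrace{F^*\otimes\cdots\otimes F^*}_{n}\bigr)/J$, where $W_i(F)$ is the group of $p$-typical Witt vectors of length $i$, the tensor products are over $\mathbb Z$, and $J$ is the subgroup generated by the elements $(\mathbf F(w)-w)\otimes b_1\otimes\cdots\otimes b_n$, where $\mathbf F(a_1,\dots,a_i)=(a_1^p,\dots,a_i^p)$; the elements $(a,0,\dots,0)\otimes a\otimes b_2\otimes\cdots\otimes b_n$ with $a\in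 F^*$ (if $n\geq 1$); and the elements $w\otimes b_1\otimes\cdots\otimes b_n$ with $b_j=b_k$ for some $j\ne k$. (c) If $m=m_1p^i$ with $m_1$ prime to $p$, then $H_m^{n+1}(F)=H_{m_1}^{n+1}(F)\oplus H_{p^i}^{n+1}(F)$. For $m\mid m'$ let $i_{m,m'}:H_m^{n+1}(F)\to H_{m'}^{n+1}(F)$ be the following homomorphism. If $m'$ is prime to $p$, it is induced by the natural embedding of Galois modules $\mu_m^{\otimes n}\to\mu_{m'}^{\otimes n}$, $\ \xi_1^{d}\otimes\cdots\otimes\xi_n^{d}\mapsto d\cdot(\xi_1\otimes\cdots\otimes\xi_n)$, where $d=m'/m$ and $\xi_j\in\mu_{m'}$ (for $n=1$ this is the inclusion $\mu_m\subset\mu_{m'}$). If $m=p^i$ and $m'=p^{j}$, it is induced by $(a_1,\dots,a_i)\otimes b_1\otimes\cdots\otimes b_n\mapsto(0,\dots,0,a_1,\dots,a_i)\otimes b_1\otimes\cdots\otimes b_n$. In general it is the direct sum of these two homomorphisms on the prime-to-$p$ part and the $p$-part. Set $H^{n+1}(F)=\varinjlim_m H_m^{n+1}(F)$, the limit being over all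 integers $m\ge1$ ordered by divisibility. Theorem 1. For every $i\ge 0$ the natural homomorphism $H_{p^i}^{n+1}(F)\to H^{n+1}(F)$ is injective, and its image is exactly the $p^i$-torsion subgroup $\{x\in H^{n+1}(F): p^i x=0\}$. -/

import Mathlib

open scoped TensorProduct

noncomputable section

universe u

namespace IzhCoh

/-! ### The `p`-primary groups `H_{p^i}^{n+1}(F)` in characteristic `p` -/

section Witt

variable (p : ℕ) [Fact p.Prime] (F : Type u) [Field F]

/-- The group `W_i(F) ⊗ Fˣ ⊗ ⋯ ⊗ Fˣ` (with `n` factors `Fˣ`); the group `Fˣ` is written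
additively and all tensor products are over `ℤ`. -/
abbrev WittTensor (i n : ℕ) : Type u :=
  TruncatedWittVector p i F ⊗[ℤ] (PiTensorProduct ℤ fun _ : Fin n => Additive Fˣ)

variable {p F}

/-- The element `w ⊗ b_1 ⊗ ⋯ ⊗ b_n`. -/
def wittSymbol {i n : ℕ} (w : TruncatedWittVector p i F) (b : Fin n → Fˣ) : WittTensor p F i n :=
  w ⊗ₜ[ℤ] PiTensorProduct.tprod ℤ fun j => Additive.ofMul (b j)

/-- `𝐅(a_1, …, a_i) = (a_1 ^ p, …, a_i ^ p)`. -/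
def wittFrob {i : ℕ} (w : TruncatedWittVector p i F) : TruncatedWittVector p i F :=
  TruncatedWittVector.mk p fun j => w.coeff j ^ p

variable (p) in
/-- The Witt vector `(a, 0, …, 0)` of length `i`. -/
def wittTeich (i : ℕ) (a : F) : TruncatedWittVector p i F :=
  TruncatedWittVector.mk p fun j => if (j : ℕ) = 0 then a else 0

/-- The generators of the subgroup `J`. -/
inductive IsWittRelation {i n : ℕ} : WittTensor p F i n → Prop
  /-- `(𝐅(w) - w) ⊗ b_1 ⊗ ⋯ ⊗ b_n` -/
  | frob (w : TruncatedWittVector p i F) (b : Fin n → Fˣ) :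
      IsWittRelation (wittSymbol (wittFrob w - w) b)
  /-- `(a, 0, …, 0) ⊗ a ⊗ b_2 ⊗ ⋯ ⊗ b_n`, where `a` is the first entry of `b` -/
  | teich (b : Fin n → Fˣ) (j : Fin n) (hj : (j : ℕ) = 0) :
      IsWittRelation (wittSymbol (wittTeich p i (b j : F)) b)
  /-- `w ⊗ b_1 ⊗ ⋯ ⊗ b_n` with `b_j = b_k` for some `j ≠ k` -/
  | alt (w : TruncatedWittVector p i F) (b : Fin n → Fˣ) (j k : Fin n) (hjk : j ≠ k)
      (h : b j = b k) : IsWittRelation (wittSymbol w b)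

variable (p F)

/-- The subgroup `J` of `W_i(F) ⊗ Fˣ ⊗ ⋯ ⊗ Fˣ`. -/
def wittJ (i n : ℕ) : AddSubgroup (WittTensor p F i n) :=
  AddSubgroup.closure {x | IsWittRelation x}

/-- The group `H_{p^i}^{n+1}(F)` for a field `F` of characteristic `p`. -/
def WittH (i n : ℕ) : Type u := WittTensor p F i n ⧸ wittJ p F i n

instance (i n : ℕ) : AddCommGroup (WittH p F i n) :=
  inferInstanceAs (AddCommGroup (WittTensor p F i n ⧸ wittJ p F i n))

variable {F}

/-- The underlying function of `wittShift`. -/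
def wittShiftFun {i j : ℕ} (w : TruncatedWittVector p i F) : TruncatedWittVector p j F :=
  TruncatedWittVector.mk p fun k =>
    if h : j - i ≤ (k : ℕ) ∧ (k : ℕ) - (j - i) < i then w.coeff ⟨k - (j - i), h.2⟩ else 0

theorem wittShiftFun_truncate {i j : ℕ} (hij : i ≤ j) (x : WittVector p F) :
    wittShiftFun p (j := j) (WittVector.truncate i x) =
      WittVector.truncate j (WittVector.verschiebung^[j - i] x) := by
  ext k
  rw [wittShiftFun, TruncatedWittVector.coeff_mk, WittVector.coeff_truncate]
  split_ifs with h
  · rw [WittVector.coeff_truncate]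
    conv_rhs => rw [← Nat.sub_add_cancel h.1]
    rw [WittVector.iterate_verschiebung_coeff]
  · have hk := k.isLt
    rw [WittVector.iterate_verschiebung_coeff_eq_zero]
    omega

/-- The homomorphism `W_i(F) → W_j(F)`, `(a_1, …, a_i) ↦ (0, …, 0, a_1, …, a_i)`, for `i ≤ j`. -/
def wittShift {i j : ℕ} (hij : i ≤ j) : TruncatedWittVector p i F →+ TruncatedWittVector p j F :=
  AddMonoidHom.mk' (wittShiftFun p) fun a b => by
    obtain ⟨x, rfl⟩ := WittVector.truncate_surjective p i F a
    obtain ⟨y, rfl⟩ := WittVector.truncate_surjective p i F b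
    rw [← map_add, wittShiftFun_truncate p hij, wittShiftFun_truncate p hij,
      wittShiftFun_truncate p hij, ← map_add, iterate_map_add]

/-- The homomorphism `w ⊗ b_1 ⊗ ⋯ ⊗ b_n ↦ (0, …, 0, w) ⊗ b_1 ⊗ ⋯ ⊗ b_n`. -/
def wittTensorShift {i j : ℕ} (hij : i ≤ j) (n : ℕ) : WittTensor p F i n →+ WittTensor p F j n :=
  (TensorProduct.map (wittShift p hij).toIntLinearMap LinearMap.id).toAddMonoidHom

theorem wittTensorShift_symbol {i j : ℕ} (hij : i ≤ j) {n : ℕ} (w : TruncatedWittVector p i F)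
    (b : Fin n → Fˣ) :
    wittTensorShift p hij n (wittSymbol w b) = wittSymbol (wittShift p hij w) b :=
  TensorProduct.map_tmul _ _ _ _

theorem wittSymbol_sub {i n : ℕ} (w w' : TruncatedWittVector p i F) (b : Fin n → Fˣ) :
    wittSymbol (w - w') b = wittSymbol w b - wittSymbol w' b :=
  TensorProduct.sub_tmul _ _ _

theorem wittSymbol_nsmul {i n : ℕ} (c : ℕ) (w : TruncatedWittVector p i F) (b : Fin n → Fˣ) :
    wittSymbol (c • w) b = c • wittSymbol w b :=
  map_nsmul ((TensorProduct.mk ℤ (TruncatedWittVector p i F) _).flip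
    (PiTensorProduct.tprod ℤ fun j => Additive.ofMul (b j))) c w

theorem wittTeich_eq (i : ℕ) (a : F) :
    wittTeich p i a = WittVector.truncate i (WittVector.teichmuller p a) := by
  ext k
  rw [wittTeich, TruncatedWittVector.coeff_mk, WittVector.coeff_truncate]
  split_ifs with h
  · rw [h, WittVector.teichmuller_coeff_zero]
  · rw [WittVector.teichmuller_coeff_pos _ _ _ (Nat.pos_of_ne_zero h)]

theorem wittFrob_iterate_sub_mem {j n : ℕ} (w : TruncatedWittVector p j F) (b : Fin n → Fˣ)
    (k : ℕ) : wittSymbol (wittFrob^[k] w) b - wittSymbol w b ∈ wittJ p F j n := by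
  induction k with
  | zero => simp
  | succ k ih =>
    have h : wittSymbol (wittFrob (wittFrob^[k] w) - wittFrob^[k] w) b ∈ wittJ p F j n :=
      AddSubgroup.subset_closure (IsWittRelation.frob _ _)
    rw [wittSymbol_sub] at h
    have := add_mem h ih
    rwa [sub_add_sub_cancel, ← Function.iterate_succ_apply' wittFrob k w] at this

variable [CharP F p]

theorem wittFrob_truncate (i : ℕ) (x : WittVector p F) :
    wittFrob (WittVector.truncate i x) = WittVector.truncate i (WittVector.frobenius x) := by
  ext k
  simp [wittFrob, WittVector.coeff_frobenius_charP]

theorem wittShift_wittFrob {i j : ℕ} (hij : i ≤ j) (w : TruncatedWittVector p i F) :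
    wittShift p hij (wittFrob w) = wittFrob (wittShift p hij w) := by
  obtain ⟨x, rfl⟩ := WittVector.truncate_surjective p i F w
  change wittShiftFun p _ = wittFrob (wittShiftFun p _)
  rw [wittFrob_truncate, wittShiftFun_truncate p hij, wittShiftFun_truncate p hij,
    wittFrob_truncate,
    ((WittVector.verschiebung_frobenius_comm (p := p) (R := F)).iterate_left (j - i)).eq]

theorem wittFrob_iterate_shift_teich {i j : ℕ} (hij : i ≤ j) (a : F) :
    wittFrob^[j - i] (wittShift p hij (wittTeich p i a)) = p ^ (j - i) • wittTeich p j a := by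
  have hF : ∀ (k : ℕ) (x : WittVector p F), wittFrob^[k] (WittVector.truncate j x) =
      WittVector.truncate j (WittVector.frobenius^[k] x) := by
    intro k
    induction k with
    | zero => intro x; rfl
    | succ k ih => intro x; rw [Function.iterate_succ_apply', ih, wittFrob_truncate,
        Function.iterate_succ_apply']
  rw [wittTeich_eq, wittTeich_eq]
  change wittFrob^[j - i] (wittShiftFun p _) = _
  rw [wittShiftFun_truncate p hij, hF, ← map_nsmul]
  congr 1
  have hc := ((WittVector.verschiebung_frobenius_comm (p := p) (R := F)).iterate_iterate
    (j - i) (j - i)).eq (WittVector.teichmuller p a)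
  rw [← hc, WittVector.iterate_verschiebung_iterate_frobenius, nsmul_eq_mul, mul_comm]
  push_cast
  rfl

theorem wittJ_le_comap {i j : ℕ} (hij : i ≤ j) (n : ℕ) :
    wittJ p F i n ≤ (wittJ p F j n).comap (wittTensorShift p hij n) := by
  rw [wittJ, AddSubgroup.closure_le]
  rintro _ (⟨w, b⟩ | ⟨b, k, hk⟩ | ⟨w, b, k, l, hkl, h⟩)
  · change wittTensorShift p hij n _ ∈ wittJ p F j n
    rw [wittTensorShift_symbol, map_sub, wittShift_wittFrob]
    exact AddSubgroup.subset_closure (IsWittRelation.frob _ _)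
  · change wittTensorShift p hij n _ ∈ wittJ p F j n
    rw [wittTensorShift_symbol]
    have h1 := wittFrob_iterate_sub_mem p (wittShift p hij (wittTeich p i (b k : F))) b (j - i)
    rw [wittFrob_iterate_shift_teich, wittSymbol_nsmul] at h1
    have h2 : wittSymbol (wittTeich p j (b k : F)) b ∈ wittJ p F j n :=
      AddSubgroup.subset_closure (IsWittRelation.teich b k hk)
    have h3 := sub_mem (nsmul_mem h2 (p ^ (j - i))) h1
    rwa [sub_sub_cancel] at h3
  · change wittTensorShift p hij n _ ∈ wittJ p F j n
    rw [wittTensorShift_symbol]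
    exact AddSubgroup.subset_closure (IsWittRelation.alt _ b k l hkl h)

variable (F)

/-- The homomorphism `H_{p^i}^{n+1}(F) → H_{p^j}^{n+1}(F)`, for `i ≤ j`, induced by
`w ⊗ b_1 ⊗ ⋯ ⊗ b_n ↦ (0, …, 0, w) ⊗ b_1 ⊗ ⋯ ⊗ b_n`. -/
def wittHTrans {i j : ℕ} (hij : i ≤ j) (n : ℕ) : WittH p F i n →+ WittH p F j n :=
  QuotientAddGroup.map _ _ (wittTensorShift p hij n) (wittJ_le_comap p hij n)

end Witt

/-! ### The groups `H^{n+1}(F, μ_m^{⊗ n})` for `m` prime to the characteristic -/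

section Tame

variable (F : Type u) [Field F]

/-- The absolute Galois group `Gal(F^sep / F)`, with the Krull topology. -/
abbrev GalSep : Type u := SeparableClosure F ≃ₐ[F] SeparableClosure F

/-- The group `μ_m` of `m`-th roots of unity in `F^sep`, written additively. -/
abbrev Mu (m : ℕ) : Type u := Additive (rootsOfUnity m (SeparableClosure F))

theorem mu_nsmul_eq_zero (m : ℕ) (x : Mu F m) : m • x = 0 := by
  apply Additive.toMul.injective
  apply Subtype.ext
  exact x.toMul.2

instance (m : ℕ) : Module (ZMod m) (Mu F m) := AddCommGroup.zmodModule (mu_nsmul_eq_zero F m)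

/-- `μ_m^{⊗ n}`, the `n`-th tensor power over `ℤ/m`; in particular `μ_m^{⊗ 0} = ℤ/m`. -/
def MuTensor (m n : ℕ) : Type u := PiTensorProduct (ZMod m) fun _ : Fin n => Mu F m

instance (m n : ℕ) : AddCommGroup (MuTensor F m n) :=
  inferInstanceAs (AddCommGroup (PiTensorProduct (ZMod m) fun _ : Fin n => Mu F m))

instance (m n : ℕ) : Module (ZMod m) (MuTensor F m n) :=
  inferInstanceAs (Module (ZMod m) (PiTensorProduct (ZMod m) fun _ : Fin n => Mu F m))

/-- `μ_m^{⊗ n}` is a discrete module. -/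
instance (m n : ℕ) : TopologicalSpace (MuTensor F m n) := ⊥

instance (m n : ℕ) : DiscreteTopology (MuTensor F m n) := ⟨rfl⟩

/-- `(ζ_1, …, ζ_n) ↦ ζ_1 ⊗ ⋯ ⊗ ζ_n`. -/
def muTprod (m n : ℕ) : MultilinearMap (ZMod m) (fun _ : Fin n => Mu F m) (MuTensor F m n) :=
  PiTensorProduct.tprod (ZMod m)

theorem muTensor_addHom_ext {m n : ℕ} {A : Type*} [AddCommGroup A] {f g : MuTensor F m n →+ A}
    (h : ∀ x, f (muTprod F m n x) = g (muTprod F m n x)) : f = g := by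
  ext t
  induction t using PiTensorProduct.induction_on with
  | smul_tprod r x =>
    change f (r • muTprod F m n x) = g (r • muTprod F m n x)
    obtain ⟨z, rfl⟩ := ZMod.intCast_surjective r
    rw [Int.cast_smul_eq_zsmul, map_zsmul, map_zsmul, h]
  | add x y hx hy => exact (map_add f x y).trans ((congrArg₂ (· + ·) hx hy).trans (map_add g x y).symm)

/-- The action of a Galois automorphism on `μ_m`. -/
def muAct (m : ℕ) (σ : GalSep F) : Mu F m →ₗ[ZMod m] Mu F m :=
  AddMonoidHom.toZModLinearMap m (MonoidHom.toAdditive (restrictRootsOfUnity σ m))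

/-- The action of a Galois automorphism on `μ_m^{⊗ n}`. -/
def muTensorAct (m n : ℕ) (σ : GalSep F) : MuTensor F m n →ₗ[ZMod m] MuTensor F m n :=
  PiTensorProduct.map fun _ => muAct F m σ

theorem muTensorAct_tprod (m n : ℕ) (σ : GalSep F) (x : Fin n → Mu F m) :
    muTensorAct F m n σ (muTprod F m n x) = muTprod F m n fun j => muAct F m σ (x j) :=
  PiTensorProduct.map_tprod _ _

/-- `μ_m^{⊗ n}` as a discrete Galois module. -/
def muContRep (m n : ℕ) : ContRepresentation ℤ (GalSep F) (MuTensor F m n) where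
  toMonoidHom :=
    { toFun := fun σ => ⟨(muTensorAct F m n σ).toAddMonoidHom.toIntLinearMap,
        continuous_of_discreteTopology⟩
      map_one' := by
        ext t
        exact DFunLike.congr_fun (muTensor_addHom_ext F
          (f := (muTensorAct F m n 1).toAddMonoidHom) (g := AddMonoidHom.id _)
          fun x => muTensorAct_tprod F m n 1 x) t
      map_mul' := fun σ τ => by
        ext t
        refine DFunLike.congr_fun (muTensor_addHom_ext F
          (f := (muTensorAct F m n (σ * τ)).toAddMonoidHom)
          (g := (muTensorAct F m n σ).toAddMonoidHom.comp (muTensorAct F m n τ).toAddMonoidHom)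
          fun x => ?_) t
        change muTensorAct F m n (σ * τ) (muTprod F m n x) =
          muTensorAct F m n σ (muTensorAct F m n τ (muTprod F m n x))
        rw [muTensorAct_tprod, muTensorAct_tprod, muTensorAct_tprod]
        rfl }

/-- `μ_m^{⊗ n}` as an object of the category of topological representations. -/
def muRep (m n : ℕ) : TopRep.{u} ℤ (GalSep F) := TopRep.of (muContRep F m n)

/-- The Galois cohomology group `H^{n+1}(F, μ_m^{⊗ n})`. -/
def TameH (m n : ℕ) : Type u := continuousCohomology (n + 1) (muRep F m n)

instance (m n : ℕ) : AddCommGroup (TameH F m n) :=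
  inferInstanceAs (AddCommGroup (continuousCohomology (n + 1) (muRep F m n)))

variable {m m' : ℕ}

/-- The homomorphism `μ_{m'} → μ_m`, `ζ ↦ ζ ^ (m' / m)`, for `m ∣ m'`. -/
def muPow (h : m ∣ m') : Mu F m' →+ Mu F m :=
  MonoidHom.toAdditive
    (((powMonoidHom (m' / m)).comp (rootsOfUnity m' (SeparableClosure F)).subtype).codRestrict
      (rootsOfUnity m (SeparableClosure F)) fun x => by
        rw [mem_rootsOfUnity]
        change ((x : (SeparableClosure F)ˣ) ^ (m' / m)) ^ m = 1
        rw [← pow_mul, Nat.div_mul_cancel h]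
        exact x.2)

theorem muPow_eq_iff (h : m ∣ m') (y z : Mu F m') :
    muPow F h y = muPow F h z ↔ (m' / m) • y = (m' / m) • z := by
  rw [← Additive.toMul.injective.eq_iff, ← Additive.toMul.injective.eq_iff, Subtype.ext_iff,
    Subtype.ext_iff]
  rfl

theorem muPow_surjective (h : m ∣ m') (hm' : (m' : F) ≠ 0) :
    Function.Surjective (muPow F h) := by
  intro x
  have hd : ((m' / m : ℕ) : SeparableClosure F) ≠ 0 := by
    intro h0
    apply hm'
    have h1 : ((m' / m : ℕ) : F) = 0 := by
      apply (algebraMap F (SeparableClosure F)).injective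
      rw [map_natCast, map_zero, h0]
    rw [← Nat.div_mul_cancel h, Nat.cast_mul, h1, zero_mul]
  have : NeZero ((m' / m : ℕ) : SeparableClosure F) := ⟨hd⟩
  obtain ⟨z, hz⟩ := IsSepClosed.exists_pow_nat_eq
    (((x.toMul : (SeparableClosure F)ˣ)) : SeparableClosure F) (m' / m)
  have hd0 : m' / m ≠ 0 := fun h0 => hd (by rw [h0, Nat.cast_zero])
  have hz0 : z ≠ 0 := by
    rintro rfl
    rw [zero_pow hd0] at hz
    exact (x.toMul : (SeparableClosure F)ˣ).ne_zero hz.symm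
  have hu : (Units.mk0 z hz0) ^ (m' / m) = (x.toMul : (SeparableClosure F)ˣ) :=
    Units.ext (by rw [Units.val_pow_eq_pow_val, Units.val_mk0, hz])
  refine ⟨Additive.ofMul ⟨Units.mk0 z hz0, ?_⟩, ?_⟩
  · rw [mem_rootsOfUnity, ← Nat.div_mul_cancel h, pow_mul, hu]
    exact x.toMul.2
  · apply Additive.toMul.injective
    exact Subtype.ext hu

theorem smul_muTprod_update (n d : ℕ) (y : Fin n → Mu F m) (j : Fin n) (a b : Mu F m)
    (hab : d • a = d • b) :
    d • muTprod F m n (Function.update y j a) = d • muTprod F m n (Function.update y j b) := by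
  rw [← Nat.cast_smul_eq_nsmul (ZMod m), ← Nat.cast_smul_eq_nsmul (ZMod m),
    ← MultilinearMap.map_update_smul, ← MultilinearMap.map_update_smul,
    Nat.cast_smul_eq_nsmul, Nat.cast_smul_eq_nsmul, hab]

theorem smul_muTprod_congr (n d : ℕ) (y z : Fin n → Mu F m) (h : ∀ j, d • y j = d • z j) :
    d • muTprod F m n y = d • muTprod F m n z := by
  have key : ∀ s : Finset (Fin n),
      d • muTprod F m n (s.piecewise y z) = d • muTprod F m n z := by
    intro s
    induction s using Finset.induction_on with
    | empty => rw [Finset.piecewise_empty]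
    | insert j s _ ih =>
      rw [Finset.piecewise_insert, ← ih]
      conv_rhs => rw [← Function.update_eq_self j (s.piecewise y z)]
      apply smul_muTprod_update
      by_cases hj : j ∈ s
      · rw [Finset.piecewise_eq_of_mem _ _ _ hj]
      · rw [Finset.piecewise_eq_of_notMem _ _ _ hj, h]
  rw [← key Finset.univ, Finset.piecewise_univ]

theorem muTensor_nsmul_eq_zero (m n : ℕ) (t : MuTensor F m n) : m • t = 0 := by
  rw [← Nat.cast_smul_eq_nsmul (ZMod m), ZMod.natCast_self, zero_smul]

/-- The `m`-torsion subgroup of `μ_{m'}^{⊗ n}`. -/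
abbrev muTorsion (m m' n : ℕ) : AddSubgroup (MuTensor F m' n) :=
  (nsmulAddMonoidHom (α := MuTensor F m' n) m).ker

instance (m m' n : ℕ) : Module (ZMod m) (muTorsion F m m' n) :=
  AddCommGroup.zmodModule fun t => Subtype.ext t.2

/-- The function `(ζ_1, …, ζ_n) ↦ (m' / m) • (ξ_1 ⊗ ⋯ ⊗ ξ_n)`, where `ξ_j ^ (m' / m) = ζ_j`; the
value does not depend on the choice of the `ξ_j`. -/
def muTensorTransFun (h : m ∣ m') (hm' : (m' : F) ≠ 0) (n : ℕ) (x : Fin n → Mu F m) :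
    muTorsion F m m' n :=
  ⟨(m' / m) • muTprod F m' n fun j => Function.surjInv (muPow_surjective F h hm') (x j), by
    have h0 : m • (m' / m) • muTprod F m' n
        (fun j => Function.surjInv (muPow_surjective F h hm') (x j)) = 0 := by
      rw [← mul_nsmul', Nat.mul_div_cancel' h, muTensor_nsmul_eq_zero]
    exact h0⟩

theorem muTensorTransFun_update_add (h : m ∣ m') (hm' : (m' : F) ≠ 0) (n : ℕ)
    (x : Fin n → Mu F m) (j : Fin n) (a b : Mu F m) :
    muTensorTransFun F h hm' n (Function.update x j (a + b)) =
      muTensorTransFun F h hm' n (Function.update x j a) +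
        muTensorTransFun F h hm' n (Function.update x j b) := by
  apply Subtype.ext
  have hu : ∀ c : Mu F m,
      (fun k => Function.surjInv (muPow_surjective F h hm') (Function.update x j c k)) =
        Function.update (fun k => Function.surjInv (muPow_surjective F h hm') (x k)) j
          (Function.surjInv (muPow_surjective F h hm') c) := fun c => by
    funext k
    exact Function.apply_update (fun _ => Function.surjInv (muPow_surjective F h hm')) x j c k
  change (m' / m) • muTprod F m' n _ =
    (m' / m) • muTprod F m' n _ + (m' / m) • muTprod F m' n _
  rw [hu, hu, hu, ← nsmul_add, ← MultilinearMap.map_update_add]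
  apply smul_muTprod_update
  rw [← muPow_eq_iff F h, map_add, Function.surjInv_eq (muPow_surjective F h hm'),
    Function.surjInv_eq (muPow_surjective F h hm'), Function.surjInv_eq (muPow_surjective F h hm')]

theorem muTensorTransFun_update_smul (h : m ∣ m') (hm' : (m' : F) ≠ 0) (n : ℕ)
    (x : Fin n → Mu F m) (j : Fin n) (c : ZMod m) (a : Mu F m) :
    muTensorTransFun F h hm' n (Function.update x j (c • a)) =
      c • muTensorTransFun F h hm' n (Function.update x j a) := by
  obtain ⟨c, rfl⟩ := ZMod.intCast_surjective c
  rw [Int.cast_smul_eq_zsmul, Int.cast_smul_eq_zsmul]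
  exact map_zsmul (AddMonoidHom.mk' (fun a => muTensorTransFun F h hm' n (Function.update x j a))
    (muTensorTransFun_update_add F h hm' n x j)) c a

/-- `muTensorTransFun` as a multilinear map. -/
def muTensorTransAux (h : m ∣ m') (hm' : (m' : F) ≠ 0) (n : ℕ) :
    MultilinearMap (ZMod m) (fun _ : Fin n => Mu F m) (muTorsion F m m' n) where
  toFun := muTensorTransFun F h hm' n
  map_update_add' := fun {inst} x j a b => by
    rw [Subsingleton.elim inst (instDecidableEqFin n)]
    exact muTensorTransFun_update_add F h hm' n x j a b
  map_update_smul' := fun {inst} x j c a => by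
    rw [Subsingleton.elim inst (instDecidableEqFin n)]
    exact muTensorTransFun_update_smul F h hm' n x j c a

/-- The natural embedding `μ_m^{⊗ n} → μ_{m'}^{⊗ n}`, for `m ∣ m'`. It is the homomorphism
`ℤ/m(n) → ℤ/m'(n)` of Tate twists that is induced by `ℤ/m → ℤ/m'`, `1 ↦ m' / m`; it maps
`ξ_1 ^ (m' / m) ⊗ ⋯ ⊗ ξ_n ^ (m' / m)` to `(m' / m) • (ξ_1 ⊗ ⋯ ⊗ ξ_n)`, and for `n = 1` it is the
inclusion `μ_m ⊆ μ_{m'}`. -/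
def muTensorTrans (h : m ∣ m') (hm' : (m' : F) ≠ 0) (n : ℕ) :
    MuTensor F m n →+ MuTensor F m' n :=
  (muTorsion F m m' n).subtype.comp
    (PiTensorProduct.lift (muTensorTransAux F h hm' n)).toAddMonoidHom

theorem muTensorTrans_tprod (h : m ∣ m') (hm' : (m' : F) ≠ 0) (n : ℕ) (ξ : Fin n → Mu F m') :
    muTensorTrans F h hm' n (muTprod F m n fun j => muPow F h (ξ j)) =
      (m' / m) • muTprod F m' n ξ := by
  have h1 : muTensorTrans F h hm' n (muTprod F m n fun j => muPow F h (ξ j)) =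
      (muTensorTransAux F h hm' n (fun j => muPow F h (ξ j)) : MuTensor F m' n) :=
    congrArg Subtype.val (PiTensorProduct.lift.tprod (φ := muTensorTransAux F h hm' n)
      fun j => muPow F h (ξ j))
  rw [h1]
  refine smul_muTprod_congr F n (m' / m) _ ξ fun j => ?_
  rw [← muPow_eq_iff F h]
  exact Function.surjInv_eq (muPow_surjective F h hm') _

theorem muTensor_addHom_ext_pow (h : m ∣ m') (hm' : (m' : F) ≠ 0) {n : ℕ} {A : Type*}
    [AddCommGroup A] {f g : MuTensor F m n →+ A}
    (hfg : ∀ ξ : Fin n → Mu F m', f (muTprod F m n fun j => muPow F h (ξ j)) =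
      g (muTprod F m n fun j => muPow F h (ξ j))) : f = g := by
  refine muTensor_addHom_ext F fun x => ?_
  choose ξ hξ using fun j => muPow_surjective F h hm' (x j)
  rw [← funext hξ]
  exact hfg ξ

theorem muAct_muPow (h : m ∣ m') (σ : GalSep F) (y : Mu F m') :
    muAct F m σ (muPow F h y) = muPow F h (muAct F m' σ y) := by
  apply Additive.toMul.injective
  apply Subtype.ext
  apply Units.ext
  exact map_pow σ _ _

/-- `muTensorTrans` as a morphism of Galois modules. -/
def muRepTrans (h : m ∣ m') (hm' : (m' : F) ≠ 0) (n : ℕ) : muRep F m n ⟶ muRep F m' n :=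
  TopRep.ofHom
    { toContinuousLinearMap :=
        ⟨(muTensorTrans F h hm' n).toIntLinearMap, continuous_of_discreteTopology⟩
      isIntertwining' := fun σ => by
        ext t
        refine DFunLike.congr_fun (muTensor_addHom_ext_pow F h hm'
          (f := (muTensorTrans F h hm' n).comp (muTensorAct F m n σ).toAddMonoidHom)
          (g := (muTensorAct F m' n σ).toAddMonoidHom.comp (muTensorTrans F h hm' n))
          fun ξ => ?_) t
        change muTensorTrans F h hm' n (muTensorAct F m n σ
            (muTprod F m n fun j => muPow F h (ξ j))) =
          muTensorAct F m' n σ (muTensorTrans F h hm' n (muTprod F m n fun j => muPow F h (ξ j)))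
        rw [muTensorAct_tprod, muTensorTrans_tprod, map_nsmul, muTensorAct_tprod,
          ← muTensorTrans_tprod F h hm']
        simp only [muAct_muPow F h] }

/-- The homomorphism `H^{n+1}(F, μ_m^{⊗ n}) → H^{n+1}(F, μ_{m'}^{⊗ n})`, for `m ∣ m'`, induced by
the natural embedding `μ_m^{⊗ n} → μ_{m'}^{⊗ n}`. -/
def tameHTrans (h : m ∣ m') (hm' : (m' : F) ≠ 0) (n : ℕ) : TameH F m n →+ TameH F m' n :=
  (ContinuousCohomology.map (ContinuousMonoidHom.id (GalSep F)) (X := muRep F m n)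
    (Y := muRep F m' n) (muRepTrans F h hm' n) (n + 1)).hom.toLinearMap.toAddMonoidHom

end Tame

/-! ### The groups `H_m^{n+1}(F)` and `H^{n+1}(F)` in characteristic `p` -/

section Limit

/-- The positive integers, preordered by divisibility. -/
structure DvdIndex where
  /-- the underlying natural number -/
  val : ℕ
  pos : 0 < val
  deriving DecidableEq

instance : Preorder DvdIndex where
  le m m' := m.val ∣ m'.val
  le_refl m := dvd_refl m.val
  le_trans _ _ _ := dvd_trans

theorem factorization_le_of_le (p : ℕ) {m m' : DvdIndex} (h : m ≤ m') :
    m.val.factorization p ≤ m'.val.factorization p :=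
  (Nat.factorization_le_iff_dvd m.pos.ne' m'.pos.ne').2 h p

variable (p : ℕ) [Fact p.Prime] (F : Type u) [Field F]

/-- The group `H_m^{n+1}(F) = H_{m₁}^{n+1}(F) ⊕ H_{p^i}^{n+1}(F)` for a field `F` of characteristic
`p` and `m = m₁ p^i` with `m₁` prime to `p`. The first summand is trivial if `m₁ = 1`, the second
one if `i = 0`. -/
abbrev HMod (n : ℕ) (m : DvdIndex) : Type u :=
  TameH F (m.val / p ^ m.val.factorization p) n × WittH p F (m.val.factorization p) n

variable [CharP F p]

theorem primePart_cast_ne_zero (m : DvdIndex) :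
    ((m.val / p ^ m.val.factorization p : ℕ) : F) ≠ 0 := by
  rw [Ne, CharP.cast_eq_zero_iff F p]
  exact Nat.not_dvd_ordCompl (Fact.out : p.Prime) m.pos.ne'

/-- The canonical homomorphism `i_{m,m'} : H_m^{n+1}(F) → H_{m'}^{n+1}(F)`, for `m ∣ m'`. -/
def hTrans (n : ℕ) (m m' : DvdIndex) (h : m ≤ m') : HMod p F n m →+ HMod p F n m' :=
  AddMonoidHom.prodMap
    (tameHTrans F (Nat.ordCompl_dvd_ordCompl_of_dvd h p) (primePart_cast_ne_zero p F m') n)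
    (wittHTrans p F (factorization_le_of_le p h) n)

/-- The group `H^{n+1}(F)`, the direct limit of the groups `H_m^{n+1}(F)` over all positive
integers `m`, ordered by divisibility. -/
abbrev HLim (n : ℕ) : Type u := AddCommGroup.DirectLimit (HMod p F n) (hTrans p F n)

/-- The inclusion of `H_{p^i}^{n+1}(F)` in `H_m^{n+1}(F)` for `m = p^i`, whose other summand
`H^{n+1}(F, μ_1^{⊗ n})` is trivial. The transition map only serves to identify the group of index
`i` with the one of index `v_p(p^i) = i`. -/
def wittHIncl (n i : ℕ) :
    WittH p F i n →+ HMod p F n ⟨p ^ i, pow_pos (Fact.out : p.Prime).pos i⟩ :=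
  (AddMonoidHom.inr _ _).comp
    (wittHTrans p F (Nat.factorization_pow_self (Fact.out : p.Prime)).ge n)

/-- The natural homomorphism `H_{p^i}^{n+1}(F) → H^{n+1}(F)`. -/
def wittHToLim (n i : ℕ) : WittH p F i n →+ HLim p F n :=
  (AddCommGroup.DirectLimit.of (HMod p F n) (hTrans p F n)
    ⟨p ^ i, pow_pos (Fact.out : p.Prime).pos i⟩).comp (wittHIncl p F n i)

end Limit

end IzhCoh

end

/-!
Write `H_i` for `H_{p^i}^{n+1}(F)`, `𝐕 : H_i → H_j` for the map induced by `w ↦ (0, …, 0, w)` and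
`𝐑 : H_j → H_i` for the truncation. Since `p = 𝐕𝐅` on Witt vectors and `𝐅` acts trivially on `H_j`,
multiplication by `p^i` on `H_j` is the composition `H_j → H_{j-i} → H_j` of a truncation and a shift
(`wittHTrans_wittHTrunc`), and `H_i → H_{i+j} → H_j` is exact in the middle by right exactness of the
tensor product (`exists_wittHTrans_eq`). Therefore everything follows from the injectivity of the maps
`𝐕`: an element `x` of `H_j` with `p^i x = 0` then satisfies `𝐑 x = 0` and comes from `H_i`. In the
direct limit the summands `H^{n+1}(F, μ_m^{⊗ n})` have torsion prime to `p` (`smul_tameH_eq_zero`) and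
do not interfere. By induction along the truncations, the injectivity reduces to that of
`H_1 → H_{j+1}` (`mem_wittJ_of_shift_mem`).

For the latter, symbols are compared with differential forms on a lift of the field. A `p`-basis `t`
of a field `K` defines a flat lift `A` of `K` modulo `p^L` with derivations `T_i ∂/∂T_i` and a lift `φ`
of Frobenius with `φ(T_i) = T_i^p` (`IsPBasis.frobLift`). If `Ω` denotes the logarithmic differential
forms of `A`, then `w ⊗ b_1 ⊗ ⋯ ⊗ b_n ↦ gh(w) dlog b_1 ∧ ⋯ ∧ dlog b_n`, where `gh` is the last ghost
component of a lift of `w` and the `b_k` are lifted as well, is a homomorphism from `H_{j+1}` to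
`Ω / (dΩ + (φ - 1)Ω + p^(j+1) Ω)` (`FrobLift.symbolMap`, `FrobLift.symbolMap_eq_zero`), and it turns
`𝐕 : H_1 → H_{j+1}` into the multiplication by `p^j`. Hence the question is whether
`p^j Y ∈ dΩ + (φ - 1)Ω + p^(j+1) Ω` implies `Y ∈ dΩ + (φ - 1)Ω + pΩ`. This is `FrobLift.mem_exSub_one`;
it rests on two theorems on the forms of `K`: Cartier's description of closed forms
(`PCoord.exists_frobenius_add_d`), and the theorem of Bloch, Gabber and Kato that the forms fixed by
the inverse Cartier operator modulo exact forms are logarithmic (`PCoord.mem_logForm`). The latter is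
proved by means of the `p`-curvature of connections of rank one (`exists_logDeriv_eq`), for fields that
contain the `(p-1)`-th roots of all their elements.

It remains to see that an element of `H_1` is trivial if its differential form over `K` belongs to
`dΩ + (φ - 1)Ω`. For `K = F` the map `a dlog t_{i_1} ∧ ⋯ ∧ dlog t_{i_n} ↦ a ⊗ t_{i_1} ⊗ ⋯ ⊗ t_{i_n}`
is a left inverse of the differential symbol. The field `F` need not contain the `(p-1)`-th roots of
its elements, so one works over an extension `K` that does and has degree "prime to `p`" in the sense
that there is an `F`-linear retraction `τ : K → F` that commutes with Frobenius
(`exists_rootClosed_retraction`): a `p`-basis of `F` is one of `K` too, and `a` is replaced by `τ(a)`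
in the left inverse (`PCoordRetract.mem_wittJ_of_symbolForm`).
-/

set_option linter.unusedSectionVars false

noncomputable section

namespace IzhCoh

/-! ### Differential forms with logarithmic coordinates -/

section Forms

variable {I : Type*} [LinearOrder I] {A : Type*} [CommRing A]

/-- The sign of the shuffle that moves `i` past the elements of `S` that exceed it. -/
def shuffleSign (i : I) (S : Finset I) : ℤ := (-1) ^ (S.filter (i < ·)).card

theorem shuffleSign_insert_of_lt {i j : I} {S : Finset I} (h : i < j) (hj : j ∉ S) :
    shuffleSign i (insert j S) = -shuffleSign i S := by
  unfold shuffleSign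
  rw [Finset.filter_insert, if_pos h, Finset.card_insert_of_notMem (by simp [hj]), pow_succ]
  ring

theorem shuffleSign_insert_of_le {i j : I} (S : Finset I) (h : j ≤ i) :
    shuffleSign i (insert j S) = shuffleSign i S := by
  unfold shuffleSign
  rw [Finset.filter_insert, if_neg (not_lt.2 h)]

theorem shuffleSign_mul_self (i : I) (S : Finset I) : shuffleSign i S * shuffleSign i S = 1 := by
  unfold shuffleSign
  rw [← mul_pow]; simp

theorem shuffleSign_of_forall_le {i : I} {S : Finset I} (h : ∀ s ∈ S, s ≤ i) :
    shuffleSign i S = 1 := by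
  unfold shuffleSign
  rw [Finset.filter_false_of_mem fun s hs => not_lt.2 (h s hs)]; rfl

variable (I A) in
/-- The module of differential forms (of all degrees) with coefficients in `A` in the free
variables `dlog T_i`. The basis element of index `S = {s_1 < ⋯ < s_n}` stands for
`dlog T_{s_n} ∧ ⋯ ∧ dlog T_{s_1}`. -/
abbrev Form := Finset I →₀ A

variable (A) in
/-- Left multiplication by `dlog T_i`. -/
def wedgeVar (i : I) : Form I A →ₗ[A] Form I A :=
  Finsupp.lsum ℕ fun S => if i ∈ S then 0 else shuffleSign i S • Finsupp.lsingle (insert i S)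

variable (A) in
/-- Contraction with the `i`-th logarithmic vector field. -/
def contractVar (i : I) : Form I A →ₗ[A] Form I A :=
  Finsupp.lsum ℕ fun S => if i ∈ S then shuffleSign i S • Finsupp.lsingle (S.erase i) else 0

theorem wedgeVar_single_of_mem {i : I} {S : Finset I} (h : i ∈ S) (a : A) :
    wedgeVar A i (Finsupp.single S a) = 0 := by
  simp [wedgeVar, h]

theorem wedgeVar_single_of_notMem {i : I} {S : Finset I} (h : i ∉ S) (a : A) :
    wedgeVar A i (Finsupp.single S a) = shuffleSign i S • Finsupp.single (insert i S) a := by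
  simp [wedgeVar, h]

theorem contractVar_single_of_mem {i : I} {S : Finset I} (h : i ∈ S) (a : A) :
    contractVar A i (Finsupp.single S a) = shuffleSign i S • Finsupp.single (S.erase i) a := by
  simp [contractVar, h]

theorem contractVar_single_of_notMem {i : I} {S : Finset I} (h : i ∉ S) (a : A) :
    contractVar A i (Finsupp.single S a) = 0 := by
  simp [contractVar, h]

theorem wedgeVar_apply (i : I) (w : Form I A) (S : Finset I) :
    wedgeVar A i w S = if i ∈ S then shuffleSign i S • w (S.erase i) else 0 := by
  induction w using Finsupp.induction_linear with
  | zero => simp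
  | add v w hv hw =>
    rw [map_add, Finsupp.add_apply, hv, hw]
    split_ifs <;> simp
  | single T a =>
    by_cases hT : i ∈ T
    · rw [wedgeVar_single_of_mem hT]
      split_ifs with hS
      · rw [Finsupp.single_eq_of_ne]
        · simp
        · rintro rfl; simp at hT
      · rfl
    · rw [wedgeVar_single_of_notMem hT, Finsupp.smul_apply]
      split_ifs with hS
      · by_cases h : insert i T = S
        · subst h
          rw [Finset.erase_insert hT, shuffleSign_insert_of_le _ le_rfl]
          simp
        · rw [Finsupp.single_eq_of_ne' h, Finsupp.single_eq_of_ne']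
          · simp
          · rintro rfl; exact h (Finset.insert_erase hS)
      · rw [Finsupp.single_eq_of_ne', smul_zero]
        rintro rfl; simp at hS

theorem wedgeVar_wedgeVar_self (i : I) (w : Form I A) : wedgeVar A i (wedgeVar A i w) = 0 := by
  induction w using Finsupp.induction_linear with
  | zero => simp
  | add v w hv hw => rw [map_add, map_add, hv, hw, add_zero]
  | single T a =>
    by_cases hT : i ∈ T
    · rw [wedgeVar_single_of_mem hT, map_zero]
    · rw [wedgeVar_single_of_notMem hT, map_zsmul, wedgeVar_single_of_mem (by simp), smul_zero]

theorem wedgeVar_wedgeVar_of_lt {i j : I} (hij : i < j) (w : Form I A) :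
    wedgeVar A i (wedgeVar A j w) = -wedgeVar A j (wedgeVar A i w) := by
  induction w using Finsupp.induction_linear with
  | zero => simp
  | add v w hv hw => simp only [map_add, hv, hw, neg_add]
  | single T a =>
    by_cases hi : i ∈ T <;> by_cases hj : j ∈ T
    · simp [wedgeVar_single_of_mem, hi, hj]
    · rw [wedgeVar_single_of_notMem hj, wedgeVar_single_of_mem hi, map_zsmul,
        wedgeVar_single_of_mem (by simp [hi]), smul_zero, map_zero, neg_zero]
    · rw [wedgeVar_single_of_notMem hi, wedgeVar_single_of_mem hj, map_zsmul,
        wedgeVar_single_of_mem (by simp [hj]), smul_zero, map_zero, neg_zero]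
    · rw [wedgeVar_single_of_notMem hi, wedgeVar_single_of_notMem hj, map_zsmul, map_zsmul,
        wedgeVar_single_of_notMem (by simp [hi, hij.ne]),
        wedgeVar_single_of_notMem (by simp [hj, hij.ne']), smul_smul, smul_smul,
        shuffleSign_insert_of_lt hij hj, shuffleSign_insert_of_le _ hij.le, Finset.insert_comm,
        ← neg_smul]
      congr 1; ring

theorem wedgeVar_wedgeVar (i j : I) (w : Form I A) :
    wedgeVar A i (wedgeVar A j w) = -wedgeVar A j (wedgeVar A i w) := by
  rcases lt_trichotomy i j with h | rfl | h
  · exact wedgeVar_wedgeVar_of_lt h w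
  · rw [wedgeVar_wedgeVar_self, neg_zero]
  · rw [wedgeVar_wedgeVar_of_lt h, neg_neg]

theorem contractVar_wedgeVar_self (i : I) (w : Form I A) :
    contractVar A i (wedgeVar A i w) + wedgeVar A i (contractVar A i w) = w := by
  induction w using Finsupp.induction_linear with
  | zero => simp
  | add v w hv hw =>
    simp only [map_add]
    rw [add_add_add_comm, hv, hw]
  | single T a =>
    by_cases hT : i ∈ T
    · rw [wedgeVar_single_of_mem hT, contractVar_single_of_mem hT, map_zsmul, map_zero, zero_add,
        wedgeVar_single_of_notMem (Finset.notMem_erase _ _), smul_smul, Finset.insert_erase hT]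
      conv_lhs => rw [← Finset.insert_erase hT, shuffleSign_insert_of_le _ le_rfl]
      simp [shuffleSign_mul_self, Finset.insert_erase hT]
    · rw [wedgeVar_single_of_notMem hT, contractVar_single_of_notMem hT, map_zsmul, map_zero,
        add_zero, contractVar_single_of_mem (Finset.mem_insert_self _ _), smul_smul,
        shuffleSign_insert_of_le _ le_rfl, shuffleSign_mul_self, Finset.erase_insert hT, one_smul]

theorem contractVar_wedgeVar_of_ne {i j : I} (hij : i ≠ j) (w : Form I A) :
    contractVar A i (wedgeVar A j w) + wedgeVar A j (contractVar A i w) = 0 := by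
  induction w using Finsupp.induction_linear with
  | zero => simp
  | add v w hv hw =>
    simp only [map_add]
    rw [add_add_add_comm, hv, hw, add_zero]
  | single T a =>
    by_cases hi : i ∈ T <;> by_cases hj : j ∈ T
    · rw [wedgeVar_single_of_mem hj, contractVar_single_of_mem hi, map_zsmul,
        wedgeVar_single_of_mem (by simp [hj, hij.symm])]
      simp
    · obtain ⟨U, hU, rfl⟩ : ∃ U, i ∉ U ∧ T = insert i U :=
        ⟨T.erase i, Finset.notMem_erase _ _, (Finset.insert_erase hi).symm⟩
      have hjU : j ∉ U := fun h => hj (by simp [h])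
      rw [wedgeVar_single_of_notMem hj, contractVar_single_of_mem hi, map_zsmul, map_zsmul,
        contractVar_single_of_mem (by simp), Finset.erase_insert hU,
        wedgeVar_single_of_notMem hjU, Finset.insert_comm, Finset.erase_insert (by simp [hU, hij]),
        smul_smul, smul_smul, ← add_smul, Finset.insert_comm]
      rcases lt_or_gt_of_ne hij with h | h
      · rw [shuffleSign_insert_of_le _ h.le, shuffleSign_insert_of_le _ le_rfl,
          Finset.insert_comm, shuffleSign_insert_of_le _ le_rfl, shuffleSign_insert_of_lt h hjU]
        rw [show shuffleSign j U * -shuffleSign i U + shuffleSign i U * shuffleSign j U = 0 by ring,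
          zero_smul]
      · rw [shuffleSign_insert_of_lt h hU, shuffleSign_insert_of_le _ le_rfl,
          Finset.insert_comm, shuffleSign_insert_of_le _ le_rfl, shuffleSign_insert_of_le _ h.le]
        rw [show -shuffleSign j U * shuffleSign i U + shuffleSign i U * shuffleSign j U = 0 by ring,
          zero_smul]
    · rw [wedgeVar_single_of_mem hj, contractVar_single_of_notMem hi]; simp
    · rw [wedgeVar_single_of_notMem hj, contractVar_single_of_notMem hi, map_zsmul,
        contractVar_single_of_notMem (by simp [hi, hij])]; simp

variable (I A) in
/-- Left multiplication by the `1`-form `∑ v_i dlog T_i`. -/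
def wedge : (I →₀ A) →ₗ[A] Module.End A (Form I A) :=
  Finsupp.linearCombination A (wedgeVar A)

theorem wedge_apply (v : I →₀ A) (w : Form I A) :
    wedge I A v w = v.sum fun i a => a • wedgeVar A i w := by
  rw [wedge, Finsupp.linearCombination_apply, Finsupp.sum, LinearMap.sum_apply]
  rfl

theorem wedge_single (i : I) (a : A) (w : Form I A) :
    wedge I A (Finsupp.single i a) w = a • wedgeVar A i w := by
  rw [wedge, Finsupp.linearCombination_single]; rfl

theorem wedge_wedgeVar (v : I →₀ A) (i : I) (w : Form I A) :
    wedge I A v (wedgeVar A i w) = -wedgeVar A i (wedge I A v w) := by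
  induction v using Finsupp.induction_linear with
  | zero => simp
  | add u v hu hv => rw [map_add, LinearMap.add_apply, hu, hv, LinearMap.add_apply, map_add, neg_add]
  | single j a => rw [wedge_single, wedge_single, map_smul, wedgeVar_wedgeVar, smul_neg]

theorem wedge_wedge (u v : I →₀ A) (w : Form I A) :
    wedge I A u (wedge I A v w) = -wedge I A v (wedge I A u w) := by
  induction v using Finsupp.induction_linear with
  | zero => simp
  | add v v' h h' =>
    rw [map_add, LinearMap.add_apply, map_add, h, h', LinearMap.add_apply, neg_add]
  | single j a => rw [wedge_single, wedge_single, map_smul, wedge_wedgeVar, smul_neg]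

theorem wedge_wedge_self (v : I →₀ A) (w : Form I A) : wedge I A v (wedge I A v w) = 0 := by
  induction v using Finsupp.induction_linear with
  | zero => simp
  | add u v hu hv =>
    rw [map_add, LinearMap.add_apply, LinearMap.add_apply, map_add, map_add, hu, hv,
      wedge_wedge u v]
    simp
  | single j a => rw [wedge_single, wedge_single, map_smul, wedgeVar_wedgeVar_self]; simp

theorem contractVar_wedge (i : I) (v : I →₀ A) (w : Form I A) :
    contractVar A i (wedge I A v w) + wedge I A v (contractVar A i w) = v i • w := by
  induction v using Finsupp.induction_linear with
  | zero => simp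
  | add u v hu hv =>
    simp only [map_add, LinearMap.add_apply]
    rw [add_add_add_comm, hu, hv, Finsupp.add_apply, add_smul]
  | single j a =>
    rw [wedge_single, wedge_single, map_smul, ← smul_add]
    by_cases h : i = j
    · subst h
      rw [contractVar_wedgeVar_self, Finsupp.single_eq_same]
    · rw [contractVar_wedgeVar_of_ne h, Finsupp.single_eq_of_ne h, smul_zero, zero_smul]

variable (I A) in
/-- The alternating map `(v_1, …, v_n) ↦ v_1 ∧ ⋯ ∧ v_n` from `1`-forms to forms. -/
def wedgeMulti (n : ℕ) : (I →₀ A) [⋀^Fin n]→ₗ[A] Form I A :=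
  ((LinearMap.applyₗ (Finsupp.single ∅ 1 : Form I A)).comp
    (ExteriorAlgebra.lift A ⟨wedge I A, fun v => LinearMap.ext fun w => by
      exact wedge_wedge_self v w⟩).toLinearMap).compAlternatingMap (ExteriorAlgebra.ιMulti A n)

theorem wedgeMulti_zero (v : Fin 0 → (I →₀ A)) : wedgeMulti I A 0 v = Finsupp.single ∅ 1 := by
  simp [wedgeMulti]

theorem wedgeMulti_succ {n : ℕ} (v : Fin (n + 1) → (I →₀ A)) :
    wedgeMulti I A (n + 1) v = wedge I A (v 0) (wedgeMulti I A n fun j => v j.succ) := by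
  simp [wedgeMulti, ExteriorAlgebra.ιMulti_succ_apply, Matrix.vecTail, Function.comp_def]

end Forms

section FormMap

variable {I : Type*} [LinearOrder I] {A B : Type*} [CommRing A] [CommRing B]

variable (I) in
/-- Application of an additive map to the coefficients of a form. -/
def Form.map (f : A →+ B) : Form I A →+ Form I B := Finsupp.mapRange.addMonoidHom f

theorem Form.map_apply (f : A →+ B) (w : Form I A) (S : Finset I) :
    Form.map I f w S = f (w S) := rfl

theorem Form.map_single (f : A →+ B) (S : Finset I) (a : A) :
    Form.map I f (Finsupp.single S a) = Finsupp.single S (f a) :=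
  Finsupp.mapRange_single (hf := map_zero f)

theorem Form.map_wedgeVar (f : A →+ B) (i : I) (w : Form I A) :
    Form.map I f (wedgeVar A i w) = wedgeVar B i (Form.map I f w) := by
  ext S
  rw [Form.map_apply, wedgeVar_apply, wedgeVar_apply]
  split_ifs
  · rw [map_zsmul]; rfl
  · rw [map_zero]

theorem Form.map_smul (f : A →+* B) (a : A) (w : Form I A) :
    Form.map I (f : A →+ B) (a • w) = f a • Form.map I (f : A →+ B) w := by
  ext S
  simp [Form.map_apply]

theorem Form.map_wedge (f : A →+* B) (v : I →₀ A) (w : Form I A) :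
    Form.map I (f : A →+ B) (wedge I A v w) =
      wedge I B (v.mapRange f (map_zero f)) (Form.map I (f : A →+ B) w) := by
  induction v using Finsupp.induction_linear with
  | zero => simp
  | add u v hu hv =>
    rw [Finsupp.mapRange_add (map_add f), map_add, map_add, LinearMap.add_apply, map_add, hu, hv,
      LinearMap.add_apply]
  | single i a =>
    rw [Finsupp.mapRange_single, wedge_single, wedge_single, Form.map_smul, Form.map_wedgeVar]

theorem Form.map_wedgeMulti (f : A →+* B) {n : ℕ} (v : Fin n → (I →₀ A)) :
    Form.map I (f : A →+ B) (wedgeMulti I A n v) =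
      wedgeMulti I B n fun j => (v j).mapRange f (map_zero f) := by
  induction n with
  | zero => rw [wedgeMulti_zero, wedgeMulti_zero, Form.map_single]; simp
  | succ n ih => rw [wedgeMulti_succ, wedgeMulti_succ, Form.map_wedge, ih]

end FormMap

/-- A locally finite family of commuting derivations of `A`, indexed by `I`: the logarithmic
derivations `T_i ∂/∂T_i` of a ring with coordinates `T_i`. -/
structure LogDer (I : Type*) (A : Type*) [CommRing A] where
  /-- the derivations -/
  D : I → Derivation ℤ A A
  comm : ∀ i j a, D i (D j a) = D j (D i a)
  finite : ∀ a, {i | D i a ≠ 0}.Finite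

namespace LogDer

variable {I : Type*} [LinearOrder I] {A : Type*} [CommRing A] (Δ : LogDer I A)

/-- The differential `da = ∑ D_i(a) dlog T_i` of a function. -/
def grad : A →+ (I →₀ A) where
  toFun a := Finsupp.ofSupportFinite (fun i => Δ.D i a) (Δ.finite a)
  map_zero' := by ext i; exact map_zero (Δ.D i)
  map_add' a b := by ext i; exact map_add (Δ.D i) a b

theorem grad_apply (a : A) (i : I) : Δ.grad a i = Δ.D i a := rfl

theorem grad_mul (a b : A) : Δ.grad (a * b) = a • Δ.grad b + b • Δ.grad a := by
  ext i
  simp [grad_apply]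

theorem grad_one : Δ.grad 1 = 0 := by
  ext i
  simp [grad_apply]

/-- The exterior differential. -/
def d : Form I A →+ Form I A :=
  Finsupp.liftAddHom fun S =>
    { toFun := fun a => wedge I A (Δ.grad a) (Finsupp.single S 1)
      map_zero' := by simp
      map_add' := fun a b => by simp }

theorem d_single (S : Finset I) (a : A) :
    Δ.d (Finsupp.single S a) = wedge I A (Δ.grad a) (Finsupp.single S 1) := by
  simp [d]

theorem d_smul (a : A) (w : Form I A) : Δ.d (a • w) = wedge I A (Δ.grad a) w + a • Δ.d w := by
  induction w using Finsupp.induction_linear with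
  | zero => simp
  | add v w hv hw => rw [smul_add, map_add, hv, hw, map_add, map_add, smul_add]; abel
  | single S b =>
    have hb : (Finsupp.single S b : Form I A) = b • Finsupp.single S 1 := by simp
    rw [Finsupp.smul_single, smul_eq_mul, d_single, d_single, grad_mul, map_add,
      LinearMap.add_apply, hb, map_smul, map_smul, map_smul, add_comm]
    rfl

theorem d_wedgeVar (i : I) (w : Form I A) : Δ.d (wedgeVar A i w) = -wedgeVar A i (Δ.d w) := by
  induction w using Finsupp.induction_linear with
  | zero => simp
  | add v w hv hw => rw [map_add, map_add, map_add, map_add, hv, hw, neg_add]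
  | single S a =>
    have ha : (Finsupp.single S a : Form I A) = a • Finsupp.single S 1 := by simp
    have h1 : Δ.d (wedgeVar A i (Finsupp.single S 1)) = 0 := by
      by_cases hi : i ∈ S
      · rw [wedgeVar_single_of_mem hi, map_zero]
      · rw [wedgeVar_single_of_notMem hi, map_zsmul, d_single, grad_one]; simp
    rw [ha, map_smul, d_smul, d_smul, h1, d_single, grad_one, wedge_wedgeVar]
    simp

theorem d_wedge_grad (a : A) (w : Form I A) :
    Δ.d (wedge I A (Δ.grad a) w) = -wedge I A (Δ.grad a) (Δ.d w) := by
  -- the second derivatives of `a` are symmetric, the products `dlog T_i ∧ dlog T_j` antisymmetric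
  have key : ∑ i ∈ (Δ.grad a).support, wedge I A (Δ.grad (Δ.D i a)) (wedgeVar A i w) = 0 := by
    set s := (Δ.grad a).support with hs
    have hsub : ∀ i, (Δ.grad (Δ.D i a)).support ⊆ s := by
      intro i k hk
      rw [Finsupp.mem_support_iff, grad_apply, Δ.comm] at hk
      rw [hs, Finsupp.mem_support_iff, grad_apply]
      intro h0
      rw [h0, map_zero] at hk
      exact hk rfl
    have h1 : ∀ i, wedge I A (Δ.grad (Δ.D i a)) (wedgeVar A i w) =
        ∑ k ∈ s, Δ.D k (Δ.D i a) • wedgeVar A k (wedgeVar A i w) := fun i => by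
      rw [wedge_apply, Finsupp.sum_of_support_subset _ (hsub i) _ (by simp)]
      rfl
    rw [Finset.sum_congr rfl fun i _ => h1 i, ← Finset.sum_product']
    refine Finset.sum_involution (fun x _ => x.swap) ?_ ?_ ?_ ?_
    · rintro ⟨i, k⟩ _
      change Δ.D k (Δ.D i a) • wedgeVar A k (wedgeVar A i w) +
        Δ.D i (Δ.D k a) • wedgeVar A i (wedgeVar A k w) = 0
      rw [Δ.comm, wedgeVar_wedgeVar, smul_neg, neg_add_cancel]
    · rintro ⟨i, k⟩ _ h hik
      have : k = i := congrArg Prod.fst hik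
      subst this
      apply h
      change Δ.D k (Δ.D k a) • _ = _
      rw [wedgeVar_wedgeVar_self, smul_zero]
    · rintro ⟨i, k⟩ h
      simpa [and_comm] using h
    · rintro ⟨i, k⟩ _; rfl
  rw [wedge_apply, wedge_apply, Finsupp.sum, Finsupp.sum, map_sum]
  calc ∑ i ∈ (Δ.grad a).support, Δ.d (Δ.grad a i • wedgeVar A i w)
      = ∑ i ∈ (Δ.grad a).support, (wedge I A (Δ.grad (Δ.D i a)) (wedgeVar A i w) -
          Δ.grad a i • wedgeVar A i (Δ.d w)) := by
        refine Finset.sum_congr rfl fun i _ => ?_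
        rw [d_smul, d_wedgeVar, smul_neg, sub_eq_add_neg]; rfl
    _ = _ := by rw [Finset.sum_sub_distrib, key, zero_sub]

theorem d_d (w : Form I A) : Δ.d (Δ.d w) = 0 := by
  induction w using Finsupp.induction_linear with
  | zero => simp
  | add v w hv hw => rw [map_add, map_add, hv, hw, add_zero]
  | single S a => rw [d_single, d_wedge_grad, d_single, grad_one]; simp

theorem d_apply (w : Form I A) (S : Finset I) :
    Δ.d w S = ∑ i ∈ S, shuffleSign i S • Δ.D i (w (S.erase i)) := by
  induction w using Finsupp.induction_linear with
  | zero => simp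
  | add v w hv hw => simp [hv, hw, Finset.sum_add_distrib]
  | single T a =>
    rw [d_single, wedge_apply, Finsupp.sum, Finsupp.finsetSum_apply]
    simp only [Finsupp.smul_apply, wedgeVar_apply]
    have h1 : ∀ i ∈ S, shuffleSign i S • Δ.D i (Finsupp.single T a (S.erase i)) =
        Δ.grad a i • if i ∈ S then shuffleSign i S • (Finsupp.single T 1 : Form I A) (S.erase i)
          else 0 := by
      intro i hi
      rw [if_pos hi, grad_apply]
      by_cases h : S.erase i = T
      · rw [h]; simp [mul_comm]
      · rw [Finsupp.single_eq_of_ne h, Finsupp.single_eq_of_ne h]; simp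
    rw [Finset.sum_congr rfl h1]
    refine Finset.sum_congr_of_eq_on_inter ?_ ?_ fun _ _ _ => rfl
    · intro i _ hi; simp [hi]
    · intro i _ hi
      rw [Finsupp.notMem_support_iff.1 hi, zero_smul]

/-- Cartan's formula for the logarithmic vector fields. -/
theorem d_contractVar (i : I) (w : Form I A) :
    Δ.d (contractVar A i w) + contractVar A i (Δ.d w) =
      Form.map I (Δ.D i : A →+ A) w := by
  induction w using Finsupp.induction_linear with
  | zero => simp
  | add v w hv hw =>
    simp only [map_add]
    rw [add_add_add_comm, hv, hw]
  | single S a =>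
    have ha : (Finsupp.single S a : Form I A) = a • Finsupp.single S 1 := by simp
    have h1 : Δ.d (contractVar A i (Finsupp.single S 1)) = 0 := by
      by_cases hi : i ∈ S
      · rw [contractVar_single_of_mem hi, map_zsmul, d_single, grad_one]; simp
      · rw [contractVar_single_of_notMem hi, map_zero]
    rw [Form.map_single, ha, map_smul, d_smul, d_smul, h1, d_single, grad_one, map_zero,
      LinearMap.zero_apply, smul_zero, add_zero, add_zero, add_comm, contractVar_wedge]
    simp [grad_apply]

theorem d_map {B : Type*} [CommRing B] (Δ' : LogDer I B) (f : A →+* B) (c : B)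
    (h : ∀ i a, Δ'.D i (f a) = c * f (Δ.D i a)) (w : Form I A) :
    Δ'.d (Form.map I (f : A →+ B) w) = c • Form.map I (f : A →+ B) (Δ.d w) := by
  ext S
  rw [d_apply, Finsupp.smul_apply, Form.map_apply, d_apply, map_sum, smul_eq_mul, Finset.mul_sum]
  refine Finset.sum_congr rfl fun i _ => ?_
  rw [map_zsmul, Form.map_apply]
  change _ • Δ'.D i (f _) = _
  rw [h, mul_smul_comm]
  rfl

/-- A `1`-form `v` is closed. -/
def IsClosedCov (v : I →₀ A) : Prop := ∀ w, Δ.d (wedge I A v w) = -wedge I A v (Δ.d w)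

theorem isClosedCov_grad (a : A) : Δ.IsClosedCov (Δ.grad a) := Δ.d_wedge_grad a

theorem IsClosedCov.add {u v : I →₀ A} (hu : Δ.IsClosedCov u) (hv : Δ.IsClosedCov v) :
    Δ.IsClosedCov (u + v) := fun w => by
  simp only [map_add, LinearMap.add_apply, hu w, hv w, neg_add]

/-- If `dc` is a multiple of `v`, then `c v` is closed together with `v`. -/
theorem IsClosedCov.smul {v : I →₀ A} (hv : Δ.IsClosedCov v) {c e : A}
    (h : Δ.grad c = e • v) : Δ.IsClosedCov (c • v) := fun w => by
  rw [map_smul, LinearMap.smul_apply, d_smul, h, hv, map_smul, LinearMap.smul_apply,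
    wedge_wedge_self, LinearMap.smul_apply]
  simp

/-- The logarithmic differential `dlog b` of a unit. -/
def dlog (b : Aˣ) : I →₀ A := (↑b⁻¹ : A) • Δ.grad b

theorem grad_unit (b : Aˣ) : Δ.grad b = (b : A) • Δ.dlog b := by
  rw [dlog, smul_smul, Units.mul_inv, one_smul]

theorem dlog_mul (b c : Aˣ) : Δ.dlog (b * c) = Δ.dlog b + Δ.dlog c := by
  rw [dlog, dlog, dlog, Units.val_mul, grad_mul, mul_inv, Units.val_mul, smul_add, smul_smul,
    smul_smul, mul_assoc, mul_comm (↑c⁻¹ : A) (b : A), ← mul_assoc, Units.inv_mul, one_mul,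
    mul_assoc, Units.inv_mul, mul_one, add_comm]

theorem isClosedCov_dlog (b : Aˣ) : Δ.IsClosedCov (Δ.dlog b) := by
  refine IsClosedCov.smul Δ (Δ.isClosedCov_grad _) (e := -((↑b⁻¹ : A) * ↑b⁻¹)) ?_
  have h := Δ.grad_mul (↑b⁻¹ : A) b
  rw [Units.inv_mul, grad_one] at h
  have h2 : (b : A) • Δ.grad (↑b⁻¹ : A) = -((↑b⁻¹ : A) • Δ.grad b) :=
    (neg_eq_of_add_eq_zero_right h.symm).symm
  calc Δ.grad (↑b⁻¹ : A) = (↑b⁻¹ : A) • ((b : A) • Δ.grad (↑b⁻¹ : A)) := by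
        rw [smul_smul, Units.inv_mul, one_smul]
    _ = _ := by rw [h2, smul_neg, smul_smul, neg_smul]

theorem d_wedgeMulti {n : ℕ} {v : Fin n → (I →₀ A)} (hv : ∀ j, Δ.IsClosedCov (v j)) :
    Δ.d (wedgeMulti I A n v) = 0 := by
  induction n with
  | zero => rw [wedgeMulti_zero, d_single, grad_one]; simp
  | succ n ih => rw [wedgeMulti_succ, hv 0, ih fun j => hv j.succ]; simp

/-- A product of closed `1`-forms one of which is exact is exact. -/
theorem wedgeMulti_update_grad {n : ℕ} {v : Fin n → (I →₀ A)} (hv : ∀ j, Δ.IsClosedCov (v j))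
    (j : Fin n) (l : A) : ∃ ξ, wedgeMulti I A n (Function.update v j (Δ.grad l)) = Δ.d ξ := by
  induction n with
  | zero => exact j.elim0
  | succ n ih =>
    rw [wedgeMulti_succ]
    refine Fin.cases ?_ (fun j => ?_) j
    · refine ⟨l • wedgeMulti I A n fun j => v j.succ, ?_⟩
      rw [d_smul, Δ.d_wedgeMulti fun j => hv j.succ, smul_zero, add_zero]
      simp
    · obtain ⟨ξ, hξ⟩ := ih (fun j => hv j.succ) j
      have h1 : (fun k : Fin n => Function.update v j.succ (Δ.grad l) k.succ) =
          Function.update (fun k => v k.succ) j (Δ.grad l) := by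
        funext k
        simp [Function.update_apply]
      refine ⟨-wedge I A (v 0) ξ, ?_⟩
      rw [h1, hξ, map_neg, hv 0, neg_neg, Function.update_of_ne (Fin.succ_ne_zero j).symm]

/-- Changing closed `1`-forms by exact ones changes their product by an exact form. -/
theorem wedgeMulti_add_grad {n : ℕ} {v : Fin n → (I →₀ A)} (hv : ∀ j, Δ.IsClosedCov (v j))
    (l : Fin n → A) :
    ∃ ξ, wedgeMulti I A n (fun j => v j + Δ.grad (l j)) = wedgeMulti I A n v + Δ.d ξ := by
  induction n with
  | zero => exact ⟨0, by rw [wedgeMulti_zero, wedgeMulti_zero, map_zero, add_zero]⟩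
  | succ n ih =>
    obtain ⟨ξ, hξ⟩ := ih (fun j => hv j.succ) fun j => l j.succ
    refine ⟨-wedge I A (v 0) ξ +
      l 0 • (wedgeMulti I A n (fun j => v j.succ) + Δ.d ξ), ?_⟩
    have h1 : Δ.d (-wedge I A (v 0) ξ +
        l 0 • (wedgeMulti I A n (fun j => v j.succ) + Δ.d ξ)) = wedge I A (v 0) (Δ.d ξ) +
          wedge I A (Δ.grad (l 0)) (wedgeMulti I A n (fun j => v j.succ) + Δ.d ξ) := by
      rw [map_add Δ.d, map_neg, hv 0, neg_neg, d_smul, map_add Δ.d,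
        Δ.d_wedgeMulti fun j => hv j.succ, d_d, add_zero, smul_zero, add_zero]
    rw [wedgeMulti_succ, wedgeMulti_succ, hξ, h1]
    simp only [map_add, LinearMap.add_apply]
    abel

end LogDer

/-! ### Connections of rank one in characteristic `p` -/

section OneVariable

variable {p : ℕ} [hp : Fact p.Prime] {K : Type*} [Field K] [CharP K p] (D : Derivation ℤ K K)

/-- The operator `f ↦ D(f) + a f`, a connection on the trivial bundle. -/
def connection (a : K) : Module.End ℤ K := (D : K →ₗ[ℤ] K) + LinearMap.mulLeft ℤ a

theorem connection_apply (a f : K) : connection D a f = D f + a * f := rfl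

theorem connection_mul (a b f g : K) :
    connection D (a + b) (f * g) = connection D a f * g + f * connection D b g := by
  simp only [connection_apply, Derivation.leibniz, smul_eq_mul]
  ring

theorem connection_pow_mul (a b f g : K) (n : ℕ) :
    (connection D (a + b) ^ n) (f * g) = ∑ ij ∈ Finset.HasAntidiagonal.antidiagonal n,
      n.choose ij.1 • ((connection D a ^ ij.1) f * (connection D b ^ ij.2) g) := by
  induction n with
  | zero => simp
  | succ n ih =>
    rw [pow_succ', Module.End.mul_apply, ih, map_sum,
      Finset.sum_antidiagonal_choose_succ_nsmul
        (fun i j => (connection D a ^ i) f * (connection D b ^ j) g) n,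
      ← Finset.sum_add_distrib]
    refine Finset.sum_congr rfl fun ij hij => ?_
    rw [map_nsmul, connection_mul D a b, ← Module.End.mul_apply, ← pow_succ', ← Module.End.mul_apply,
      ← pow_succ', smul_add,
      Nat.choose_symm_of_eq_add (Finset.HasAntidiagonal.mem_antidiagonal.1 hij).symm, add_comm]

/-- The `p`-th power of a connection satisfies the Leibniz rule again. -/
theorem connection_pow_prime_mul (a b f g : K) :
    (connection D (a + b) ^ p) (f * g) =
      (connection D a ^ p) f * g + f * (connection D b ^ p) g := by
  obtain ⟨q, hq⟩ : ∃ q, p = q + 1 := ⟨p - 1, (Nat.sub_add_cancel hp.out.one_lt.le).symm⟩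
  rw [connection_pow_mul, Finset.Nat.sum_antidiagonal_eq_sum_range_succ_mk, Finset.sum_range_succ,
    Finset.sum_eq_single_of_mem 0 (by simp [hp.out.pos])]
  · simp [add_comm]
  · intro k hk hk0
    rw [← Nat.cast_smul_eq_nsmul K, (CharP.cast_eq_zero_iff K p _).2, zero_smul]
    exact hp.out.dvd_choose_self hk0 (Finset.mem_range.1 hk)

theorem natCast_pow_char (n : ℕ) : (n : K) ^ p = n := map_natCast (frobenius K p) n

theorem derivation_pow_char (x : K) : D (x ^ p) = 0 := by
  rw [Derivation.leibniz_pow, ← Nat.cast_smul_eq_nsmul K, CharP.cast_eq_zero, zero_smul]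

theorem derivation_pow_char_mul (x y : K) : D (x ^ p * y) = x ^ p * D y := by
  rw [Derivation.leibniz, derivation_pow_char]; simp

theorem derivation_pow_apply_of_eigen {a : K} {i : ℕ} (ha : D a = i * a) (m : ℕ) :
    ((D : K →ₗ[ℤ] K) ^ m : Module.End ℤ K) a = (i : K) ^ m * a := by
  induction m with
  | zero => simp
  | succ m ih =>
    rw [pow_succ', Module.End.mul_apply, ih]
    change D _ = _
    rw [← Nat.cast_pow, ← nsmul_eq_mul, map_nsmul, ha, nsmul_eq_mul]
    push_cast; ring

theorem derivation_pow_eigen {a : K} {i : ℕ} (ha : D a = i * a) (k : ℕ) :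
    D (a ^ k) = ((i * k : ℕ) : K) * a ^ k := by
  rw [Derivation.leibniz_pow, ha]
  rcases k with _ | k
  · simp
  · simp; ring

variable (p) in
/-- The projection `1 - D^{p-1}` to the constants of `D`, along the sum of the nonzero
eigenspaces of `D` (for a derivation with `D^p = D`). -/
def constProj : Module.End ℤ K := 1 - (D : K →ₗ[ℤ] K) ^ (p - 1)

theorem constProj_apply (x : K) :
    constProj p D x = x - ((D : K →ₗ[ℤ] K) ^ (p - 1) : Module.End ℤ K) x := rfl

/-- The `p`-th iterate of a connection is `D^p` plus the multiplication by its `p`-curvature. -/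
theorem connection_pow_prime_apply (hD : ((D : K →ₗ[ℤ] K) ^ p : Module.End ℤ K) = D) (a f : K) :
    (connection D a ^ p) f = (connection D a ^ p) 1 * f + D f := by
  have h0 : connection D 0 = (D : K →ₗ[ℤ] K) := by
    ext x; simp [connection_apply]
  have := connection_pow_prime_mul (p := p) D a 0 1 f
  rw [add_zero, one_mul, one_mul, h0, hD] at this
  exact this

theorem derivation_connection_pow_one_sub (hD : ((D : K →ₗ[ℤ] K) ^ p : Module.End ℤ K) = D) (a : K) :
    D ((connection D a ^ p) 1 - a) = 0 := by
  have h1 : (connection D a ^ p) (connection D a 1) = connection D a ((connection D a ^ p) 1) := by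
    rw [← Module.End.mul_apply, ← Module.End.mul_apply, ← pow_succ, ← pow_succ']
  rw [connection_pow_prime_apply D hD a (connection D a 1), connection_apply, connection_apply] at h1
  simp only [Derivation.map_one_eq_zero, zero_add, mul_one] at h1
  rw [map_sub, sub_eq_zero]
  linear_combination -h1

theorem constProj_apply_of_eq_zero {x : K} (hx : D x = 0) : constProj p D x = x := by
  obtain ⟨q, hq⟩ : ∃ q, p - 1 = q + 1 :=
    ⟨p - 2, by have := hp.out.two_le; omega⟩
  rw [constProj_apply, hq, pow_succ, Module.End.mul_apply]
  change x - ((D : K →ₗ[ℤ] K) ^ q : Module.End ℤ K) (D x) = x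
  rw [hx, map_zero, sub_zero]

theorem constProj_apply_eigen {a : K} {i : ℕ} (ha : D a = i * a) (hi : (i : K) ≠ 0) :
    constProj p D a = 0 := by
  have h : (i : K) ^ (p - 1) = 1 := by
    apply mul_right_cancel₀ hi
    rw [← pow_succ, Nat.sub_add_cancel hp.out.one_lt.le, natCast_pow_char, one_mul]
  rw [constProj_apply, derivation_pow_apply_of_eigen D ha, h, one_mul, sub_self]

/-- The `p`-curvature for an eigenfunction `a` of `D`. -/
theorem connection_pow_prime_one_eigen (hD : ((D : K →ₗ[ℤ] K) ^ p : Module.End ℤ K) = D)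
    {a : K} {i : ℕ} (ha : D a = i * a) :
    (connection D a ^ p) 1 = a ^ p + a - constProj p D a := by
  by_cases hi : (i : K) = 0
  · rw [hi, zero_mul] at ha
    have h : ∀ m, (connection D a ^ m) 1 = a ^ m := by
      intro m
      induction m with
      | zero => simp
      | succ m ih =>
        rw [pow_succ', Module.End.mul_apply, ih, connection_apply, Derivation.leibniz_pow, ha]
        simp; ring
    rw [h, constProj_apply_of_eq_zero D ha, add_sub_cancel_right]
  · -- modulo the lower powers of `a`, whose weights do not vanish, `(D + a)^m (1)` is `a^m`
    have h : ∀ m, m + 1 ≤ p → (connection D a ^ (m + 1)) 1 - a ^ (m + 1) ∈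
        AddSubgroup.closure {x | ∃ k, 1 ≤ k ∧ k < m + 1 ∧ ∃ c : ℕ, x = c * a ^ k} := by
      intro m hm
      induction m with
      | zero => simp [connection_apply]
      | succ m ih =>
        specialize ih (by omega)
        set N := AddSubgroup.closure {x | ∃ k, 1 ≤ k ∧ k < m + 1 + 1 ∧ ∃ c : ℕ, x = (c : K) * a ^ k}
        have hgen : ∀ (c k : ℕ), 1 ≤ k → k < m + 1 + 1 → (c : K) * a ^ k ∈ N := fun c k h1 h2 =>
          AddSubgroup.subset_closure ⟨k, h1, h2, c, rfl⟩
        have hpow : ∀ c k : ℕ, connection D a (c * a ^ k) =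
            ((c * (i * k) : ℕ) : K) * a ^ k + c * a ^ (k + 1) := by
          intro c k
          rw [connection_apply, ← nsmul_eq_mul, map_nsmul, derivation_pow_eigen D ha]
          simp; ring
        have hle : ∀ x ∈ AddSubgroup.closure {x | ∃ k, 1 ≤ k ∧ k < m + 1 ∧ ∃ c : ℕ,
            x = (c : K) * a ^ k}, connection D a x ∈ N := by
          intro x hx
          induction hx using AddSubgroup.closure_induction with
          | mem x hx =>
            obtain ⟨k, h1, h2, c, rfl⟩ := hx
            rw [hpow]
            exact add_mem (hgen _ _ h1 (by omega)) (hgen _ _ (by omega) (by omega))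
          | zero => rw [map_zero]; exact zero_mem _
          | add x y _ _ hx hy => rw [map_add]; exact add_mem hx hy
          | neg x _ hx => rw [map_neg]; exact neg_mem hx
        have h1 := hle _ ih
        have h2 := hpow 1 (m + 1)
        rw [Nat.cast_one, one_mul, one_mul] at h2
        rw [map_sub, h2, ← Module.End.mul_apply, ← pow_succ'] at h1
        have h3 := add_mem h1 (hgen (1 * (i * (m + 1))) (m + 1) (by omega) (by omega))
        rw [one_mul] at h3
        convert h3 using 1
        ring_nf
    obtain ⟨q, hq⟩ : ∃ q, p = q + 1 := ⟨p - 1, (Nat.sub_add_cancel hp.out.one_lt.le).symm⟩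
    have h1 := h q hq.ge
    rw [← hq] at h1
    have h2 : ∀ x ∈ AddSubgroup.closure {x | ∃ k, 1 ≤ k ∧ k < p ∧ ∃ c : ℕ, x = (c : K) * a ^ k},
        constProj p D x = 0 := by
      intro x hx
      induction hx using AddSubgroup.closure_induction with
      | mem x hx =>
        obtain ⟨k, h1, h2, c, rfl⟩ := hx
        rw [← nsmul_eq_mul, map_nsmul, constProj_apply_eigen D (derivation_pow_eigen D ha k),
          smul_zero]
        rw [Nat.cast_mul]
        refine mul_ne_zero hi ?_
        rw [Ne, CharP.cast_eq_zero_iff K p]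
        exact fun hk => by have := Nat.le_of_dvd (by omega) hk; omega
      | zero => rw [map_zero]
      | add x y _ _ hx hy => rw [map_add, hx, hy, add_zero]
      | neg x _ hx => rw [map_neg, hx, neg_zero]
    have h3 := h2 _ h1
    have h4 := constProj_apply_of_eq_zero (p := p) D (derivation_connection_pow_one_sub D hD a)
    rw [map_sub, constProj_apply_eigen D ha hi, sub_zero] at h4
    rw [map_sub, constProj_apply_of_eq_zero D (derivation_pow_char D a), h4, sub_eq_zero] at h3
    rw [constProj_apply_eigen D ha hi]
    linear_combination h3

/-- Jacobson's formula for the `p`-curvature of a connection. -/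
theorem connection_pow_prime_one (hD : ((D : K →ₗ[ℤ] K) ^ p : Module.End ℤ K) = D)
    {a : K} (ha : a ∈ AddSubgroup.closure {x : K | ∃ i : ℕ, D x = i * x}) :
    (connection D a ^ p) 1 = a ^ p + a - constProj p D a := by
  have hadd : ∀ a b : K, (connection D (a + b) ^ p) 1 =
      (connection D a ^ p) 1 + (connection D b ^ p) 1 := fun a b => by
    have := connection_pow_prime_mul (p := p) D a b 1 1
    rwa [mul_one, mul_one, one_mul] at this
  induction ha using AddSubgroup.closure_induction with
  | mem x hx => obtain ⟨i, hi⟩ := hx; exact connection_pow_prime_one_eigen D hD hi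
  | zero => exact connection_pow_prime_one_eigen D hD (i := 0) (by simp)
  | add x y _ _ hx hy => rw [hadd, hx, hy, add_pow_char, map_add]; ring
  | neg x _ hx =>
    have h0 : (connection D 0 ^ p) 1 = 0 := by
      have := connection_pow_prime_one_eigen (p := p) D hD (a := 0) (i := 0) (by simp)
      rw [this, map_zero, zero_pow hp.out.ne_zero]; simp
    have h1 := hadd x (-x)
    rw [add_neg_cancel, h0, hx] at h1
    have h2 : (-x) ^ p = -x ^ p := by
      rw [eq_neg_iff_add_eq_zero, ← add_pow_char, neg_add_cancel, zero_pow hp.out.ne_zero]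
    rw [h2, map_neg]
    linear_combination -h1

/-- An additive operator `T` on `K` with `T^p v = T v` has an eigenvector with eigenvalue in the
prime field, and one that is killed by every operator that commutes with `T` and kills `v`. -/
theorem exists_eigenvector (T : Module.End ℤ K) {v : K} (hv : v ≠ 0) (h : (T ^ p) v = T v) :
    ∃ (k : ℕ) (x : K), x ≠ 0 ∧ T x = k * x ∧
      ∀ U : Module.End ℤ K, Commute U T → U v = 0 → U x = 0 := by
  classical
  have : CharP (Module.End ℤ K) p := charP_of_injective_ringHom
    (f := (Algebra.lmul ℤ K).toRingHom) (fun x y hxy => by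
      have := LinearMap.congr_fun hxy 1
      simpa using this) p
  let _ := ZMod.algebra (Module.End ℤ K) p
  have hpoly : (Polynomial.X ^ p - Polynomial.X : Polynomial (ZMod p)) =
      ∏ i : ZMod p, (Polynomial.X - Polynomial.C i) := by
    have hr := FiniteField.roots_X_pow_card_sub_X (ZMod p)
    have hdeg := FiniteField.X_pow_card_sub_X_natDegree_eq (ZMod p) hp.out.one_lt
    rw [ZMod.card] at hr
    have hm : (Polynomial.X ^ p - Polynomial.X : Polynomial (ZMod p)).Monic := by
      apply Polynomial.monic_X_pow_sub
      rw [Polynomial.degree_X]; exact_mod_cast hp.out.one_lt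
    have := Polynomial.prod_multiset_X_sub_C_of_monic_of_roots_card_eq hm (by
      rw [hr, hdeg]; simp [ZMod.card])
    rw [← this, hr]; rfl
  have key : ∀ (s : Finset (ZMod p)) (v : K), v ≠ 0 →
      Polynomial.aeval T (∏ i ∈ s, (Polynomial.X - Polynomial.C i)) v = 0 →
      ∃ (k : ℕ) (x : K), x ≠ 0 ∧ T x = k * x ∧
        ∀ U : Module.End ℤ K, Commute U T → U v = 0 → U x = 0 := by
    intro s
    induction s using Finset.induction_on with
    | empty =>
      intro v hv h
      simp at h
      exact absurd h hv
    | insert i s hi ih =>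
      intro v hv h
      have hTi : Polynomial.aeval T (Polynomial.X - Polynomial.C i) v = T v - (i.val : K) * v := by
        have hi : algebraMap (ZMod p) (Module.End ℤ K) i = (i.val : Module.End ℤ K) := by
          conv_lhs => rw [← ZMod.natCast_zmod_val i, map_natCast]
        rw [map_sub, Polynomial.aeval_X, Polynomial.aeval_C, LinearMap.sub_apply, hi,
          Module.End.natCast_apply, nsmul_eq_mul]
      rw [Finset.prod_insert hi, mul_comm, map_mul, Module.End.mul_apply, hTi] at h
      by_cases h0 : T v - (i.val : K) * v = 0
      · exact ⟨i.val, v, hv, sub_eq_zero.1 h0, fun U _ hU => hU⟩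
      · obtain ⟨k, x, hx, hTx, hU⟩ := ih _ h0 h
        refine ⟨k, x, hx, hTx, fun U hUT hUv => hU U hUT ?_⟩
        have hc : U (T v) = T (U v) := LinearMap.congr_fun hUT v
        rw [map_sub, hc, hUv, ← nsmul_eq_mul, map_nsmul, hUv]; simp
  refine key Finset.univ v hv ?_
  rw [← hpoly, map_sub, map_pow, Polynomial.aeval_X, LinearMap.sub_apply, h, sub_self]

/-- Cartier's theorem in one variable: if the connection `D - g` has vanishing `p`-curvature, then
`g` is a logarithmic derivative `D(c) / c`. Moreover, `c` is a constant for all derivations that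
commute with `D` and annihilate `g` and the coordinate `t`. -/
theorem exists_logDeriv_eq (hD : ((D : K →ₗ[ℤ] K) ^ p : Module.End ℤ K) = D) {t g : K}
    (ht0 : t ≠ 0) (ht : D t = t) (hg : g ∈ AddSubgroup.closure {x : K | ∃ i : ℕ, D x = i * x})
    (hgp : constProj p D g = g ^ p) :
    ∃ c : K, c ≠ 0 ∧ D c = g * c ∧
      ∀ D' : Derivation ℤ K K, (∀ x, D' (D x) = D (D' x)) → D' g = 0 → D' t = 0 → D' c = 0 := by
  have h1 : (connection D (-g) ^ p) 1 = connection D (-g) 1 := by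
    have h2 : (-g) ^ p = -g ^ p := by
      rw [eq_neg_iff_add_eq_zero, ← add_pow_char, neg_add_cancel, zero_pow hp.out.ne_zero]
    rw [connection_pow_prime_one D hD (neg_mem hg), map_neg, hgp, h2, connection_apply]
    simp
  obtain ⟨k, x, hx, hTx, hU⟩ := exists_eigenvector (p := p) _ one_ne_zero h1
  rw [connection_apply] at hTx
  refine ⟨x / t ^ k, div_ne_zero hx (pow_ne_zero _ ht0), ?_, fun D' hD' hg' ht' => ?_⟩
  · rw [Derivation.leibniz_div, Derivation.leibniz_pow, ht]
    have : D x = (k + g) * x := by linear_combination hTx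
    rcases k with _ | k
    · rw [this]; simp
    · rw [this]; simp; field_simp; ring
  · have : D' x = 0 := by
      refine hU (D' : K →ₗ[ℤ] K) ?_ (Derivation.map_one_eq_zero D')
      ext y
      change D' (connection D (-g) y) = connection D (-g) (D' y)
      rw [connection_apply, connection_apply, map_add, hD', Derivation.leibniz, map_neg, hg']
      simp
    rw [Derivation.leibniz_div, Derivation.leibniz_pow, ht', this]
    simp

end OneVariable

/-! ### The Cartier isomorphism -/

theorem LogDer.d_map_comm {I : Type*} [LinearOrder I] {A : Type*} [CommRing A] (Δ : LogDer I A)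
    (f : A →+ A) (h : ∀ i a, Δ.D i (f a) = f (Δ.D i a)) (w : Form I A) :
    Δ.d (Form.map I f w) = Form.map I f (Δ.d w) := by
  ext S
  rw [LogDer.d_apply, Form.map_apply, LogDer.d_apply, map_sum]
  refine Finset.sum_congr rfl fun i _ => ?_
  rw [map_zsmul, Form.map_apply, h]

/-- Coordinates on a field `K` of characteristic `p`: units `t_i` and commuting derivations
`D_i = t_i ∂/∂t_i`, such that the `t_i` generate `K` over the field of `p`-th powers, which is
the common field of constants of the `D_i`. In other words, the `t_i` form a `p`-basis. -/
structure PCoord (p : ℕ) (I : Type*) (K : Type*) [Field K] [DecidableEq I] extends LogDer I K where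
  /-- the coordinates -/
  t : I → Kˣ
  D_t : ∀ i j, D i (t j) = if i = j then (t j : K) else 0
  span : ∀ f : K, f ∈ AddSubgroup.closure
    {x : K | ∃ (g : K) (α : I →₀ ℕ), x = g ^ p * (α.prod fun i k => t i ^ k : Kˣ)}
  exists_pow : ∀ f : K, (∀ i, D i f = 0) → ∃ g, f = g ^ p

namespace PCoord

variable {p : ℕ} [hp : Fact p.Prime] {I : Type*} [LinearOrder I] {K : Type*} [Field K] [CharP K p]
  (P : PCoord p I K)

theorem D_prod (i : I) (α : I →₀ ℕ) :
    P.D i (α.prod fun j k => P.t j ^ k : Kˣ) = α i * (α.prod fun j k => P.t j ^ k : Kˣ) := by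
  induction α using Finsupp.induction_linear with
  | zero => simp
  | add α β hα hβ =>
    rw [Finsupp.prod_add_index' (by simp) (by simp [pow_add]), Units.val_mul, Derivation.leibniz,
      hα, hβ]
    simp; ring
  | single j k =>
    rw [Finsupp.prod_single_index (by simp), Units.val_pow_eq_pow_val, Derivation.leibniz_pow, P.D_t]
    split_ifs with h
    · subst h
      rcases k with _ | k
      · simp
      · rw [Finsupp.single_eq_same, nsmul_eq_mul, smul_eq_mul,
          Nat.add_sub_cancel, pow_succ]
    · rw [Finsupp.single_eq_of_ne h]; simp

theorem D_pow_mul_prod (i : I) (g : K) (α : I →₀ ℕ) :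
    P.D i (g ^ p * (α.prod fun j k => P.t j ^ k : Kˣ)) =
      α i * (g ^ p * (α.prod fun j k => P.t j ^ k : Kˣ)) := by
  rw [derivation_pow_char_mul, D_prod]; ring

theorem mem_closure_eigen (i : I) (f : K) :
    f ∈ AddSubgroup.closure {x : K | ∃ k : ℕ, P.D i x = k * x} := by
  refine AddSubgroup.closure_mono ?_ (P.span f)
  rintro x ⟨g, α, rfl⟩
  exact ⟨α i, P.D_pow_mul_prod i g α⟩

/-- The derivation `D_i` as an additive endomorphism. -/
abbrev E (i : I) : Module.End ℤ K := (P.D i : K →ₗ[ℤ] K)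

theorem E_pow (i : I) : P.E i ^ p = P.E i := by
  ext f
  induction P.mem_closure_eigen i f using AddSubgroup.closure_induction with
  | mem x hx =>
    obtain ⟨k, hk⟩ := hx
    rw [derivation_pow_apply_of_eigen _ hk, natCast_pow_char]
    exact hk.symm
  | zero => simp
  | add x y _ _ hx hy => rw [map_add, map_add, hx, hy]
  | neg x _ hx => rw [map_neg, map_neg, hx]

theorem E_commute (i j : I) : Commute (P.E i) (P.E j) := by
  ext f; exact P.comm i j f

/-- The projection to the constants of `D_i`. -/
abbrev q (i : I) : Module.End ℤ K := constProj p (P.D i)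

theorem q_commute_E (i j : I) : Commute (P.q i) (P.E j) :=
  (Commute.one_left _).sub_left ((P.E_commute i j).pow_left _)

theorem q_commute (i j : I) : Commute (P.q i) (P.q j) :=
  (Commute.one_right _).sub_right ((P.q_commute_E i j).pow_right _)

theorem D_q (i j : I) (f : K) : P.D j (P.q i f) = P.q i (P.D j f) :=
  (LinearMap.congr_fun (P.q_commute_E i j) f).symm

theorem D_q_self (i : I) (f : K) : P.D i (P.q i f) = 0 := by
  have h : P.E i * P.q i = 0 := by
    change P.E i * (1 - P.E i ^ (p - 1)) = 0
    rw [mul_sub, mul_one, ← pow_succ', Nat.sub_add_cancel hp.out.one_lt.le, E_pow,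
      sub_self]
  exact LinearMap.congr_fun h f

theorem q_D_self (i : I) (f : K) : P.q i (P.D i f) = 0 := by
  rw [← D_q, D_q_self]

theorem q_mul {i : I} {c : K} (hc : P.D i c = 0) (f : K) : P.q i (c * f) = c * P.q i f := by
  have h : ∀ m : ℕ, (P.E i ^ m) (c * f) = c * (P.E i ^ m) f := by
    intro m
    induction m with
    | zero => simp
    | succ m ih =>
      rw [pow_succ', Module.End.mul_apply, ih, Module.End.mul_apply]
      change P.D i _ = c * P.D i _
      rw [Derivation.leibniz, hc]; simp
  rw [constProj_apply, h, constProj_apply, mul_sub]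

theorem sub_q_mem (i : I) (f : K) : ∃ g, f - P.q i f = P.D i g := by
  refine ⟨(P.E i ^ (p - 2)) f, ?_⟩
  have h : P.E i * P.E i ^ (p - 2) = P.E i ^ (p - 1) := by
    rw [← pow_succ']; congr 1; have := hp.out.two_le; omega
  rw [constProj_apply, sub_sub_cancel, ← h]
  rfl

/-- A closed form may be made constant along any finite set of coordinates by an exact form. -/
theorem exists_const_along (s : Finset I) {w : Form I K} (hw : P.d w = 0) :
    ∃ w' v, w = w' + P.d v ∧ P.d w' = 0 ∧
      (∀ i ∈ s, ∀ S, P.D i (w' S) = 0) ∧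
      ∀ i, (∀ S, P.D i (w S) = 0) → ∀ S, P.D i (w' S) = 0 := by
  induction s using Finset.induction_on with
  | empty => exact ⟨w, 0, by simp, hw, by simp, fun i h => h⟩
  | insert i s hi ih =>
    obtain ⟨w', v, h1, h2, h3, h4⟩ := ih
    have hp2 : P.E i * P.E i ^ (p - 2) = P.E i ^ (p - 1) := by
      rw [← pow_succ']; congr 1; have := hp.out.two_le; omega
    set u := Form.map I ((P.E i ^ (p - 2) : Module.End ℤ K) : K →+ K) w' with hu
    have hdu : P.d u = 0 := by
      rw [hu, LogDer.d_map_comm, h2, map_zero]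
      intro j a
      exact (LinearMap.congr_fun ((P.E_commute i j).pow_left (p - 2)) a).symm
    have hE := P.d_contractVar i u
    rw [hdu, map_zero, add_zero] at hE
    have hq : w' = Form.map I ((P.q i : Module.End ℤ K) : K →+ K) w' + P.d (contractVar K i u) := by
      rw [hE]
      ext S
      change w' S = P.q i (w' S) + P.D i ((P.E i ^ (p - 2)) (w' S))
      have : P.D i ((P.E i ^ (p - 2)) (w' S)) = (P.E i ^ (p - 1)) (w' S) := by rw [← hp2]; rfl
      rw [this, constProj_apply, sub_add_cancel]
    refine ⟨Form.map I ((P.q i : Module.End ℤ K) : K →+ K) w', v + contractVar K i u, ?_, ?_, ?_, ?_⟩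
    · rw [h1, map_add]
      nth_rw 1 [hq]
      abel
    · rw [LogDer.d_map_comm, h2, map_zero]
      exact fun j a => P.D_q i j a
    · intro j hj S
      change P.D j (P.q i (w' S)) = 0
      rcases Finset.mem_insert.1 hj with rfl | hj
      · exact P.D_q_self _ _
      · rw [D_q, h3 j hj, map_zero]
    · intro j hj S
      change P.D j (P.q i (w' S)) = 0
      rw [D_q, h4 j hj, map_zero]

/-- The Cartier isomorphism: modulo exact forms, a closed form is of the form `∑ u_S^p dlog t_S`. -/
theorem exists_frobenius_add_d {w : Form I K} (hw : P.d w = 0) :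
    ∃ u v, w = Form.map I (frobenius K p : K →+ K) u + P.d v := by
  classical
  obtain ⟨w', v, h1, -, h3, h4⟩ :=
    P.exists_const_along (w.support.biUnion fun S => (P.grad (w S)).support) hw
  have h5 : ∀ i S, P.D i (w' S) = 0 := by
    intro i
    by_cases hi : i ∈ w.support.biUnion fun S => (P.grad (w S)).support
    · exact h3 i hi
    · refine h4 i fun S => ?_
      by_contra hS
      apply hi
      rw [Finset.mem_biUnion]
      refine ⟨S, ?_, ?_⟩
      · rw [Finsupp.mem_support_iff]; rintro h0; rw [h0, map_zero] at hS; exact hS rfl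
      · rw [Finsupp.mem_support_iff]; exact hS
  choose g hg using fun S => P.exists_pow (w' S) fun i => h5 i S
  refine ⟨Finsupp.onFinset w'.support g fun S hS => ?_, v, ?_⟩
  · rw [Finsupp.mem_support_iff, hg]; exact pow_ne_zero _ hS
  · rw [h1]
    congr 1
    ext S
    exact hg S

/-- The group of exact functions `∑ D_i(f_i)`. -/
def exactFun : AddSubgroup K := AddSubgroup.closure {x | ∃ i f, x = P.D i f}

theorem pow_mul_mem_exactFun (x : K) {f : K} (hf : f ∈ P.exactFun) : x ^ p * f ∈ P.exactFun := by
  induction hf using AddSubgroup.closure_induction with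
  | mem y hy =>
    obtain ⟨i, f, rfl⟩ := hy
    exact AddSubgroup.subset_closure ⟨i, x ^ p * f, (derivation_pow_char_mul _ _ _).symm⟩
  | zero => rw [mul_zero]; exact zero_mem _
  | add y z _ _ hy hz => rw [mul_add]; exact add_mem hy hz
  | neg y _ hy => rw [mul_neg]; exact neg_mem hy

theorem one_notMem_exactFun : (1 : K) ∉ P.exactFun := by
  have hcomm : ∀ (l : List I) (i : I), Commute ((l.map P.q).prod) (P.q i) := fun l i =>
    Commute.list_prod_left _ _ (by
      intro x hx
      obtain ⟨j, -, rfl⟩ := List.mem_map.1 hx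
      exact P.q_commute j i)
  have hcomm2 : ∀ l l' : List I, Commute ((l.map P.q).prod) ((l'.map P.q).prod) := fun l l' =>
    Commute.list_prod_right _ _ (by
      intro x hx
      obtain ⟨j, -, rfl⟩ := List.mem_map.1 hx
      exact hcomm l j)
  have hone : ∀ l : List I, (l.map P.q).prod 1 = 1 := by
    intro l
    induction l with
    | nil => simp
    | cons i l ih =>
      rw [List.map_cons, List.prod_cons, Module.End.mul_apply, ih,
        constProj_apply_of_eq_zero _ (Derivation.map_one_eq_zero _)]
  -- a product of projections kills a given exact function, but preserves `1`
  have key : ∀ f ∈ P.exactFun, ∃ l : List I, (l.map P.q).prod f = 0 := by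
    intro f hf
    induction hf using AddSubgroup.closure_induction with
    | mem y hy =>
      obtain ⟨i, f, rfl⟩ := hy
      exact ⟨[i], by simpa using P.q_D_self i f⟩
    | zero => exact ⟨[], by simp⟩
    | add y z _ _ hy hz =>
      obtain ⟨l, hl⟩ := hy
      obtain ⟨l', hl'⟩ := hz
      refine ⟨l ++ l', ?_⟩
      rw [List.map_append, List.prod_append, map_add, (hcomm2 l l').eq, Module.End.mul_apply, hl,
        (hcomm2 l' l).eq, Module.End.mul_apply, hl']
      simp
    | neg y _ hy =>
      obtain ⟨l, hl⟩ := hy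
      exact ⟨l, by rw [map_neg, hl, neg_zero]⟩
  intro h
  obtain ⟨l, hl⟩ := key 1 h
  rw [hone] at hl
  exact one_ne_zero hl

theorem pow_notMem_exactFun {x : K} (hx : x ≠ 0) : x ^ p ∉ P.exactFun := by
  intro h
  have := P.pow_mul_mem_exactFun x⁻¹ h
  rw [← mul_pow, inv_mul_cancel₀ hx, one_pow] at this
  exact P.one_notMem_exactFun this

end PCoord

/-! ### Forms fixed by the inverse Cartier operator are logarithmic -/

/-- The colexicographic order on the finite subsets of a well-ordered set is a well-order. -/
theorem wellFounded_colex_finset (I : Type*) [LinearOrder I] [WellFoundedLT I] :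
    WellFounded fun S T : Finset I => toColex S < toColex T := by
  classical
  let f : Finset I → Colex (I →₀ ℕ) := fun S => toColex (Finsupp.indicator S fun _ _ => 1)
  have hf : ∀ S T : Finset I, toColex S < toColex T → f S < f T := by
    intro S T h
    obtain ⟨w, hw, h⟩ := Finset.Colex.lt_iff_exists_filter_lt.1 h
    rw [Finsupp.Colex.lt_iff]
    refine ⟨w, fun j hj => ?_, ?_⟩
    · have h2 := Finset.ext_iff.1 h j
      simp only [Finset.mem_filter, hj, and_true] at h2
      change Finsupp.indicator S (fun _ _ => 1) j = Finsupp.indicator T (fun _ _ => 1) j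
      simp only [Finsupp.indicator_apply, dite_eq_ite]
      by_cases hS : j ∈ S
      · rw [if_pos hS, if_pos (h2.1 hS)]
      · rw [if_neg hS, if_neg fun hT => hS (h2.2 hT)]
    · change Finsupp.indicator S (fun _ _ => 1) w < Finsupp.indicator T (fun _ _ => 1) w
      rw [Finset.mem_sdiff] at hw
      simp [Finsupp.indicator_apply, hw.1, hw.2]
  exact Subrelation.wf (fun {S T} h => hf S T h) (InvImage.wf f (wellFounded_lt))

namespace PCoord

variable {p : ℕ} [hp : Fact p.Prime] {I : Type*} [LinearOrder I] {K : Type*} [Field K] [CharP K p]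
  (P : PCoord p I K)

/-- `D_i(a)` is a combination of derivatives with respect to later variables from `S`. For the
leading coefficient `a` of a closed form with leading index `S`, this holds for all `i ∉ S`. -/
def TailExact (S : Finset I) (a : K) : Prop :=
  ∀ i ∉ S, P.D i a ∈ AddSubgroup.closure {x | ∃ s ∈ S, i < s ∧ ∃ y, x = P.D s y}

/-- A leading coefficient that is fixed by the Cartier operator is a product of logarithmic
derivatives, the `s`-th one of a function that does not depend on the variables beyond `s`. -/
theorem exists_eq_prod_logDeriv (hroot : ∀ x : K, ∃ y, y ^ (p - 1) = x) (S : Finset I) :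
    ∀ a : K, a ≠ 0 → a ^ p - a ∈ P.exactFun → P.TailExact S a →
      ∃ (k : ℕ) (c : I → Kˣ), (∀ s ∈ S, ∀ i, s < i → P.D i (c s) = 0) ∧
        a = k * ∏ s ∈ S, P.D s (c s) / c s := by
  induction S using Finset.induction_on_max with
  | empty =>
    intro a ha hap hS
    have h0 : ∀ i, P.D i a = 0 := fun i => by simpa using hS i (Finset.notMem_empty i)
    -- `a = x^p` with `(x^p - x)^p` exact, so `x^p = x` and `a` belongs to the prime field
    obtain ⟨x, rfl⟩ := P.exists_pow a h0
    have h1 : (x ^ p) ^ p = x ^ p := by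
      rw [← sub_pow_char] at hap
      by_contra hne
      refine P.pow_notMem_exactFun (x := x ^ p - x) (fun h => hne ?_) hap
      conv_rhs => rw [← sub_eq_zero.1 h]
    obtain ⟨k, y, hy, hxy, -⟩ := exists_eigenvector (p := p) (LinearMap.mulLeft ℤ (x ^ p))
      one_ne_zero (by rw [LinearMap.pow_mulLeft, h1])
    refine ⟨k, fun _ => 1, by simp, ?_⟩
    simpa using mul_right_cancel₀ hy hxy
  | insert m T hmax ih =>
    intro a ha hap hS
    have hmT : m ∉ T := fun h => lt_irrefl _ (hmax m h)
    have hgt : ∀ i, m < i → P.D i a = 0 := by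
      intro i hi
      have hiS : i ∉ insert m T := by
        rw [Finset.mem_insert]
        rintro (rfl | h)
        · exact lt_irrefl _ hi
        · exact lt_asymm hi (hmax i h)
      have := hS i hiS
      have hempty : {x | ∃ s ∈ insert m T, i < s ∧ ∃ y, x = P.D s y} = ∅ := by
        rw [Set.eq_empty_iff_forall_notMem]
        rintro x ⟨s, hs, his, -⟩
        rcases Finset.mem_insert.1 hs with rfl | hs
        · exact lt_asymm hi his
        · exact lt_asymm (hi.trans his) (hmax s hs)
      rw [hempty] at this
      simpa using this
    -- `b` is the part of `a` that is constant along the largest variable `m`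
    set b := P.q m a with hb
    obtain ⟨f, hf⟩ := P.sub_q_mem m a
    have hexf : P.D m f ∈ P.exactFun := AddSubgroup.subset_closure ⟨m, f, rfl⟩
    have hb0 : b ≠ 0 := by
      intro h0
      apply P.pow_notMem_exactFun ha
      rw [← hb, h0, sub_zero] at hf
      have := add_mem hap hexf
      rwa [← hf, sub_add_cancel] at this
    have hDb : ∀ i, m ≤ i → P.D i b = 0 := by
      intro i hi
      rcases hi.eq_or_lt with rfl | hi
      · exact P.D_q_self _ _
      · rw [hb, D_q, hgt i hi, map_zero]
    -- `u` is chosen so that `g = a / u` satisfies `g^p = q_m(g)`: then `g = D_m(c) / c` by Cartier's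
    -- theorem, and `u` does not depend on `m`
    obtain ⟨u, hu⟩ := hroot (a ^ p / b)
    have hu0 : u ≠ 0 := by
      rintro rfl
      rw [zero_pow (by have := hp.out.two_le; omega)] at hu
      exact div_ne_zero (pow_ne_zero _ ha) hb0 hu.symm
    have hup : u ^ p * b = u * a ^ p := by
      have : u ^ p = u ^ (p - 1) * u := by
        rw [← pow_succ, Nat.sub_add_cancel hp.out.one_lt.le]
      rw [this, hu]; field_simp
    have hub : u = (u / a) ^ p * b := by
      rw [div_pow]; field_simp; linear_combination -hup
    have hDu : ∀ i, m ≤ i → P.D i u = 0 := by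
      intro i hi
      rw [hub, derivation_pow_char_mul, hDb i hi, mul_zero]
    have hg1 : constProj p (P.D m) (a / u) = (a / u) ^ p := by
      have hinv : P.D m u⁻¹ = 0 := by rw [Derivation.leibniz_inv, hDu m le_rfl]; simp
      have h2 : constProj p (P.D m) (a / u) = u⁻¹ * b := by
        rw [div_eq_inv_mul]; exact P.q_mul hinv a
      rw [h2, div_pow]; field_simp; linear_combination hup
    obtain ⟨c, hc0, hDc, hc⟩ := exists_logDeriv_eq (P.D m) (P.E_pow m) (P.t m).ne_zero
      (by rw [P.D_t, if_pos rfl]) (P.mem_closure_eigen m (a / u)) hg1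
    -- `u` satisfies the hypotheses with respect to `T`
    have hup' : u ^ p - u = (u / a) ^ p * ((a ^ p - a) + P.D m f) := by
      rw [← hf, sub_add_sub_cancel, mul_sub, ← hub, div_pow, div_mul_cancel₀ _ (pow_ne_zero _ ha)]
    have htail : P.TailExact T u := by
      intro i hi
      by_cases him : m ≤ i
      · rw [hDu i him]; exact zero_mem _
      · rw [not_le] at him
        have h1 := hS i (by rw [Finset.mem_insert]; rintro (rfl | h); exacts [lt_irrefl _ him, hi h])
        rw [hub, derivation_pow_char_mul, hb, D_q]
        generalize P.D i a = y at h1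
        induction h1 using AddSubgroup.closure_induction with
        | mem x hx =>
          obtain ⟨s, hs, his, y, rfl⟩ := hx
          rcases Finset.mem_insert.1 hs with rfl | hs
          · rw [q_D_self, mul_zero]; exact zero_mem _
          · refine AddSubgroup.subset_closure ⟨s, hs, his, (u / a) ^ p * P.q m y, ?_⟩
            rw [derivation_pow_char_mul, D_q]
        | zero => rw [map_zero, mul_zero]; exact zero_mem _
        | add x y _ _ hx hy => rw [map_add, mul_add]; exact add_mem hx hy
        | neg x _ hx => rw [map_neg, mul_neg]; exact neg_mem hx
    obtain ⟨k, c', hc', huc⟩ := ih u hu0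
      (hup' ▸ P.pow_mul_mem_exactFun _ (add_mem hap hexf)) htail
    refine ⟨k, Function.update c' m (Units.mk0 c hc0), ?_, ?_⟩
    · intro s hs i hi
      rcases Finset.mem_insert.1 hs with rfl | hs
      · rw [Function.update_self, Units.val_mk0]
        refine hc (P.D i) (fun x => P.comm _ _ _) ?_ ?_
        · rw [Derivation.leibniz_div, hgt i hi, hDu i hi.le]; simp
        · rw [P.D_t, if_neg hi.ne']
      · rw [Function.update_of_ne (hmax s hs).ne]
        exact hc' s hs i hi
    · rw [Finset.prod_insert hmT, Function.update_self, Units.val_mk0, hDc,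
        mul_div_cancel_right₀ _ hc0, Finset.prod_congr rfl fun s hs => by
          rw [Function.update_of_ne (hmax s hs).ne]]
      rw [mul_left_comm, ← huc, div_mul_cancel₀ _ hu0]

/-- The group of logarithmic forms, generated by the products `dlog b_1 ∧ ⋯ ∧ dlog b_n`. -/
def logForm : AddSubgroup (Form I K) :=
  AddSubgroup.closure {w | ∃ (n : ℕ) (b : Fin n → Kˣ), w = wedgeMulti I K n fun j => P.dlog (b j)}

/-- The product of the forms `dlog c_s`, `s ∈ S`, has leading index `S` for the colexicographic order,
and its leading coefficient is the product of the diagonal entries of a triangular matrix. -/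
theorem exists_logForm_leading (S : Finset I) (c : I → Kˣ)
    (hc : ∀ s ∈ S, ∀ i, s < i → P.D i (c s) = 0) :
    ∃ (n : ℕ) (b : Fin n → Kˣ),
      (∀ S', wedgeMulti I K n (fun j => P.dlog (b j)) S' ≠ 0 → toColex S' ≤ toColex S) ∧
      wedgeMulti I K n (fun j => P.dlog (b j)) S = ∏ s ∈ S, P.D s (c s) / c s := by
  induction S using Finset.induction_on_max with
  | empty =>
    refine ⟨0, Fin.elim0, ?_, ?_⟩
    · intro S' hS'
      rw [wedgeMulti_zero] at hS'
      by_contra h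
      apply hS'
      rw [Finsupp.single_eq_of_ne]
      rintro rfl
      exact h le_rfl
    · rw [wedgeMulti_zero]; simp
  | insert m T hmax ih =>
    have hmT : m ∉ T := fun h => lt_irrefl _ (hmax m h)
    obtain ⟨n, b, h1, h2⟩ := ih fun s hs => hc s (Finset.mem_insert_of_mem hs)
    have hval : ∀ S', wedgeMulti I K (n + 1)
        (fun j => P.dlog (Fin.cons (α := fun _ => Kˣ) (c m) b j)) S' =
          ∑ i ∈ S', shuffleSign i S' • (P.dlog (c m) i *
            wedgeMulti I K n (fun j => P.dlog (b j)) (S'.erase i)) := by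
      intro S'
      rw [wedgeMulti_succ]
      simp only [Fin.cons_zero, Fin.cons_succ]
      rw [wedge_apply, Finsupp.sum, Finsupp.finsetSum_apply]
      refine Finset.sum_congr_of_eq_on_inter ?_ ?_ ?_
      · intro i _ hi
        simp [wedgeVar_apply, hi]
      · intro i _ hi
        rw [Finsupp.notMem_support_iff.1 hi]; simp
      · intro i _ hi
        rw [Finsupp.smul_apply, wedgeVar_apply, if_pos hi, smul_eq_mul, mul_smul_comm]
    have hdl : ∀ i, m < i → P.dlog (c m) i = 0 := by
      intro i hi
      simp [LogDer.dlog, LogDer.grad_apply, hc m (Finset.mem_insert_self _ _) i hi]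
    refine ⟨n + 1, Fin.cons (α := fun _ => Kˣ) (c m) b, ?_, ?_⟩
    · intro S' hS'
      rw [hval] at hS'
      obtain ⟨i, hi, hne⟩ := Finset.exists_ne_zero_of_sum_ne_zero hS'
      have him : i ≤ m := by
        by_contra h
        rw [hdl i (not_le.1 h)] at hne; simp at hne
      have hle := h1 (S'.erase i) (by intro h; rw [h] at hne; simp at hne)
      rcases him.eq_or_lt with rfl | him
      · rw [Finset.Colex.toColex_le_toColex] at hle ⊢
        intro a haS ha
        rw [Finset.mem_insert, not_or] at ha
        obtain ⟨b, hb, hb2, hab⟩ := hle (Finset.mem_erase.2 ⟨ha.1, haS⟩) ha.2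
        refine ⟨b, Finset.mem_insert_of_mem hb, fun hb3 => hb2 (Finset.mem_erase.2 ⟨?_, hb3⟩), hab⟩
        exact (hmax b hb).ne
      · have hlt := Finset.Colex.forall_lt_mono hle hmax
        rw [Finset.Colex.toColex_le_toColex]
        have hS'm : ∀ a ∈ S', a < m := by
          intro a ha
          by_cases hai : a = i
          · rwa [hai]
          · exact hlt a (Finset.mem_erase.2 ⟨hai, ha⟩)
        intro a haS _
        exact ⟨m, Finset.mem_insert_self _ _, fun h => lt_irrefl _ (hS'm m h), (hS'm a haS).le⟩
    · rw [hval, Finset.sum_insert hmT, Finset.erase_insert hmT, h2, Finset.prod_insert hmT,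
        shuffleSign_of_forall_le, Finset.sum_eq_zero, add_zero, one_smul]
      · congr 1
        simp [LogDer.dlog, LogDer.grad_apply, div_eq_inv_mul]
      · intro i hi
        -- removing `i < m` from `T ∪ {m}` gives a set beyond `T`
        have : wedgeMulti I K n (fun j => P.dlog (b j)) ((insert m T).erase i) = 0 := by
          by_contra hne
          have := Finset.Colex.forall_lt_mono (h1 _ hne) hmax m
            (Finset.mem_erase.2 ⟨(hmax i hi).ne', Finset.mem_insert_self _ _⟩)
          exact lt_irrefl _ this
        rw [this]; simp
      · intro s hs
        rcases Finset.mem_insert.1 hs with rfl | hs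
        exacts [le_rfl, (hmax s hs).le]

theorem tailExact_of_closed {w : Form I K} (hw : P.d w = 0) {S : Finset I}
    (hS : ∀ S', w S' ≠ 0 → toColex S' ≤ toColex S) : P.TailExact S (w S) := by
  intro i hi
  have h1 : P.d w (insert i S) = 0 := by rw [hw]; rfl
  rw [LogDer.d_apply, Finset.sum_insert hi, Finset.erase_insert hi] at h1
  have h2 : ∑ s ∈ S, shuffleSign s (insert i S) • P.D s (w ((insert i S).erase s)) ∈
      AddSubgroup.closure {x | ∃ s ∈ S, i < s ∧ ∃ y, x = P.D s y} := by
    refine AddSubgroup.sum_mem _ fun s hs => ?_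
    rcases lt_trichotomy i s with h | rfl | h
    · refine AddSubgroup.zsmul_mem _ ?_ _
      exact AddSubgroup.subset_closure ⟨s, hs, h, _, rfl⟩
    · exact absurd hs hi
    · have : w ((insert i S).erase s) = 0 := by
        by_contra hne
        have hle := hS _ hne
        rw [Finset.Colex.toColex_le_toColex] at hle
        obtain ⟨b, hb, hb2, hib⟩ := hle
          (Finset.mem_erase.2 ⟨h.ne', Finset.mem_insert_self _ _⟩) hi
        apply hb2
        exact Finset.mem_erase.2 ⟨(h.trans_le hib).ne', Finset.mem_insert_of_mem hb⟩
      rw [this, map_zero, smul_zero]; exact zero_mem _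
  have h3 : P.D i (w S) = -(shuffleSign i (insert i S) •
      ∑ s ∈ S, shuffleSign s (insert i S) • P.D s (w ((insert i S).erase s))) := by
    rw [eq_neg_of_add_eq_zero_right h1, smul_neg, smul_smul, shuffleSign_mul_self, one_smul, neg_neg]
  rw [h3]
  exact neg_mem (zsmul_mem h2 _)

theorem d_map_frobenius (w : Form I K) : P.d (Form.map I (frobenius K p : K →+ K) w) = 0 := by
  rw [LogDer.d_map P.toLogDer P.toLogDer (frobenius K p) 0, zero_smul]
  intro i a
  rw [frobenius_def, derivation_pow_char, zero_mul]

/-- The theorem of Bloch, Gabber and Kato on the surjectivity of the differential symbol: a form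
that is fixed by the inverse Cartier operator modulo exact forms is logarithmic. Here the field is
assumed to be closed under taking `(p-1)`-th roots. The hypothesis `hlog` says that the inverse
Cartier operator fixes `dlog b` modulo exact forms. -/
theorem mem_logForm [WellFoundedLT I] (hroot : ∀ x : K, ∃ y, y ^ (p - 1) = x)
    (hlog : ∀ b : Kˣ, ∃ l, (P.dlog b).mapRange (frobenius K p) (map_zero _) =
      P.dlog b + P.grad l)
    {w z : Form I K} (hw : Form.map I (frobenius K p : K →+ K) w = w + P.d z) :
    w ∈ P.logForm := by
  have hlog' : ∀ (n : ℕ) (b : Fin n → Kˣ), ∃ ξ, Form.map I (frobenius K p : K →+ K)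
      (wedgeMulti I K n fun j => P.dlog (b j)) =
        wedgeMulti I K n (fun j => P.dlog (b j)) + P.d ξ := by
    intro n b
    choose l hl using fun j => hlog (b j)
    obtain ⟨ξ, hξ⟩ := P.wedgeMulti_add_grad (fun j => P.isClosedCov_dlog (b j)) l
    refine ⟨ξ, ?_⟩
    rw [Form.map_wedgeMulti, ← hξ]
    simp only [hl]
  have key : ∀ T : Finset I, ∀ w z : Form I K,
      Form.map I (frobenius K p : K →+ K) w = w + P.d z →
      (∀ S, w S ≠ 0 → toColex S ≤ toColex T) → w ∈ P.logForm := by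
    intro T
    induction T using (wellFounded_colex_finset I).induction with
    | _ T ih =>
    -- a form without a term of index `T` has a smaller leading index
    have red : ∀ w z : Form I K, Form.map I (frobenius K p : K →+ K) w = w + P.d z →
        (∀ S, w S ≠ 0 → toColex S ≤ toColex T) → w T = 0 → w ∈ P.logForm := by
      intro w z hw hle hT
      by_cases h0 : w.support = ∅
      · rw [Finsupp.support_eq_empty.1 h0]; exact zero_mem _
      · obtain ⟨S, hS, hmax⟩ := Finset.exists_max_image w.support toColex
          (Finset.nonempty_iff_ne_empty.2 h0)
        rw [Finsupp.mem_support_iff] at hS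
        refine ih S ((hle S hS).lt_of_ne ?_) w z hw fun S' hS' => hmax S' (by simpa using hS')
        intro h
        rw [toColex_inj.1 h] at hS
        exact hS hT
    intro w z hw hle
    by_cases hT : w T = 0
    · exact red w z hw hle hT
    · have hdw : P.d w = 0 := by
        have := P.d_map_frobenius w
        rwa [hw, map_add, LogDer.d_d, add_zero] at this
      have hex : w T ^ p - w T ∈ P.exactFun := by
        have h1 := DFunLike.congr_fun hw T
        change w T ^ p = w T + P.d z T at h1
        rw [h1, add_sub_cancel_left, LogDer.d_apply]
        refine AddSubgroup.sum_mem _ fun i _ => AddSubgroup.zsmul_mem _ ?_ _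
        exact AddSubgroup.subset_closure ⟨i, _, rfl⟩
      obtain ⟨k, c, hc, hk⟩ := P.exists_eq_prod_logDeriv hroot T (w T) hT hex
        (P.tailExact_of_closed hdw hle)
      obtain ⟨n, b, hb1, hb2⟩ := P.exists_logForm_leading T c hc
      set η := wedgeMulti I K n fun j => P.dlog (b j) with hη
      have hηmem : η ∈ P.logForm := AddSubgroup.subset_closure ⟨n, b, rfl⟩
      obtain ⟨ξ, hξ⟩ := hlog' n b
      have hsub : w - k • η ∈ P.logForm := by
        refine red _ (z - k • ξ) ?_ ?_ ?_
        · rw [map_sub, map_nsmul, hw, hξ, map_sub, map_nsmul, smul_add]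
          abel
        · intro S hS
          by_cases hwS : w S = 0
          · refine hb1 S fun h => hS ?_
            rw [Finsupp.sub_apply, Finsupp.smul_apply, hwS, hη, h]; simp
          · exact hle S hwS
        · rw [Finsupp.sub_apply, Finsupp.smul_apply, hη, hb2, nsmul_eq_mul, ← hk, sub_self]
      have := add_mem hsub (nsmul_mem hηmem k)
      rwa [sub_add_cancel] at this
  by_cases h0 : w.support = ∅
  · rw [Finsupp.support_eq_empty.1 h0]; exact zero_mem _
  · obtain ⟨S, hS, hmax⟩ := Finset.exists_max_image w.support toColex
      (Finset.nonempty_iff_ne_empty.2 h0)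
    exact key S w z hw fun S' hS' => hmax S' (by simpa using hS')

end PCoord

/-! ### Lifts of a field with a lift of Frobenius -/

theorem Finsupp.exists_eq_smul {α A : Type*} [CommRing A] (m : A) (v : α →₀ A)
    (h : ∀ i, ∃ y, v i = m * y) : ∃ r : α →₀ A, v = m • r := by
  classical
  choose y hy using h
  refine ⟨Finsupp.onFinset v.support (fun i => if v i = 0 then 0 else y i) fun i hi => ?_, ?_⟩
  · rw [Finsupp.mem_support_iff]; rintro h0; exact hi (if_pos h0)
  · ext i
    rw [Finsupp.smul_apply, Finsupp.onFinset_apply, smul_eq_mul]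
    split_ifs with h0
    · rw [h0, mul_zero]
    · exact hy i

theorem wedgeMulti_add_smul {I A : Type*} [LinearOrder I] [CommRing A] (m : A) {n : ℕ}
    (v r : Fin n → (I →₀ A)) :
    ∃ s, wedgeMulti I A n (fun j => v j + m • r j) = wedgeMulti I A n v + m • s := by
  induction n with
  | zero => exact ⟨0, by rw [wedgeMulti_zero, wedgeMulti_zero, smul_zero, add_zero]⟩
  | succ n ih =>
    obtain ⟨s, hs⟩ := ih (fun j => v j.succ) fun j => r j.succ
    refine ⟨wedge I A (v 0) s + wedge I A (r 0) (wedgeMulti I A n (fun j => v j.succ) + m • s), ?_⟩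
    rw [wedgeMulti_succ, wedgeMulti_succ, hs, map_add, map_smul]
    simp only [LinearMap.add_apply, LinearMap.smul_apply, map_add, map_smul, smul_add]
    abel

/-- A lift modulo `p^L` of a field `K` with coordinates: a `ℤ/p^L`-flat ring `A` with `A/p = K`,
lifts `T_i ∂/∂T_i` of the derivations of `K`, and a lift `φ` of the Frobenius endomorphism with
`φ(T_i) = T_i^p`; the last condition is expressed by the relation of `φ` with the derivations. -/
structure FrobLift {p : ℕ} {I : Type*} {K : Type*} [Field K] [LinearOrder I]
    (P : PCoord p I K) (L : ℕ) (A : Type*) [CommRing A] extends LogDer I A where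
  /-- the reduction modulo `p` -/
  π : A →+* K
  /-- the lift of Frobenius -/
  φ : A →+* A
  π_surjective : Function.Surjective π
  exists_of_π_eq_zero : ∀ x, π x = 0 → ∃ y, x = p * y
  p_pow_eq_zero : (p : A) ^ L = 0
  exists_of_p_mul_eq_zero : ∀ x, (p : A) * x = 0 → ∃ y, x = p ^ (L - 1) * y
  φ_eq : ∀ x, ∃ y, φ x = x ^ p + p * y
  D_φ : ∀ i x, D i (φ x) = p * φ (D i x)
  π_D : ∀ i x, π (D i x) = P.D i (π x)

namespace FrobLift

variable {p : ℕ} [hp : Fact p.Prime] {I : Type*} [LinearOrder I] {K : Type*} [Field K] [CharP K p]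
  {P : PCoord p I K} {L : ℕ} {A : Type*} [CommRing A] (Q : FrobLift P L A)

theorem π_p : Q.π (p : A) = 0 := by rw [map_natCast, CharP.cast_eq_zero]

theorem exists_eq_of_p_mul_eq (Q : FrobLift P L A) {x y : A} {k : ℕ} (hk : k + 1 ≤ L)
    (h : (p : A) * x = p ^ (k + 1) * y) : ∃ z, x = p ^ k * z := by
  obtain ⟨z, hz⟩ := Q.exists_of_p_mul_eq_zero (x - p ^ k * y) (by
    rw [mul_sub, h]; ring)
  refine ⟨y + p ^ (L - 1 - k) * z, ?_⟩
  rw [mul_add, ← mul_assoc, ← pow_add, show k + (L - 1 - k) = L - 1 by omega, ← hz]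
  ring

theorem exists_form_eq_of_π_eq_zero {w : Form I A} (h : Form.map I (Q.π : A →+ K) w = 0) :
    ∃ w', w = (p : A) • w' :=
  Finsupp.exists_eq_smul _ _ fun S => Q.exists_of_π_eq_zero _ (DFunLike.congr_fun h S)

theorem exists_form_of_p_smul_eq (Q : FrobLift P L A) {x y : Form I A} {k : ℕ} (hk : k + 1 ≤ L)
    (h : (p : A) • x = (p : A) ^ (k + 1) • y) : ∃ z, x = (p : A) ^ k • z :=
  Finsupp.exists_eq_smul _ _ fun S =>
    Q.exists_eq_of_p_mul_eq hk (y := y S) (DFunLike.congr_fun h S)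

theorem map_π_surjective : Function.Surjective (Form.map I (Q.π : A →+ K)) :=
  Finsupp.mapRange_surjective _ (map_zero Q.π) Q.π_surjective

theorem π_φ (x : A) : Q.π (Q.φ x) = Q.π x ^ p := by
  obtain ⟨y, hy⟩ := Q.φ_eq x
  rw [hy, map_add, map_mul, π_p, map_pow, zero_mul, add_zero]

theorem map_π_map_φ (w : Form I A) : Form.map I (Q.π : A →+ K) (Form.map I (Q.φ : A →+ A) w) =
    Form.map I (frobenius K p : K →+ K) (Form.map I (Q.π : A →+ K) w) := by
  ext S; exact Q.π_φ _

theorem map_π_d (w : Form I A) : Form.map I (Q.π : A →+ K) (Q.d w) =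
    P.d (Form.map I (Q.π : A →+ K) w) := by
  rw [LogDer.d_map Q.toLogDer P.toLogDer Q.π 1, one_smul]
  intro i a; rw [Q.π_D, one_mul]

theorem d_map_φ (w : Form I A) : Q.d (Form.map I (Q.φ : A →+ A) w) =
    (p : A) • Form.map I (Q.φ : A →+ A) (Q.d w) :=
  LogDer.d_map Q.toLogDer Q.toLogDer Q.φ p Q.D_φ w

theorem isNilpotent_p (Q : FrobLift P L A) : IsNilpotent (p : A) := ⟨L, Q.p_pow_eq_zero⟩

theorem isUnit_of_π_ne_zero {x : A} (hx : Q.π x ≠ 0) : IsUnit x := by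
  obtain ⟨y, hy⟩ := Q.π_surjective (Q.π x)⁻¹
  obtain ⟨c, hc⟩ := Q.exists_of_π_eq_zero (x * y - 1) (by
    rw [map_sub, map_mul, hy, mul_inv_cancel₀ hx, map_one, sub_self])
  have h1 : IsUnit (x * y) := by
    rw [sub_eq_iff_eq_add.1 hc]
    exact ((Commute.all _ _).isNilpotent_mul_right Q.isNilpotent_p).isUnit_add_one
  exact isUnit_of_mul_isUnit_left h1

theorem exists_unit_lift (b : Kˣ) : ∃ u : Aˣ, Q.π u = b := by
  obtain ⟨x, hx⟩ := Q.π_surjective b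
  exact ⟨(Q.isUnit_of_π_ne_zero (x := x) (by rw [hx]; exact b.ne_zero)).unit, hx⟩

/-- A chosen lift of a unit. -/
def liftUnit (b : Kˣ) : Aˣ := (Q.exists_unit_lift b).choose

theorem π_liftUnit (b : Kˣ) : Q.π (Q.liftUnit b) = b := (Q.exists_unit_lift b).choose_spec

/-- The function `l = log(1 + pc) / p`, characterized by its differential. -/
theorem exists_log (c : A) : ∃ l, ∀ i, (1 + p * c) * Q.D i l = Q.D i c := by
  -- the coefficients `(-p)^k / (k + 1)` of the series are `p`-integral
  have he : ∀ k : ℕ, ∃ e : ℤ, ((k + 1 : ℕ) : A) * e = (-(p : A)) ^ k := by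
    intro k
    obtain ⟨v, m, hm, hkm⟩ := Nat.exists_eq_pow_mul_and_not_dvd (Nat.succ_ne_zero k) p
      hp.out.ne_one
    have hcop : Nat.Coprime m (p ^ L) :=
      ((Nat.Prime.coprime_iff_not_dvd hp.out).2 hm).symm.pow_right L
    obtain ⟨a, b, hab⟩ := Nat.isCoprime_iff_coprime.2 hcop
    have hma : (m : A) * a = 1 := by
      have h2 := congrArg (Int.cast : ℤ → A) hab
      push_cast at h2
      rw [Q.p_pow_eq_zero, mul_zero, add_zero] at h2
      rw [mul_comm, h2]
    have hv : v ≤ k := by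
      have h1 : p ^ v ≤ k + 1 := Nat.le_of_dvd (Nat.succ_pos k) ⟨m, hkm⟩
      have h2 : v < p ^ v := Nat.lt_pow_self hp.out.one_lt
      omega
    refine ⟨(-1) ^ k * p ^ (k - v) * a, ?_⟩
    have hkm' : ((k + 1 : ℕ) : A) = p ^ v * m := by
      rw [show k + 1 = p ^ v * m from hkm]; push_cast; ring
    rw [hkm', neg_pow (p : A) k]
    push_cast
    calc (p : A) ^ v * m * ((-1) ^ k * p ^ (k - v) * a)
        = (-1) ^ k * (p ^ v * p ^ (k - v)) * (m * a) := by ring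
      _ = _ := by rw [hma, ← pow_add, Nat.add_sub_cancel' hv, mul_one]
  choose e he using he
  refine ⟨∑ k ∈ Finset.range L, (e k : A) * c ^ (k + 1), fun i => ?_⟩
  have he0 : ∀ k, Q.D i ((e k : A) * c ^ (k + 1)) = (-((p : A) * c)) ^ k * Q.D i c := by
    intro k
    have h1 : (-((p : A) * c)) ^ k = ((k + 1 : ℕ) : A) * e k * c ^ k := by
      rw [he, ← mul_pow, neg_mul]
    rw [← zsmul_eq_mul, map_zsmul, Derivation.leibniz_pow, h1]
    simp only [smul_eq_mul, nsmul_eq_mul, zsmul_eq_mul, Nat.add_sub_cancel]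
    ring
  rw [map_sum, Finset.sum_congr rfl fun k _ => he0 k, ← Finset.sum_mul, ← mul_assoc]
  have hg := mul_neg_geom_sum (-((p : A) * c)) L
  rw [sub_neg_eq_add] at hg
  rw [hg, neg_pow, mul_pow, Q.p_pow_eq_zero, zero_mul, mul_zero, sub_zero, one_mul]

end FrobLift

/-! ### Forms on a lift modulo exact forms and the image of `φ - 1` -/

namespace FrobLift

variable {p : ℕ} [hp : Fact p.Prime] {I : Type*} [LinearOrder I] {K : Type*} [Field K] [CharP K p]
  {P : PCoord p I K} {L : ℕ} {A : Type*} [CommRing A] (Q : FrobLift P L A)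

theorem D_unit (i : I) (b : Aˣ) : Q.D i b = b * Q.dlog b i :=
  DFunLike.congr_fun (Q.grad_unit b) i

theorem exists_φ_unit (b : Aˣ) : ∃ c, Q.φ b = b ^ p * (1 + p * c) := by
  obtain ⟨y, hy⟩ := Q.φ_eq b
  refine ⟨(↑b⁻¹ : A) ^ p * y, ?_⟩
  have h1 : (b : A) ^ p * (↑b⁻¹ : A) ^ p = 1 := by rw [← mul_pow, Units.mul_inv, one_pow]
  rw [hy]
  linear_combination (-(p : A) * y) * h1

/-- Frobenius changes the logarithmic differential of a unit by an exact form: if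
`φ(b) = b^p (1 + pc)`, then `φ(dlog b) = dlog b + dl` with `l = log(1 + pc) / p`. Since `A` has
`p`-torsion, this holds modulo `p^(L-1)` only. -/
theorem map_φ_dlog (b : Aˣ) {c l : A} (hc : Q.φ b = b ^ p * (1 + p * c))
    (hl : ∀ i, (1 + p * c) * Q.D i l = Q.D i c) :
    ∃ r, (Q.dlog b).mapRange Q.φ (map_zero _) = Q.dlog b + Q.grad l + (p : A) ^ (L - 1) • r := by
  have key : ∀ i, ∃ y, ((Q.dlog b).mapRange Q.φ (map_zero _) - Q.dlog b - Q.grad l) i =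
      (p : A) ^ (L - 1) * y := by
    intro i
    apply Q.exists_of_p_mul_eq_zero
    have hu : IsUnit (Q.φ b) := b.isUnit.map Q.φ
    apply hu.mul_left_cancel
    have h1 := Q.D_φ i b
    rw [D_unit, map_mul, hc, Derivation.leibniz, map_add, Derivation.map_one_eq_zero,
      ← nsmul_eq_mul, map_nsmul, Derivation.leibniz_pow, D_unit, ← hl] at h1
    simp only [smul_eq_mul, nsmul_eq_mul] at h1
    rw [Finsupp.sub_apply, Finsupp.sub_apply, Finsupp.mapRange_apply, LogDer.grad_apply, hc]
    have h2 : (b : A) ^ (p - 1) * b = b ^ p := pow_sub_one_mul hp.out.ne_zero _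
    rw [← h2] at h1 ⊢
    linear_combination -h1
  obtain ⟨r, hr⟩ := Finsupp.exists_eq_smul _ _ key
  refine ⟨r, ?_⟩
  rw [← hr]
  abel

theorem dlog_eq_of_π_eq {b b' : Aˣ} (h : Q.π b = Q.π b') :
    ∃ l, Q.dlog b' = Q.dlog b + (p : A) • Q.grad l := by
  obtain ⟨y, hy⟩ := Q.exists_of_π_eq_zero (b' - b) (by rw [map_sub, h, sub_self])
  have hb' : (b' : A) = b * (1 + p * (↑b⁻¹ * y)) := by
    have h1 : (b : A) * ↑b⁻¹ = 1 := b.mul_inv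
    linear_combination hy - (p : A) * y * h1
  obtain ⟨l, hl⟩ := Q.exists_log (↑b⁻¹ * y)
  refine ⟨l, ?_⟩
  ext i
  apply b'.isUnit.mul_left_cancel
  rw [← D_unit, Finsupp.add_apply, Finsupp.smul_apply, smul_eq_mul, LogDer.grad_apply, hb',
    Derivation.leibniz, D_unit, map_add, Derivation.map_one_eq_zero, ← nsmul_eq_mul, map_nsmul,
    ← hl]
  simp only [smul_eq_mul, nsmul_eq_mul]
  ring

theorem π_dlog (b : Aˣ) (i : I) : Q.π (Q.dlog b i) = P.dlog (Units.map Q.π b) i := by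
  have h1 : (Units.map (Q.π : A →* K) b : K) * Q.π (Q.dlog b i) =
      Units.map (Q.π : A →* K) b * P.dlog (Units.map Q.π b) i := by
    have h2 : P.D i (Units.map (Q.π : A →* K) b) = _ :=
      DFunLike.congr_fun (P.grad_unit (Units.map (Q.π : A →* K) b)) i
    rw [Finsupp.smul_apply, smul_eq_mul] at h2
    rw [← h2]
    change Q.π b * _ = P.D i (Q.π b)
    rw [← Q.π_D, D_unit, map_mul]
  exact (Units.isUnit _).mul_left_cancel h1

/-- In `K`, Frobenius changes a logarithmic differential by an exact form. -/
theorem exists_frobenius_dlog (Q : FrobLift P L A) (hL : 2 ≤ L) (b : Kˣ) :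
    ∃ l, (P.dlog b).mapRange (frobenius K p) (map_zero _) = P.dlog b + P.grad l := by
  obtain ⟨u, hu⟩ := Q.exists_unit_lift b
  obtain ⟨c, hc⟩ := Q.exists_φ_unit u
  obtain ⟨l, hl⟩ := Q.exists_log c
  obtain ⟨r, hr⟩ := Q.map_φ_dlog u hc hl
  refine ⟨Q.π l, ?_⟩
  obtain rfl : Units.map (Q.π : A →* K) u = b := Units.ext hu
  ext i
  have h1 := congrArg Q.π (DFunLike.congr_fun hr i)
  rw [Finsupp.mapRange_apply, π_φ, Finsupp.add_apply, Finsupp.add_apply, Finsupp.smul_apply,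
    smul_eq_mul, map_add, map_add, map_mul, map_pow, π_p, zero_pow (by omega), zero_mul, add_zero,
    π_dlog, LogDer.grad_apply, Q.π_D] at h1
  exact h1

theorem exists_φ_wedgeMulti {n : ℕ} (b : Fin n → Aˣ) :
    ∃ ξ ρ, Form.map I (Q.φ : A →+ A) (wedgeMulti I A n fun j => Q.dlog (b j)) =
      wedgeMulti I A n (fun j => Q.dlog (b j)) + Q.d ξ + (p : A) ^ (L - 1) • ρ := by
  choose c hc using fun j => Q.exists_φ_unit (b j)
  choose l hl using fun j => Q.exists_log (c j)
  choose r hr using fun j => Q.map_φ_dlog (b j) (hc j) (hl j)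
  obtain ⟨s, hs⟩ := wedgeMulti_add_smul ((p : A) ^ (L - 1))
    (fun j => Q.dlog (b j) + Q.grad (l j)) r
  obtain ⟨ξ, hξ⟩ := Q.wedgeMulti_add_grad (fun j => Q.isClosedCov_dlog (b j)) l
  refine ⟨ξ, s, ?_⟩
  rw [Form.map_wedgeMulti]
  simp only [hr]
  rw [hs, hξ]

/-- A logarithmic form over `K` has a lift that is fixed by `φ` modulo exact forms and `p^(L-1)`. -/
theorem exists_lift_logForm {x : Form I K} (hx : x ∈ P.logForm) :
    ∃ w ξ ρ, Form.map I (Q.π : A →+ K) w = x ∧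
      Form.map I (Q.φ : A →+ A) w = w + Q.d ξ + (p : A) ^ (L - 1) • ρ := by
  induction hx using AddSubgroup.closure_induction with
  | mem x hx =>
    obtain ⟨n, b, rfl⟩ := hx
    obtain ⟨ξ, ρ, h⟩ := Q.exists_φ_wedgeMulti fun j => Q.liftUnit (b j)
    refine ⟨_, ξ, ρ, ?_, h⟩
    rw [Form.map_wedgeMulti]
    congr 1
    funext j
    ext i
    rw [Finsupp.mapRange_apply, π_dlog]
    congr 2
    exact Units.ext (Q.π_liftUnit (b j))
  | zero => exact ⟨0, 0, 0, by simp, by simp⟩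
  | add x y _ _ hx hy =>
    obtain ⟨w, ξ, ρ, h1, h2⟩ := hx
    obtain ⟨w', ξ', ρ', h1', h2'⟩ := hy
    refine ⟨w + w', ξ + ξ', ρ + ρ', by rw [map_add, h1, h1'], ?_⟩
    rw [map_add, h2, h2', map_add, smul_add]
    abel
  | neg x _ hx =>
    obtain ⟨w, ξ, ρ, h1, h2⟩ := hx
    refine ⟨-w, -ξ, -ρ, by rw [map_neg, h1], ?_⟩
    rw [map_neg, h2, map_neg, smul_neg]
    abel

/-- The subgroup `dΩ + (φ - 1)Ω + p^N Ω` of the group of differential forms. -/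
def exSub (N : ℕ) : AddSubgroup (Form I A) where
  carrier := {w | ∃ z v u, w = Q.d z + (Form.map I (Q.φ : A →+ A) v - v) + (p : A) ^ N • u}
  zero_mem' := ⟨0, 0, 0, by simp⟩
  add_mem' := by
    rintro _ _ ⟨z, v, u, rfl⟩ ⟨z', v', u', rfl⟩
    refine ⟨z + z', v + v', u + u', ?_⟩
    rw [map_add, map_add, smul_add]
    abel
  neg_mem' := by
    rintro _ ⟨z, v, u, rfl⟩
    refine ⟨-z, -v, -u, ?_⟩
    rw [map_neg, map_neg, smul_neg]
    abel

theorem d_mem_exSub (N : ℕ) (z : Form I A) : Q.d z ∈ Q.exSub N := ⟨z, 0, 0, by simp⟩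

theorem map_φ_sub_mem_exSub (N : ℕ) (v : Form I A) :
    Form.map I (Q.φ : A →+ A) v - v ∈ Q.exSub N := ⟨0, v, 0, by simp⟩

theorem pow_smul_mem_exSub {N M : ℕ} (h : N ≤ M) (u : Form I A) : (p : A) ^ M • u ∈ Q.exSub N :=
  ⟨0, 0, (p : A) ^ (M - N) • u, by
    rw [smul_smul, ← pow_add, Nat.add_sub_cancel' h]; simp⟩

/-- The key step. A relation `p^j Y ∈ dΩ + (φ - 1)Ω + p^(j+1) Ω` can be divided by `p^j`: modulo `p`
it says that `v` is fixed by the inverse Cartier operator, so that `v` is logarithmic modulo `p` by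
the theorem of Bloch, Gabber and Kato and may be taken divisible by `p`; then `z` is closed modulo
`p`, and by the theorem of Cartier `dz` is divisible by `p` in a controlled way. -/
theorem mem_exSub_one [WellFoundedLT I] (hroot : ∀ x : K, ∃ y, y ^ (p - 1) = x) {j : ℕ}
    (hj : j + 2 ≤ L) {Y : Form I A} (hY : (p : A) ^ j • Y ∈ Q.exSub (j + 1)) :
    Y ∈ Q.exSub 1 := by
  induction j with
  | zero => rwa [pow_zero, one_smul] at hY
  | succ j ih =>
    refine ih (by omega) ?_
    obtain ⟨z, v, u, h⟩ := hY
    have hpi : ∀ (k : ℕ) (x : Form I A), Form.map I (Q.π : A →+ K) ((p : A) ^ (k + 1) • x) = 0 := by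
      intro k x
      rw [Form.map_smul, map_pow, π_p, zero_pow (Nat.succ_ne_zero k), zero_smul]
    -- reduction modulo `p` gives `φ(v) - v = -dz`
    have h1 := congrArg (Form.map I (Q.π : A →+ K)) h
    rw [hpi, map_add, map_add, hpi, map_sub, map_π_map_φ, map_π_d, add_zero] at h1
    have h2 := PCoord.mem_logForm P hroot (Q.exists_frobenius_dlog (by omega))
      (w := Form.map I (Q.π : A →+ K) v) (z := -Form.map I (Q.π : A →+ K) z) (by
        rw [map_neg, ← sub_eq_add_neg, eq_sub_iff_add_eq, ← sub_eq_zero]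
        rw [h1]; abel)
    obtain ⟨v₁, ξ, ρ, hv₁, hφ⟩ := Q.exists_lift_logForm h2
    obtain ⟨v₂, hv₂⟩ := Q.exists_form_eq_of_π_eq_zero (w := v - v₁) (by
      rw [map_sub, hv₁, sub_self])
    have hv : v = v₁ + (p : A) • v₂ := by rw [← hv₂]; abel
    have hφp : ∀ (k : ℕ) (x : Form I A), Form.map I (Q.φ : A →+ A) ((p : A) ^ k • x) =
        (p : A) ^ k • Form.map I (Q.φ : A →+ A) x := by
      intro k x
      rw [Form.map_smul, map_pow, map_natCast]
    obtain ⟨u', hu'⟩ : ∃ u', (p : A) ^ (L - 1) • ρ + (p : A) ^ (j + 2) • u =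
        (p : A) ^ (j + 2) • u' := ⟨(p : A) ^ (L - 1 - (j + 2)) • ρ + u, by
      rw [smul_add, smul_smul, ← pow_add, show j + 2 + (L - 1 - (j + 2)) = L - 1 by omega]⟩
    have h3 : (p : A) ^ (j + 1) • Y = Q.d (z + ξ) +
        (p : A) • (Form.map I (Q.φ : A →+ A) v₂ - v₂) + (p : A) ^ (j + 2) • u' := by
      have h4 := hφp 1 v₂
      rw [pow_one] at h4
      rw [← hu', h, hv, map_add, hφ, h4, map_add, smul_sub]
      abel
    -- now `z + ξ` is closed modulo `p`, hence of the form `φ(a) + db + pc`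
    have h5 := congrArg (Form.map I (Q.π : A →+ K)) h3
    have hp1 := hpi 0
    rw [zero_add, pow_one] at hp1
    rw [hpi, map_add, map_add, hpi, hp1, add_zero, add_zero, map_π_d] at h5
    obtain ⟨a, b, hab⟩ := PCoord.exists_frobenius_add_d P h5.symm
    obtain ⟨a, rfl⟩ := Q.map_π_surjective a
    obtain ⟨b, rfl⟩ := Q.map_π_surjective b
    obtain ⟨c, hc⟩ := Q.exists_form_eq_of_π_eq_zero
      (w := z + ξ - (Form.map I (Q.φ : A →+ A) a + Q.d b)) (by
        rw [map_sub, hab, map_add, map_π_map_φ, map_π_d, sub_self])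
    have hz : z + ξ = Form.map I (Q.φ : A →+ A) a + Q.d b + (p : A) • c := by rw [← hc]; abel
    have hdp : Q.d ((p : A) • c) = (p : A) • Q.d c := by
      rw [Nat.cast_smul_eq_nsmul, map_nsmul, Nat.cast_smul_eq_nsmul]
    -- `d ∘ φ = p φ ∘ d`, so that all terms are divisible by `p`
    rw [hz, map_add, map_add, Q.d_d, add_zero, Q.d_map_φ, hdp] at h3
    obtain ⟨ζ, hζ⟩ := Q.exists_form_of_p_smul_eq (k := j + 1) (by omega)
      (x := (p : A) ^ j • Y - (Form.map I (Q.φ : A →+ A) (Q.d a) + Q.d c +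
        (Form.map I (Q.φ : A →+ A) v₂ - v₂))) (y := u') (by
        rw [smul_sub, smul_smul, ← pow_succ', h3, smul_add, smul_add]
        abel)
    -- `φ(da) = da + (φ - 1)(da)`
    refine ⟨a + c, v₂ + Q.d a, ζ, ?_⟩
    rw [← hζ, map_add, map_add]
    abel

end FrobLift

/-! ### The comparison of Witt vector symbols with differential forms -/

section WittTensor

variable {p : ℕ} [hp : Fact p.Prime] {F : Type*} [Field F]

/-- A function of units, additive in each variable, as a multilinear map over `ℤ`. -/
def unitsMultilinear {n : ℕ} {G : Type*} [AddCommGroup G] (f : (Fin n → Fˣ) → G)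
    (hmul : ∀ b k x y, f (Function.update b k (x * y)) =
      f (Function.update b k x) + f (Function.update b k y)) :
    MultilinearMap ℤ (fun _ : Fin n => Additive Fˣ) G where
  toFun b := f fun k => (b k).toMul
  map_update_add' := fun {inst} b k x y => by
    obtain rfl : inst = instDecidableEqFin n := Subsingleton.elim _ _
    have h : ∀ z : Additive Fˣ, (fun i => (Function.update b k z i).toMul) =
        Function.update (fun i => (b i).toMul) k z.toMul := fun z => by
      funext i; exact Function.apply_update (fun _ => Additive.toMul) b k z i
    rw [h, h, h, toMul_add, hmul]
  map_update_smul' := fun {inst} b k c x => by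
    obtain rfl : inst = instDecidableEqFin n := Subsingleton.elim _ _
    have h : ∀ z : Additive Fˣ, (fun i => (Function.update b k z i).toMul) =
        Function.update (fun i => (b i).toMul) k z.toMul := fun z => by
      funext i; exact Function.apply_update (fun _ => Additive.toMul) b k z i
    rw [h, h]
    exact map_zsmul (AddMonoidHom.mk' (fun z : Additive Fˣ =>
      f (Function.update (fun i => (b i).toMul) k z.toMul)) fun z z' => hmul _ k _ _) c x

/-- The homomorphism on `W_i(F) ⊗ Fˣ ⊗ ⋯ ⊗ Fˣ` with prescribed values on symbols. -/
def wittTensorLift {i n : ℕ} {G : Type*} [AddCommGroup G]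
    (f : TruncatedWittVector p i F → (Fin n → Fˣ) → G)
    (hadd : ∀ w w' b, f (w + w') b = f w b + f w' b)
    (hmul : ∀ w b k x y, f w (Function.update b k (x * y)) =
      f w (Function.update b k x) + f w (Function.update b k y)) : WittTensor p F i n →+ G :=
  (TensorProduct.lift
    (AddMonoidHom.mk' (fun w => PiTensorProduct.lift (unitsMultilinear (f w) (hmul w)))
      fun w w' => by
        rw [← map_add]
        congr 1
        ext b
        exact hadd w w' _).toIntLinearMap).toAddMonoidHom

theorem wittTensorLift_symbol {i n : ℕ} {G : Type*} [AddCommGroup G]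
    (f : TruncatedWittVector p i F → (Fin n → Fˣ) → G)
    (hadd : ∀ w w' b, f (w + w') b = f w b + f w' b)
    (hmul : ∀ w b k x y, f w (Function.update b k (x * y)) =
      f w (Function.update b k x) + f w (Function.update b k y))
    (w : TruncatedWittVector p i F) (b : Fin n → Fˣ) :
    wittTensorLift f hadd hmul (wittSymbol w b) = f w b := by
  change PiTensorProduct.lift (unitsMultilinear (f w) (hmul w)) (PiTensorProduct.tprod ℤ _) = _
  rw [PiTensorProduct.lift.tprod]
  rfl

theorem wittTensor_induction {i n : ℕ} {C : WittTensor p F i n → Prop} (X : WittTensor p F i n)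
    (h0 : C 0) (hadd : ∀ X Y, C X → C Y → C (X + Y)) (h : ∀ w b, C (wittSymbol w b)) : C X := by
  induction X using TensorProduct.induction_on with
  | zero => exact h0
  | add X Y hX hY => exact hadd X Y hX hY
  | tmul w t =>
    induction t using PiTensorProduct.induction_on with
    | smul_tprod r b =>
      rw [← TensorProduct.smul_tmul]
      exact h (r • w) fun k => (b k).toMul
    | add s t hs ht => rw [TensorProduct.tmul_add]; exact hadd _ _ hs ht

end WittTensor

namespace FrobLift

variable {p : ℕ} [hp : Fact p.Prime] {I : Type*} [LinearOrder I] {K : Type*} [Field K] [CharP K p]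
  {P : PCoord p I K} {L : ℕ} {A : Type*} [CommRing A] (Q : FrobLift P L A)
  {F : Type*} [Field F] (ψ : F →+* K)

theorem smul_d_mem_exSub {N : ℕ} {g : A} (hg : ∀ i, ∃ y, Q.D i g = (p : A) ^ N * y)
    (ξ : Form I A) : g • Q.d ξ ∈ Q.exSub N := by
  obtain ⟨r, hr⟩ := Finsupp.exists_eq_smul ((p : A) ^ N) (Q.grad g) hg
  have h := Q.d_smul g ξ
  rw [hr, (wedge I A).map_smul, LinearMap.smul_apply] at h
  rw [← sub_eq_iff_eq_add'.2 h]
  exact sub_mem (Q.d_mem_exSub N _) (Q.pow_smul_mem_exSub le_rfl _)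

/-- A Witt vector over `A` lifts the truncated Witt vector `w` over `F`. -/
def LiftsWitt {i : ℕ} (w : TruncatedWittVector p i F) (x : WittVector p A) : Prop :=
  ∃ z : WittVector p F, WittVector.truncate i z = w ∧ WittVector.map Q.π x = WittVector.map ψ z

theorem exists_liftsWitt {i : ℕ} (w : TruncatedWittVector p i F) : ∃ x, Q.LiftsWitt ψ w x := by
  obtain ⟨z, hz⟩ := WittVector.truncate_surjective p i F w
  obtain ⟨x, hx⟩ := WittVector.map_surjective (p := p) Q.π Q.π_surjective (WittVector.map ψ z)
  exact ⟨x, z, hz, hx⟩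

variable {Q ψ}

theorem LiftsWitt.add {i : ℕ} {w w' : TruncatedWittVector p i F} {x x' : WittVector p A}
    (h : Q.LiftsWitt ψ w x) (h' : Q.LiftsWitt ψ w' x') : Q.LiftsWitt ψ (w + w') (x + x') := by
  obtain ⟨z, rfl, hz⟩ := h
  obtain ⟨z', rfl, hz'⟩ := h'
  exact ⟨z + z', map_add _ _ _, by rw [map_add, map_add, hz, hz']⟩

theorem LiftsWitt.frob [CharP F p] {i : ℕ} {w : TruncatedWittVector p i F} {x : WittVector p A}
    (h : Q.LiftsWitt ψ w x) : Q.LiftsWitt ψ (wittFrob w) (WittVector.map Q.φ x) := by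
  obtain ⟨z, rfl, hz⟩ := h
  refine ⟨WittVector.frobenius z, (wittFrob_truncate p i z).symm, ?_⟩
  ext k
  rw [WittVector.map_coeff, WittVector.map_coeff, WittVector.map_coeff,
    WittVector.coeff_frobenius_charP, π_φ, map_pow]
  congr 1
  exact congrArg (fun y => WittVector.coeff y k) hz

theorem LiftsWitt.teich {i : ℕ} {a : F} {x : A} (h : Q.π x = ψ a) :
    Q.LiftsWitt ψ (wittTeich p i a) (WittVector.teichmuller p x) :=
  ⟨_, (wittTeich_eq p i a).symm, by
    rw [WittVector.map_teichmuller, WittVector.map_teichmuller, h]⟩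

theorem LiftsWitt.shift {i j : ℕ} (hij : i ≤ j) {w : TruncatedWittVector p i F}
    {x : WittVector p A} (h : Q.LiftsWitt ψ w x) :
    Q.LiftsWitt ψ (wittShift p hij w) (WittVector.verschiebung^[j - i] x) := by
  obtain ⟨z, rfl, hz⟩ := h
  refine ⟨WittVector.verschiebung^[j - i] z, (wittShiftFun_truncate p hij z).symm, ?_⟩
  generalize j - i = k
  induction k with
  | zero => exact hz
  | succ k ih =>
    rw [Function.iterate_succ_apply', Function.iterate_succ_apply', WittVector.map_verschiebung,
      ih, WittVector.map_verschiebung]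

theorem LiftsWitt.π_coeff {i : ℕ} {w : TruncatedWittVector p i F} {x : WittVector p A}
    (h : Q.LiftsWitt ψ w x) (k : Fin i) : Q.π (x.coeff k) = ψ (w.coeff k) := by
  obtain ⟨z, rfl, hz⟩ := h
  rw [WittVector.coeff_truncate]
  exact congrArg (fun y => WittVector.coeff y (k : ℕ)) hz

theorem ghostComponent_eq_sum (j : ℕ) (x : WittVector p A) : WittVector.ghostComponent j x =
    ∑ k ∈ Finset.range (j + 1), (p : A) ^ k * x.coeff k ^ p ^ (j - k) := by
  rw [WittVector.ghostComponent_apply, aeval_wittPolynomial]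

theorem map_ghostComponent {B : Type*} [CommRing B] (f : A →+* B) (j : ℕ) (x : WittVector p A) :
    f (WittVector.ghostComponent j x) = WittVector.ghostComponent j (WittVector.map f x) := by
  rw [ghostComponent_eq_sum, ghostComponent_eq_sum, map_sum]
  simp [WittVector.map_coeff]

/-- The last ghost component of a lift of a truncated Witt vector of length `j + 1` is well defined
modulo `p^(j+1)`. -/
theorem LiftsWitt.ghostComponent_congr {j : ℕ} {w : TruncatedWittVector p (j + 1) F}
    {x y : WittVector p A} (hx : Q.LiftsWitt ψ w x) (hy : Q.LiftsWitt ψ w y) :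
    (p : A) ^ (j + 1) ∣ WittVector.ghostComponent j x - WittVector.ghostComponent j y := by
  rw [ghostComponent_eq_sum, ghostComponent_eq_sum, ← Finset.sum_sub_distrib]
  refine Finset.dvd_sum fun k hk => ?_
  rw [Finset.mem_range] at hk
  obtain ⟨z, hz⟩ := Q.exists_of_π_eq_zero (x.coeff k - y.coeff k) (by
    rw [map_sub, sub_eq_zero]
    exact (hx.π_coeff ⟨k, hk⟩).trans (hy.π_coeff ⟨k, hk⟩).symm)
  have h := dvd_sub_pow_of_dvd_sub (R := A) (p := p) ⟨z, hz⟩ (j - k)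
  rw [← mul_sub, show j + 1 = k + (j - k + 1) by omega, pow_add]
  exact mul_dvd_mul_left _ h

theorem exists_D_ghostComponent (Q : FrobLift P L A) (j : ℕ) (x : WittVector p A) (i : I) :
    ∃ y, Q.D i (WittVector.ghostComponent j x) = (p : A) ^ j * y := by
  change (p : A) ^ j ∣ _
  rw [ghostComponent_eq_sum, map_sum]
  refine Finset.dvd_sum fun k hk => ?_
  rw [Finset.mem_range] at hk
  rw [← Nat.cast_pow p k, ← nsmul_eq_mul, map_nsmul, Derivation.leibniz_pow, nsmul_eq_mul,
    nsmul_eq_mul, ← mul_assoc, ← Nat.cast_mul, ← pow_add, show k + (j - k) = j by omega]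
  push_cast
  exact dvd_mul_right _ _

variable (Q ψ)

/-- The product of the logarithmic differentials of lifts of units of `F`. -/
def dlogLift {n : ℕ} (b : Fin n → Fˣ) : Form I A :=
  wedgeMulti I A n fun k => Q.dlog (Q.liftUnit (Units.map (ψ : F →* K) (b k)))

theorem dlogLift_update_mul {n : ℕ} (b : Fin n → Fˣ) (k : Fin n) (x y : Fˣ) :
    ∃ ξ, Q.dlogLift ψ (Function.update b k (x * y)) = Q.dlogLift ψ (Function.update b k x) +
      Q.dlogLift ψ (Function.update b k y) + (p : A) • Q.d ξ := by
  set u : Fˣ → Aˣ := fun z => Q.liftUnit (Units.map (ψ : F →* K) z) with hu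
  have h : ∀ z, Q.dlogLift ψ (Function.update b k z) =
      wedgeMulti I A n (Function.update (fun k => Q.dlog (u (b k))) k (Q.dlog (u z))) := fun z => by
    rw [dlogLift]
    congr 1
    funext i
    exact Function.apply_update (fun _ z => Q.dlog (u z)) b k z i
  obtain ⟨l, hl⟩ := Q.dlog_eq_of_π_eq (b := u x * u y) (b' := u (x * y)) (by
    simp only [hu, Units.val_mul, map_mul, π_liftUnit])
  obtain ⟨ξ, hξ⟩ := Q.wedgeMulti_update_grad (v := fun k => Q.dlog (u (b k)))
    (fun k => Q.isClosedCov_dlog _) k l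
  refine ⟨ξ, ?_⟩
  rw [h, h, h, hl, LogDer.dlog_mul, AlternatingMap.map_update_add, AlternatingMap.map_update_add,
    AlternatingMap.map_update_smul, hξ]

/-- The form `g • dlog b₁ ∧ ⋯ ∧ dlog b_n`, where `g` is the last ghost component of a lift of `w`,
modulo `dΩ + (φ - 1)Ω + p^(j+1) Ω`. -/
def symbolClass (j n : ℕ) (w : TruncatedWittVector p (j + 1) F) (b : Fin n → Fˣ) :
    Form I A ⧸ Q.exSub (j + 1) :=
  QuotientAddGroup.mk (WittVector.ghostComponent j (Q.exists_liftsWitt ψ w).choose •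
    Q.dlogLift ψ b)

variable {Q ψ}

theorem LiftsWitt.symbolClass_eq {j n : ℕ} {w : TruncatedWittVector p (j + 1) F}
    {x : WittVector p A} (h : Q.LiftsWitt ψ w x) (b : Fin n → Fˣ) :
    Q.symbolClass ψ j n w b =
      QuotientAddGroup.mk (WittVector.ghostComponent j x • Q.dlogLift ψ b) := by
  rw [symbolClass, QuotientAddGroup.eq_iff_sub_mem, ← sub_smul]
  obtain ⟨z, hz⟩ := (Q.exists_liftsWitt ψ w).choose_spec.ghostComponent_congr h
  rw [hz, mul_smul]
  exact Q.pow_smul_mem_exSub le_rfl _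

variable (Q ψ)

/-- The homomorphism `w ⊗ b₁ ⊗ ⋯ ⊗ b_n ↦ gh(w) dlog b₁ ∧ ⋯ ∧ dlog b_n`, a comparison of
Witt vector symbols with de Rham cohomology of the lift. -/
def symbolMap (j n : ℕ) : WittTensor p F (j + 1) n →+ Form I A ⧸ Q.exSub (j + 1) :=
  wittTensorLift (Q.symbolClass ψ j n)
    (fun w w' b => by
      obtain ⟨x, hx⟩ := Q.exists_liftsWitt ψ w
      obtain ⟨x', hx'⟩ := Q.exists_liftsWitt ψ w'
      rw [hx.symbolClass_eq, hx'.symbolClass_eq, (hx.add hx').symbolClass_eq, map_add, add_smul]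
      rfl)
    (fun w b k y z => by
      obtain ⟨x, hx⟩ := Q.exists_liftsWitt ψ w
      obtain ⟨ξ, hξ⟩ := Q.dlogLift_update_mul ψ b k y z
      rw [hx.symbolClass_eq, hx.symbolClass_eq, hx.symbolClass_eq, ← QuotientAddGroup.mk_add,
        QuotientAddGroup.eq_iff_sub_mem, hξ, smul_add, smul_add, add_sub_cancel_left, smul_smul]
      refine Q.smul_d_mem_exSub (fun i => ?_) ξ
      obtain ⟨v, hv⟩ := Q.exists_D_ghostComponent j x i
      refine ⟨v, ?_⟩
      rw [mul_comm, ← nsmul_eq_mul, map_nsmul, hv, nsmul_eq_mul]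
      ring)

variable {Q ψ}

theorem LiftsWitt.symbolMap_symbol {j n : ℕ} {w : TruncatedWittVector p (j + 1) F}
    {x : WittVector p A} (h : Q.LiftsWitt ψ w x) (b : Fin n → Fˣ) :
    Q.symbolMap ψ j n (wittSymbol w b) =
      QuotientAddGroup.mk (WittVector.ghostComponent j x • Q.dlogLift ψ b) := by
  rw [symbolMap, wittTensorLift_symbol, h.symbolClass_eq]

/-- `(1 + pc)^(p^m) = 1 + p^(m+1) y` with `dy = (1 + pc)^(p^m - 1) dc`. -/
theorem exists_one_add_pow_eq (Q : FrobLift P L A) (c : A) (m : ℕ) :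
    ∃ y, (1 + (p : A) * c) ^ p ^ m = 1 + (p : A) ^ (m + 1) * y ∧
      ∀ i, Q.D i y = (1 + p * c) ^ (p ^ m - 1) * Q.D i c := by
  obtain ⟨Y, hY⟩ : ∃ Y : Polynomial ℤ,
      (1 + (p : Polynomial ℤ) * Polynomial.X) ^ p ^ m = 1 + (p : Polynomial ℤ) ^ (m + 1) * Y := by
    obtain ⟨Y, hY⟩ := dvd_sub_pow_of_dvd_sub (R := Polynomial ℤ) (p := p)
      (a := 1 + (p : Polynomial ℤ) * Polynomial.X) (b := 1) ⟨Polynomial.X, by ring⟩ m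
    exact ⟨Y, by rw [← hY, one_pow]; ring⟩
  have hY' : Polynomial.derivative Y = (1 + (p : Polynomial ℤ) * Polynomial.X) ^ (p ^ m - 1) := by
    have h := congrArg Polynomial.derivative hY
    have hp0 : (p : Polynomial ℤ) ^ (m + 1) ≠ 0 :=
      pow_ne_zero _ (Nat.cast_ne_zero.2 hp.out.ne_zero)
    apply mul_left_cancel₀ hp0
    rw [← Nat.cast_pow, ← nsmul_eq_mul, ← nsmul_eq_mul, Polynomial.derivative_pow] at *
    simp only [Polynomial.derivative_add, Polynomial.derivative_one, Polynomial.derivative_mul,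
      Polynomial.derivative_natCast, Polynomial.derivative_X, zero_mul, zero_add, mul_one,
      nsmul_eq_mul] at h ⊢
    rw [← h]
    push_cast
    simp only [map_natCast, map_pow]
    ring
  refine ⟨Polynomial.aeval c Y, ?_, fun i => ?_⟩
  · have h := congrArg (Polynomial.aeval c) hY
    simpa using h
  · rw [Derivation.map_aeval, hY', smul_eq_mul]
    simp

/-- The image of a symbol with a Teichmüller representative `[a] ⊗ a ⊗ ⋯`: the form
`a^(p^m) dlog a ∧ ⋯` is exact for `m = 0`, and `φ` increases `m`. -/
theorem pow_smul_wedge_dlog_mem_exSub (Q : FrobLift P L A) (N : ℕ) (a : Aˣ) {n : ℕ}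
    (b : Fin n → Aˣ) (hN : N ≤ L - 1) (m : ℕ) :
    (a : A) ^ p ^ m • wedge I A (Q.dlog a) (wedgeMulti I A n fun k => Q.dlog (b k)) ∈
      Q.exSub N := by
  set η := wedgeMulti I A n fun k => Q.dlog (b k) with hη
  have hdη : Q.d η = 0 := Q.d_wedgeMulti fun k => Q.isClosedCov_dlog _
  have hex : ∀ f : A, wedge I A (Q.grad f) η ∈ Q.exSub N := fun f => by
    have h := Q.d_smul f η
    rw [hdη, smul_zero, add_zero] at h
    rw [← h]
    exact Q.d_mem_exSub N _
  induction m with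
  | zero =>
    rw [pow_zero, pow_one, ← LinearMap.smul_apply, ← map_smul, ← LogDer.grad_unit]
    exact hex a
  | succ m ih =>
    obtain ⟨c, hc⟩ := Q.exists_φ_unit a
    obtain ⟨l, hl⟩ := Q.exists_log c
    obtain ⟨r, hr⟩ := Q.map_φ_dlog a hc hl
    obtain ⟨ξ, ρ, hξ⟩ := Q.exists_φ_wedgeMulti b
    obtain ⟨y, hy, hDy⟩ := Q.exists_one_add_pow_eq c m
    rw [← hη] at hξ
    set v := Q.dlog a + Q.grad l with hv
    set x := (a : A) ^ p ^ m with hx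
    have hpL : (p : A) * (p : A) ^ (L - 1) = 0 ∨ L = 0 := by
      rcases Nat.eq_zero_or_pos L with h | h
      · exact Or.inr h
      · left; rw [← pow_succ', Nat.sub_add_cancel h, Q.p_pow_eq_zero]
    have hA0 : L = 0 → ∀ z : A, z = 0 := by
      intro h z
      have h1 := Q.p_pow_eq_zero
      rw [h, pow_zero] at h1
      rw [← one_mul z, h1, zero_mul]
    have hpL' : (p : A) * (p : A) ^ (L - 1) = 0 := hpL.elim id fun h => hA0 h _
    -- `φ(x) • v` is closed
    have hgradφ : ∀ i, Q.D i (Q.φ a) = p * Q.φ a * v i := fun i => by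
      rw [Q.D_φ, D_unit, map_mul]
      have h1 := DFunLike.congr_fun hr i
      rw [Finsupp.mapRange_apply, Finsupp.add_apply, Finsupp.smul_apply, smul_eq_mul] at h1
      rw [h1]
      linear_combination Q.φ a * r i * hpL'
    have hgradx : Q.grad (Q.φ x) = ((p : A) ^ (m + 1) * Q.φ x) • v := by
      ext i
      rw [LogDer.grad_apply, hx, map_pow, Derivation.leibniz_pow, hgradφ, Finsupp.smul_apply]
      simp only [smul_eq_mul, nsmul_eq_mul]
      have h2 : Q.φ (a : A) ^ (p ^ m - 1) * Q.φ a = Q.φ a ^ p ^ m :=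
        pow_sub_one_mul (pow_ne_zero _ hp.out.ne_zero) _
      rw [← h2]
      push_cast
      ring
    have hcv : Q.IsClosedCov (Q.φ x • v) :=
      LogDer.IsClosedCov.smul Q.toLogDer ((Q.isClosedCov_dlog a).add _ (Q.isClosedCov_grad l)) hgradx
    have hφx : Q.φ x = (a : A) ^ p ^ (m + 1) * (1 + (p : A) ^ (m + 1) * y) := by
      rw [hx, map_pow, hc, mul_pow, hy, ← pow_mul, ← pow_succ']
    -- the leading term
    have h1 : Q.φ x • v = (a : A) ^ p ^ (m + 1) • Q.dlog a + Q.grad ((a : A) ^ p ^ (m + 1) * y) := by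
      have hly : ∀ i, (1 + (p : A) ^ (m + 1) * y) * Q.D i l = Q.D i y := fun i => by
        rw [hDy, ← hl, ← hy, ← mul_assoc, pow_sub_one_mul (pow_ne_zero _ hp.out.ne_zero)]
      have hax : (a : A) ^ (p ^ (m + 1) - 1) * a = a ^ p ^ (m + 1) :=
        pow_sub_one_mul (pow_ne_zero _ hp.out.ne_zero) _
      ext i
      rw [hφx, Finsupp.smul_apply, hv, Finsupp.add_apply, Finsupp.add_apply, LogDer.grad_apply,
        LogDer.grad_apply, Derivation.leibniz, Derivation.leibniz_pow, D_unit, ← hly,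
        Finsupp.smul_apply]
      simp only [smul_eq_mul, nsmul_eq_mul]
      push_cast
      linear_combination (-(p : A) ^ (m + 1) * y * Q.dlog a i) * hax
    have h2 : Form.map I (Q.φ : A →+ A) (x • wedge I A (Q.dlog a) η) =
        (a : A) ^ p ^ (m + 1) • wedge I A (Q.dlog a) η +
          (wedge I A (Q.grad ((a : A) ^ p ^ (m + 1) * y)) η + Q.d (-wedge I A (Q.φ x • v) ξ) +
          (p : A) ^ (L - 1) • (Q.φ x • (wedge I A v ρ + wedge I A r (η + Q.d ξ +
            (p : A) ^ (L - 1) • ρ)))) := by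
      rw [Form.map_smul, Form.map_wedge, hr, hξ, map_neg, hcv, neg_neg]
      have h3 : wedge I A (Q.φ x • v) η = (a : A) ^ p ^ (m + 1) • wedge I A (Q.dlog a) η +
          wedge I A (Q.grad ((a : A) ^ p ^ (m + 1) * y)) η := by
        rw [h1, map_add, map_smul]; rfl
      rw [← add_assoc, ← add_assoc, ← h3]
      simp only [map_add, map_smul, LinearMap.add_apply, LinearMap.smul_apply, smul_add]
      simp only [smul_comm ((p : A) ^ (L - 1)) (Q.φ x)]
      abel
    have h4 := Q.map_φ_sub_mem_exSub N (x • wedge I A (Q.dlog a) η)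
    have h5 := add_mem h4 ih
    rw [sub_add_cancel, h2] at h5
    have h6 := add_mem (add_mem (hex ((a : A) ^ p ^ (m + 1) * y))
      (Q.d_mem_exSub N (-wedge I A (Q.φ x • v) ξ)))
      (Q.pow_smul_mem_exSub hN (Q.φ x • (wedge I A v ρ + wedge I A r (η + Q.d ξ +
            (p : A) ^ (L - 1) • ρ))))
    exact (AddSubgroup.add_mem_cancel_right _ h6).1 h5

theorem symbolMap_eq_zero [CharP F p] (Q : FrobLift P L A) {j n : ℕ} (hj : j + 2 ≤ L)
    {X : WittTensor p F (j + 1) n} (hX : X ∈ wittJ p F (j + 1) n) : Q.symbolMap ψ j n X = 0 := by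
  have h : wittJ p F (j + 1) n ≤ (Q.symbolMap ψ j n).ker := by
    rw [wittJ, AddSubgroup.closure_le]
    rintro _ (⟨w, b⟩ | ⟨b, k, hk⟩ | ⟨w, b, k, l, hkl, h⟩)
    · change Q.symbolMap ψ j n _ = 0
      obtain ⟨x, hx⟩ := Q.exists_liftsWitt ψ w
      obtain ⟨ξ, ρ, hξ⟩ := Q.exists_φ_wedgeMulti
        fun k => Q.liftUnit (Units.map (ψ : F →* K) (b k))
      rw [wittSymbol_sub, map_sub, hx.symbolMap_symbol, hx.frob.symbolMap_symbol,
        ← QuotientAddGroup.mk_sub, QuotientAddGroup.eq_zero_iff, ← map_ghostComponent]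
      set g := WittVector.ghostComponent j x
      have h1 := Q.map_φ_sub_mem_exSub (j + 1) (g • Q.dlogLift ψ b)
      rw [Form.map_smul, dlogLift, hξ, smul_add, smul_add] at h1
      have h2 : Q.φ g • Q.d ξ ∈ Q.exSub (j + 1) := Q.smul_d_mem_exSub (fun i => by
        obtain ⟨y, hy⟩ := Q.exists_D_ghostComponent j x i
        refine ⟨Q.φ y, ?_⟩
        rw [Q.D_φ, hy, map_mul, map_pow, map_natCast]
        ring) ξ
      have h3 : Q.φ g • (p : A) ^ (L - 1) • ρ ∈ Q.exSub (j + 1) := by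
        rw [smul_comm]
        exact Q.pow_smul_mem_exSub (by omega) _
      have h4 := sub_mem (sub_mem h1 h2) h3
      rw [dlogLift]
      convert h4 using 1
      abel
    · change Q.symbolMap ψ j n _ = 0
      cases n with
      | zero => exact k.elim0
      | succ n =>
        obtain rfl : k = 0 := Fin.ext hk
        rw [(LiftsWitt.teich (Q.π_liftUnit (Units.map (ψ : F →* K) (b 0)))).symbolMap_symbol,
          WittVector.ghostComponent_teichmuller, QuotientAddGroup.eq_zero_iff, dlogLift,
          wedgeMulti_succ]
        exact Q.pow_smul_wedge_dlog_mem_exSub (j + 1) _ _ (by omega) j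
    · change Q.symbolMap ψ j n _ = 0
      obtain ⟨x, hx⟩ := Q.exists_liftsWitt ψ w
      rw [hx.symbolMap_symbol, dlogLift, AlternatingMap.map_eq_zero_of_eq _ _ (by rw [h]) hkl,
        smul_zero]
      rfl
  exact h hX

end FrobLift

section SymbolForm

variable {p : ℕ} [hp : Fact p.Prime] {I : Type*} [LinearOrder I] {K : Type*} [Field K] [CharP K p]
  (P : PCoord p I K) {F : Type*} [Field F] (ψ : F →+* K)

/-- The homomorphism `a ⊗ b₁ ⊗ ⋯ ⊗ b_n ↦ a dlog b₁ ∧ ⋯ ∧ dlog b_n`. -/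
def PCoord.symbolForm (n : ℕ) : WittTensor p F 1 n →+ Form I K :=
  wittTensorLift (fun w b => ψ (w.coeff 0) • wedgeMulti I K n fun k =>
      P.dlog (Units.map (ψ : F →* K) (b k)))
    (fun w w' b => by
      obtain ⟨x, rfl⟩ := WittVector.truncate_surjective p 1 F w
      obtain ⟨x', rfl⟩ := WittVector.truncate_surjective p 1 F w'
      rw [← map_add, WittVector.coeff_truncate, WittVector.coeff_truncate,
        WittVector.coeff_truncate, Fin.val_zero, WittVector.add_coeff_zero, map_add, add_smul])
    (fun w b k x y => by
      have h : ∀ z, (fun i => P.dlog (Units.map (ψ : F →* K) (Function.update b k z i))) =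
          Function.update (fun i => P.dlog (Units.map (ψ : F →* K) (b i))) k
            (P.dlog (Units.map (ψ : F →* K) z)) := fun z => by
        funext i
        exact Function.apply_update (fun _ z => P.dlog (Units.map (ψ : F →* K) z)) b k z i
      rw [h, h, h, map_mul, LogDer.dlog_mul, AlternatingMap.map_update_add, smul_add])

theorem PCoord.symbolForm_symbol {n : ℕ} (w : TruncatedWittVector p 1 F) (b : Fin n → Fˣ) :
    P.symbolForm ψ n (wittSymbol w b) = ψ (w.coeff 0) • wedgeMulti I K n fun k =>
      P.dlog (Units.map (ψ : F →* K) (b k)) :=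
  wittTensorLift_symbol _ _ _ _ _

variable {P} {L : ℕ} {A : Type*} [CommRing A]

theorem FrobLift.symbolMap_shift (Q : FrobLift P L A) (j n : ℕ) (X : WittTensor p F 1 n) :
    ∃ Y : Form I A, Form.map I (Q.π : A →+ K) Y = P.symbolForm ψ n X ∧
      Q.symbolMap ψ j n (wittTensorShift p (Nat.le_add_left 1 j) n X) =
        QuotientAddGroup.mk ((p : A) ^ j • Y) := by
  induction X using wittTensor_induction with
  | h0 => exact ⟨0, by simp, by rw [smul_zero, map_zero, map_zero]; rfl⟩
  | hadd X X' hX hX' =>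
    obtain ⟨Y, h1, h2⟩ := hX
    obtain ⟨Y', h1', h2'⟩ := hX'
    refine ⟨Y + Y', by rw [map_add, h1, h1', map_add], ?_⟩
    rw [map_add, map_add, h2, h2', smul_add]
    rfl
  | h w b =>
    obtain ⟨x, hx⟩ := Q.exists_liftsWitt ψ w
    refine ⟨x.coeff 0 • Q.dlogLift ψ b, ?_, ?_⟩
    · have h0 : Q.π (x.coeff 0) = ψ (w.coeff 0) := hx.π_coeff 0
      rw [PCoord.symbolForm_symbol, Form.map_smul, h0, dlogLift, Form.map_wedgeMulti]
      congr 2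
      funext k
      ext i
      rw [Finsupp.mapRange_apply, π_dlog]
      congr 2
      exact Units.ext (Q.π_liftUnit _)
    · rw [wittTensorShift_symbol, (hx.shift (Nat.le_add_left 1 j)).symbolMap_symbol, smul_smul]
      congr 2
      rw [Nat.add_sub_cancel]
      have h : ∀ j, WittVector.ghostComponent j (WittVector.verschiebung^[j] x) =
          (p : A) ^ j * x.coeff 0 := by
        intro j
        induction j with
        | zero => simp [FrobLift.ghostComponent_eq_sum]
        | succ j ih =>
          rw [Function.iterate_succ_apply', WittVector.ghostComponent_verschiebung, ih]
          ring
      exact h j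

/-- If the image of `X` under `H_p → H_{p^(j+1)}` vanishes, then the differential form of `X` is
trivial modulo exact forms and the image of Frobenius minus the identity. -/
theorem FrobLift.symbolForm_of_shift_mem [WellFoundedLT I] [CharP F p] (Q : FrobLift P L A)
    (hroot : ∀ x : K, ∃ y, y ^ (p - 1) = x) {j n : ℕ} (hj : j + 2 ≤ L) {X : WittTensor p F 1 n}
    (hX : wittTensorShift p (Nat.le_add_left 1 j) n X ∈ wittJ p F (j + 1) n) :
    ∃ z v, P.symbolForm ψ n X = P.d z + (Form.map I (frobenius K p : K →+ K) v - v) := by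
  obtain ⟨Y, hY, h⟩ := Q.symbolMap_shift ψ j n X
  rw [Q.symbolMap_eq_zero hj hX, eq_comm, QuotientAddGroup.eq_zero_iff] at h
  obtain ⟨z, v, u, hzv⟩ := Q.mem_exSub_one hroot hj h
  refine ⟨Form.map I (Q.π : A →+ K) z, Form.map I (Q.π : A →+ K) v, ?_⟩
  rw [← hY, hzv, map_add, map_add, map_sub, Q.map_π_map_φ, Q.map_π_d, pow_one, Form.map_smul, Q.π_p,
    zero_smul, add_zero]

end SymbolForm

/-! ### From differential forms to symbols -/

section Symbols

variable {p : ℕ} [hp : Fact p.Prime] {F : Type*} [Field F]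

/-- The projection onto `H_{p^i}^{n+1}(F)`. -/
def wittHMk (i n : ℕ) : WittTensor p F i n →+ WittH p F i n := QuotientAddGroup.mk' (wittJ p F i n)

theorem wittHMk_surjective (i n : ℕ) : Function.Surjective (wittHMk (p := p) (F := F) i n) :=
  QuotientAddGroup.mk'_surjective _

theorem wittHMk_eq_zero_iff {i n : ℕ} {X : WittTensor p F i n} :
    wittHMk i n X = 0 ↔ X ∈ wittJ p F i n := QuotientAddGroup.eq_zero_iff X

/-- The class of a symbol in `H_{p^i}^{n+1}(F)`, as an alternating map of the units. -/
def wittHAlt {i : ℕ} (n : ℕ) (w : TruncatedWittVector p i F) :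
    (Additive Fˣ) [⋀^Fin n]→ₗ[ℤ] WittH p F i n :=
  { ((wittHMk i n).toIntLinearMap.comp (TensorProduct.mk ℤ _ _ w)).compMultilinearMap
      (PiTensorProduct.tprod ℤ) with
    map_eq_zero_of_eq' := fun b j k h hjk => by
      change wittHMk i n (wittSymbol w fun k => (b k).toMul) = 0
      rw [wittHMk_eq_zero_iff]
      exact AddSubgroup.subset_closure (IsWittRelation.alt w _ j k hjk h) }

theorem wittHAlt_apply {i n : ℕ} (w : TruncatedWittVector p i F) (b : Fin n → Additive Fˣ) :
    wittHAlt n w b = wittHMk i n (wittSymbol w fun k => (b k).toMul) := rfl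

theorem wittSymbol_add {i n : ℕ} (w w' : TruncatedWittVector p i F) (b : Fin n → Fˣ) :
    wittSymbol (w + w') b = wittSymbol w b + wittSymbol w' b := TensorProduct.add_tmul _ _ _

theorem wittSymbol_update_mul {i n : ℕ} (w : TruncatedWittVector p i F) (b : Fin n → Fˣ)
    (k : Fin n) (x y : Fˣ) : wittSymbol w (Function.update b k (x * y)) =
      wittSymbol w (Function.update b k x) + wittSymbol w (Function.update b k y) := by
  have h : ∀ z, (fun j => Additive.ofMul (Function.update b k z j)) =
      Function.update (fun j => Additive.ofMul (b j)) k (Additive.ofMul z) := fun z => by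
    funext j; exact Function.apply_update (fun _ => Additive.ofMul) b k z j
  rw [wittSymbol, wittSymbol, wittSymbol, h, h, h, ofMul_mul, MultilinearMap.map_update_add,
    TensorProduct.tmul_add]

/-- The homomorphism `w ⊗ b₁ ⊗ ⋯ ⊗ b_n ↦ w ⊗ b ⊗ b₁ ⊗ ⋯ ⊗ b_n`. -/
def tensorPrepend {i : ℕ} (b : Fˣ) (n : ℕ) : WittTensor p F i n →+ WittTensor p F i (n + 1) :=
  wittTensorLift (fun w b' => wittSymbol w (Fin.cons b b')) (fun _ _ _ => wittSymbol_add _ _ _)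
    (fun w b' k x y => by
      simp only [Fin.cons_update]
      exact wittSymbol_update_mul _ _ _ _ _)

theorem tensorPrepend_symbol {i n : ℕ} (b : Fˣ) (w : TruncatedWittVector p i F) (b' : Fin n → Fˣ) :
    tensorPrepend b n (wittSymbol w b') = wittSymbol w (Fin.cons b b' : Fin (n + 1) → Fˣ) :=
  wittTensorLift_symbol _ _ _ _ _

theorem wittJ_le_comap_prepend {i : ℕ} (b : Fˣ) (n : ℕ) :
    wittJ p F i n ≤ (wittJ p F i (n + 1)).comap (tensorPrepend b n) := by
  rw [wittJ, AddSubgroup.closure_le]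
  rintro _ (⟨w, b'⟩ | ⟨b', k, hk⟩ | ⟨w, b', k, l, hkl, h⟩)
  · change tensorPrepend b n _ ∈ wittJ p F i (n + 1)
    rw [tensorPrepend_symbol]
    exact AddSubgroup.subset_closure (IsWittRelation.frob _ _)
  · change tensorPrepend b n _ ∈ wittJ p F i (n + 1)
    rw [tensorPrepend_symbol, ← wittHMk_eq_zero_iff]
    cases n with
    | zero => exact k.elim0
    | succ n =>
      obtain rfl : k = 0 := Fin.ext hk
      set c : Fin (n + 2) → Additive Fˣ := fun j => Additive.ofMul
        ((Fin.cons b b' : Fin (n + 2) → Fˣ) j)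
      have h1 := (wittHAlt (n + 2) (wittTeich p i (b' 0 : F))).map_swap c
        (i := 0) (j := 1) (by simp)
      have h2 : wittHAlt (n + 2) (wittTeich p i (b' 0 : F)) (c ∘ Equiv.swap 0 1) = 0 := by
        rw [wittHAlt_apply, wittHMk_eq_zero_iff]
        have h3 : ((c ∘ Equiv.swap 0 1) 0).toMul = b' 0 := by simp [c]
        conv => arg 2; arg 1; rw [← h3]
        exact AddSubgroup.subset_closure
          (IsWittRelation.teich (fun k => ((c ∘ Equiv.swap 0 1) k).toMul) 0 rfl)
      rw [h2, eq_comm, neg_eq_zero] at h1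
      exact h1
  · change tensorPrepend b n _ ∈ wittJ p F i (n + 1)
    rw [tensorPrepend_symbol]
    exact AddSubgroup.subset_closure (IsWittRelation.alt _ _ k.succ l.succ
      (fun h => hkl (Fin.succ_injective _ h)) (by simpa using h))

/-- The homomorphism `H_{p^i}^{n+1}(F) → H_{p^i}^{n+2}(F)` of left multiplication by a unit. -/
def wittHPrepend {i : ℕ} (b : Fˣ) (n : ℕ) : WittH p F i n →+ WittH p F i (n + 1) :=
  QuotientAddGroup.map _ _ (tensorPrepend b n) (wittJ_le_comap_prepend b n)

theorem wittHPrepend_mk {i n : ℕ} (b : Fˣ) (w : TruncatedWittVector p i F) (b' : Fin n → Fˣ) :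
    wittHPrepend b n (wittHMk i n (wittSymbol w b')) =
      wittHMk i (n + 1) (wittSymbol w (Fin.cons b b' : Fin (n + 1) → Fˣ)) :=
  congrArg (wittHMk i (n + 1)) (tensorPrepend_symbol b w b')

theorem wittH_induction {i n : ℕ} {C : WittH p F i n → Prop} (X : WittH p F i n)
    (h0 : C 0) (hadd : ∀ X Y, C X → C Y → C (X + Y))
    (h : ∀ w b, C (wittHMk i n (wittSymbol w b))) : C X := by
  obtain ⟨X, rfl⟩ := wittHMk_surjective i n X
  induction X using wittTensor_induction with
  | h0 => rw [map_zero]; exact h0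
  | hadd X Y hX hY => rw [map_add]; exact hadd _ _ hX hY
  | h w b => exact h w b

theorem wittHPrepend_mul {i n : ℕ} (b c : Fˣ) (X : WittH p F i n) :
    wittHPrepend (b * c) n X = wittHPrepend b n X + wittHPrepend c n X := by
  induction X using wittH_induction with
  | h0 => simp
  | hadd X Y hX hY => rw [map_add, map_add, map_add, hX, hY]; abel
  | h w b' =>
    have h := wittSymbol_update_mul w (Fin.cons 1 b' : Fin (n + 1) → Fˣ) 0 b c
    rw [Fin.update_cons_zero, Fin.update_cons_zero, Fin.update_cons_zero] at h
    rw [wittHPrepend_mk, wittHPrepend_mk, wittHPrepend_mk, ← map_add, ← h]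

theorem wittHPrepend_self {i n : ℕ} (b : Fˣ) (X : WittH p F i n) :
    wittHPrepend b (n + 1) (wittHPrepend b n X) = 0 := by
  induction X using wittH_induction with
  | h0 => simp
  | hadd X Y hX hY => rw [map_add, map_add, hX, hY, add_zero]
  | h w b' =>
    rw [wittHPrepend_mk, wittHPrepend_mk, wittHMk_eq_zero_iff]
    exact AddSubgroup.subset_closure (IsWittRelation.alt _ _ 0 1 (by simp) (by simp))

variable (p F) in
/-- The product of the groups `H_p^{n+1}(F)` over all `n`. -/
abbrev SymbolSeq := ∀ n, WittH p F 1 n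

/-- Left multiplication by a unit, on `∏_n H_p^{n+1}(F)`. -/
def SymbolSeq.prepend (b : Fˣ) : SymbolSeq p F →+ SymbolSeq p F where
  toFun x n := Nat.casesOn n 0 fun n => wittHPrepend b n (x n)
  map_zero' := by
    funext n
    cases n with
    | zero => rfl
    | succ n => exact map_zero (wittHPrepend b n)
  map_add' x y := by
    funext n
    cases n with
    | zero => exact (add_zero _).symm
    | succ n => exact map_add (wittHPrepend b n) (x n) (y n)

theorem SymbolSeq.prepend_mul (b c : Fˣ) (x : SymbolSeq p F) :
    prepend (b * c) x = prepend b x + prepend c x := by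
  funext n
  cases n with
  | zero => exact (add_zero _).symm
  | succ n => exact wittHPrepend_mul b c (x n)

theorem SymbolSeq.prepend_self (b : Fˣ) (x : SymbolSeq p F) : prepend b (prepend b x) = 0 := by
  funext n
  cases n with
  | zero => rfl
  | succ n =>
    cases n with
    | zero => exact map_zero (wittHPrepend b 0)
    | succ n => exact wittHPrepend_self b (x n)

theorem SymbolSeq.prepend_comm (b c : Fˣ) (x : SymbolSeq p F) :
    prepend b (prepend c x) = -prepend c (prepend b x) := by
  have h := prepend_self (b * c) x
  rw [prepend_mul, prepend_mul, map_add, map_add, prepend_self, prepend_self, zero_add,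
    add_zero] at h
  rw [eq_neg_iff_add_eq_zero]
  exact h

theorem SymbolSeq.prepend_single (b : Fˣ) (n : ℕ) (x : WittH p F 1 n) :
    prepend b (Pi.single n x) = Pi.single (n + 1) (wittHPrepend b n x) := by
  funext m
  cases m with
  | zero => exact (Pi.single_eq_of_ne (Nat.succ_ne_zero n).symm _).symm
  | succ m =>
    change wittHPrepend b m _ = _
    by_cases h : m = n
    · subst h; rw [Pi.single_eq_same, Pi.single_eq_same]
    · rw [Pi.single_eq_of_ne h, Pi.single_eq_of_ne (by omega), map_zero]

/-- The homomorphism `F ⊗ Fˣ ⊗ ⋯ ⊗ Fˣ → ∏_n H_p^{n+1}(F)` in degree `n = 0`. -/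
def SymbolSeq.const : F →+ SymbolSeq p F :=
  (AddMonoidHom.single (fun n => WittH p F 1 n) 0).comp
    (AddMonoidHom.mk' (fun a => wittHMk 1 0 (wittSymbol (wittTeich p 1 a) Fin.elim0)) fun a b => by
      rw [← map_add, ← wittSymbol_add]
      congr 2
      ext k
      obtain rfl : k = 0 := Subsingleton.elim _ _
      rw [wittTeich_eq, wittTeich_eq, wittTeich_eq, ← map_add, WittVector.coeff_truncate,
        WittVector.coeff_truncate, Fin.val_zero, WittVector.add_coeff_zero,
        WittVector.teichmuller_coeff_zero, WittVector.teichmuller_coeff_zero,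
        WittVector.teichmuller_coeff_zero])

theorem SymbolSeq.const_apply (a : F) : const (p := p) a =
    Pi.single 0 (wittHMk 1 0 (wittSymbol (wittTeich p 1 a) Fin.elim0)) := rfl

theorem SymbolSeq.const_pow (a : F) : const (p := p) (a ^ p) = const a := by
  rw [const_apply, const_apply]
  congr 1
  rw [← sub_eq_zero, ← map_sub, ← wittSymbol_sub, wittHMk_eq_zero_iff]
  have h : wittTeich p 1 (a ^ p) = wittFrob (wittTeich p 1 a) := by
    ext k
    obtain rfl : k = 0 := Subsingleton.elim _ _
    simp [wittTeich, wittFrob]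
  rw [h]
  exact AddSubgroup.subset_closure (IsWittRelation.frob _ _)

theorem SymbolSeq.prepend_const_self (b : Fˣ) : prepend (p := p) b (const (b : F)) = 0 := by
  rw [const_apply, prepend_single, wittHPrepend_mk, Pi.single_eq_zero_iff, wittHMk_eq_zero_iff]
  exact AddSubgroup.subset_closure (IsWittRelation.teich (Fin.cons b Fin.elim0) 0 rfl)

theorem SymbolSeq.prepend_const_mul (b k : Fˣ) :
    prepend (p := p) b (const (k * b : F)) = -prepend k (const (k * b : F)) := by
  have h := prepend_const_self (p := p) (k * b)
  rw [prepend_mul, Units.val_mul] at h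
  exact eq_neg_of_add_eq_zero_right h

theorem SymbolSeq.prepend_one (x : SymbolSeq p F) : prepend 1 x = 0 := by
  have h := prepend_mul 1 1 x
  rwa [mul_one, left_eq_add] at h

theorem SymbolSeq.prepend_pow (b : Fˣ) (k : ℕ) (x : SymbolSeq p F) :
    prepend (b ^ k) x = k • prepend b x := by
  induction k with
  | zero => rw [pow_zero, prepend_one, zero_smul]
  | succ k ih => rw [pow_succ, prepend_mul, ih, succ_nsmul]

theorem SymbolSeq.prepend_prod {I : Type*} (s : I → Fˣ) (α : I →₀ ℕ) (x : SymbolSeq p F) :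
    prepend (α.prod fun i k => s i ^ k) x = α.sum fun i k => k • prepend (s i) x := by
  induction α using Finsupp.induction_linear with
  | zero => simp [prepend_one]
  | add α β hα hβ =>
    rw [Finsupp.prod_add_index' (by simp) (by simp [pow_add]), prepend_mul, hα, hβ,
      Finsupp.sum_add_index' (by simp) (by simp [add_smul])]
  | single i k => rw [Finsupp.prod_single_index (by simp), Finsupp.sum_single_index (by simp),
      prepend_pow]

end Symbols

/-- Compatible coordinates on fields `F ⊆ K`, and an `F`-linear retraction `τ` of the inclusion
that commutes with Frobenius. -/
structure PCoordRetract {p : ℕ} {I : Type*} {K : Type*} [Field K] [DecidableEq I]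
    (P : PCoord p I K) (F : Type*) [Field F] where
  /-- the inclusion of `F` in `K` -/
  ψ : F →+* K
  /-- the retraction -/
  τ : K →+ F
  τ_mul : ∀ a x, τ (ψ a * x) = a * τ x
  τ_one : τ 1 = 1
  τ_pow : ∀ x, τ (x ^ p) = τ x ^ p
  /-- the coordinates -/
  s : I → Fˣ
  t_eq : ∀ i, P.t i = Units.map (ψ : F →* K) (s i)
  span : ∀ f : F, f ∈ AddSubgroup.closure
    {x : F | ∃ (g : F) (α : I →₀ ℕ), x = g ^ p * (α.prod fun i k => s i ^ k : Fˣ)}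

namespace PCoordRetract

variable {p : ℕ} [hp : Fact p.Prime] {I : Type*} [LinearOrder I] {K : Type*} [Field K] [CharP K p]
  {P : PCoord p I K} {F : Type*} [Field F] [CharP F p] (R : PCoordRetract P F)

theorem τ_ψ (a : F) : R.τ (R.ψ a) = a := by
  rw [← mul_one (R.ψ a), R.τ_mul, R.τ_one, mul_one]

theorem ψ_prod (α : I →₀ ℕ) : R.ψ (α.prod fun i k => R.s i ^ k : Fˣ) =
    (α.prod fun i k => P.t i ^ k : Kˣ) := by
  simp only [R.t_eq]
  change ((Units.map (R.ψ : F →* K) _ : Kˣ) : K) = _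
  rw [map_finsuppProd]
  simp only [map_pow]

theorem D_ψ_pow_mul_prod (i : I) (g : F) (α : I →₀ ℕ) :
    P.D i (R.ψ (g ^ p * (α.prod fun i k => R.s i ^ k : Fˣ))) =
      R.ψ (α i * (g ^ p * (α.prod fun i k => R.s i ^ k : Fˣ))) := by
  rw [map_mul, map_pow, ψ_prod, P.D_pow_mul_prod, map_mul, map_mul, map_pow, ψ_prod, map_natCast]

theorem exists_D_ψ (i : I) (f : F) : ∃ g, P.D i (R.ψ f) = R.ψ g := by
  induction R.span f using AddSubgroup.closure_induction with
  | mem f hf => obtain ⟨g, α, rfl⟩ := hf; exact ⟨_, R.D_ψ_pow_mul_prod i g α⟩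
  | zero => exact ⟨0, by simp⟩
  | add x y _ _ hx hy =>
    obtain ⟨a, ha⟩ := hx
    obtain ⟨b, hb⟩ := hy
    exact ⟨a + b, by rw [map_add, map_add, ha, hb, map_add]⟩
  | neg x _ hx =>
    obtain ⟨a, ha⟩ := hx
    exact ⟨-a, by rw [map_neg, map_neg, ha, map_neg]⟩

/-- The symbol `τ(a) ⊗ s_{i_n} ⊗ ⋯ ⊗ s_{i_1}` for `S = {i_1 < ⋯ < i_n}`. -/
def coordSymbol (S : Finset I) : K →+ SymbolSeq p F :=
  ((S.sort (· ≥ ·)).foldr (fun i f => (SymbolSeq.prepend (R.s i)).comp f) SymbolSeq.const).comp R.τ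

theorem coordSymbol_empty (a : K) : R.coordSymbol ∅ a = SymbolSeq.const (R.τ a) := by
  simp [coordSymbol]

theorem coordSymbol_insert {m : I} {S : Finset I} (h : ∀ s ∈ S, s < m) (a : K) :
    R.coordSymbol (insert m S) a = SymbolSeq.prepend (R.s m) (R.coordSymbol S a) := by
  rw [coordSymbol, Finset.sort_insert (· ≥ ·) (fun b hb => (h b hb).le)
    (fun hm => lt_irrefl _ (h m hm))]
  rfl

/-- The homomorphism `a dlog t_{i_n} ∧ ⋯ ∧ dlog t_{i_1} ↦ τ(a) ⊗ s_{i_n} ⊗ ⋯ ⊗ s_{i_1}` from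
differential forms to symbols. -/
def formSymbol : Form I K →+ SymbolSeq p F := Finsupp.liftAddHom R.coordSymbol

theorem formSymbol_single (S : Finset I) (a : K) :
    R.formSymbol (Finsupp.single S a) = R.coordSymbol S a := Finsupp.liftAddHom_apply_single _ _ _

theorem formSymbol_wedgeVar (i : I) (w : Form I K) :
    R.formSymbol (wedgeVar K i w) = SymbolSeq.prepend (R.s i) (R.formSymbol w) := by
  induction w using Finsupp.induction_linear with
  | zero => simp
  | add v w hv hw => rw [map_add, map_add, map_add, map_add, hv, hw]
  | single S a =>
    induction S using Finset.induction_on_max with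
    | empty =>
      rw [wedgeVar_single_of_notMem (Finset.notMem_empty _), shuffleSign_of_forall_le (by simp),
        one_smul, formSymbol_single, coordSymbol_insert _ (by simp), formSymbol_single]
    | insert m T hmax ih =>
      rcases lt_trichotomy i m with h | rfl | h
      · have hm : m ∉ T := fun hm => lt_irrefl _ (hmax m hm)
        have h1 : (Finsupp.single (insert m T) a : Form I K) =
            wedgeVar K m (Finsupp.single T a) := by
          rw [wedgeVar_single_of_notMem hm, shuffleSign_of_forall_le fun s hs => (hmax s hs).le,
            one_smul]
        have h2 : R.formSymbol (wedgeVar K m (wedgeVar K i (Finsupp.single T a))) =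
            SymbolSeq.prepend (R.s m) (R.formSymbol (wedgeVar K i (Finsupp.single T a))) := by
          by_cases hi : i ∈ T
          · rw [wedgeVar_single_of_mem hi, map_zero, map_zero, map_zero]
          · have hlt : ∀ s ∈ insert i T, s < m := fun s hs => by
              rcases Finset.mem_insert.1 hs with rfl | hs
              · exact h
              · exact hmax s hs
            rw [wedgeVar_single_of_notMem hi, map_zsmul, map_zsmul, map_zsmul, map_zsmul,
              wedgeVar_single_of_notMem (fun hm => lt_irrefl _ (hlt m hm)),
              shuffleSign_of_forall_le fun s hs => (hlt s hs).le, one_smul, formSymbol_single,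
              coordSymbol_insert _ hlt, formSymbol_single]
        rw [h1, wedgeVar_wedgeVar, map_neg, h2, ih, SymbolSeq.prepend_comm, neg_neg, ← h1,
          formSymbol_single, formSymbol_single, coordSymbol_insert _ hmax]
      · rw [wedgeVar_single_of_mem (Finset.mem_insert_self _ _), map_zero, formSymbol_single,
          coordSymbol_insert _ hmax, SymbolSeq.prepend_self]
      · have hlt : ∀ s ∈ insert m T, s < i := fun s hs => by
          rcases Finset.mem_insert.1 hs with rfl | hs
          · exact h
          · exact (hmax s hs).trans h
        rw [wedgeVar_single_of_notMem (fun hm => lt_irrefl _ (hlt i hm)),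
          shuffleSign_of_forall_le fun s hs => (hlt s hs).le, one_smul, formSymbol_single,
          coordSymbol_insert _ hlt, formSymbol_single]

theorem prepend_pow_mul_prod {g : F} {α : I →₀ ℕ} {h : Fˣ}
    (hh : (h : F) = g ^ p * (α.prod fun i k => R.s i ^ k : Fˣ)) (c : F) :
    SymbolSeq.prepend (p := p) h (SymbolSeq.const c) =
      α.sum fun i k => k • SymbolSeq.prepend (R.s i) (SymbolSeq.const c) := by
  have hg : g ≠ 0 := by
    rintro rfl
    rw [zero_pow hp.out.ne_zero, zero_mul] at hh
    exact h.ne_zero hh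
  obtain rfl : h = Units.mk0 g hg ^ p * α.prod fun i k => R.s i ^ k := Units.ext (by simp [hh])
  rw [SymbolSeq.prepend_mul, SymbolSeq.prepend_pow, SymbolSeq.prepend_prod, ← map_nsmul,
    ← map_nsmul, nsmul_eq_mul, CharP.cast_eq_zero, zero_mul, map_zero, map_zero, zero_add]

/-- The homomorphism `x ↦ ∑_i τ(k D_i x) ⊗ s_i`, which represents `k dx`. -/
def gradSymbol (k : F) : K →+ SymbolSeq p F :=
  (Finsupp.liftAddHom fun i => (SymbolSeq.prepend (R.s i)).comp
    (SymbolSeq.const.comp (R.τ.comp (AddMonoidHom.mulLeft (R.ψ k))))).comp P.grad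

theorem gradSymbol_apply (k : F) (x : K) : R.gradSymbol k x =
    (P.grad x).sum fun i y => SymbolSeq.prepend (R.s i) (SymbolSeq.const (R.τ (R.ψ k * y))) := rfl

theorem gradSymbol_of_eigen (k : F) {x : K} {α : I →₀ ℕ} (hx : ∀ i, P.D i x = α i * x) :
    R.gradSymbol k x = α.sum fun i m =>
      m • SymbolSeq.prepend (R.s i) (SymbolSeq.const (R.τ (R.ψ k * x))) := by
  rw [gradSymbol_apply, Finsupp.sum_of_support_subset (s := α.support) _ _ _ (by simp),
    Finsupp.sum]
  · refine Finset.sum_congr rfl fun i _ => ?_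
    rw [LogDer.grad_apply, hx, mul_left_comm, ← nsmul_eq_mul, map_nsmul, map_nsmul, map_nsmul]
  · intro i hi
    rw [Finsupp.mem_support_iff, LogDer.grad_apply, hx] at hi
    rw [Finsupp.mem_support_iff]
    intro h0
    rw [h0, Nat.cast_zero, zero_mul] at hi
    exact hi rfl

/-- The symbol of an exact form `dx` vanishes: for `x = g^p t^α` it is `h ⊗ h` with `h = τ(x)`. -/
theorem gradSymbol_one (x : K) : R.gradSymbol 1 x = 0 := by
  induction P.span x using AddSubgroup.closure_induction with
  | mem x hx =>
    obtain ⟨g, α, rfl⟩ := hx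
    rw [R.gradSymbol_of_eigen 1 (fun i => P.D_pow_mul_prod i g α), map_one, one_mul]
    have h1 : R.τ (g ^ p * (α.prod fun i k => P.t i ^ k : Kˣ)) =
        R.τ g ^ p * (α.prod fun i k => R.s i ^ k : Fˣ) := by
      rw [← R.ψ_prod, mul_comm, R.τ_mul, R.τ_pow, mul_comm]
    rw [h1]
    by_cases hg : R.τ g = 0
    · rw [hg, zero_pow hp.out.ne_zero, zero_mul, map_zero]
      simp
    · have hne : R.τ g ^ p * (α.prod fun i k => R.s i ^ k : Fˣ) ≠ 0 :=
        mul_ne_zero (pow_ne_zero _ hg) (Units.ne_zero _)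
      rw [← R.prepend_pow_mul_prod (h := Units.mk0 _ hne) rfl]
      exact SymbolSeq.prepend_const_self (Units.mk0 _ hne)
  | zero => exact map_zero _
  | add x y _ _ hx hy => rw [map_add, hx, hy, add_zero]
  | neg x _ hx => rw [map_neg, hx, neg_zero]

/-- The symbol of `k db` is `kb ⊗ b`. Since `kb ⊗ b = -(kb ⊗ k)`, both sides are additive in `b`,
so that `b` may be assumed to be a monomial in the coordinates times a `p`-th power. -/
theorem gradSymbol_ψ (k b : Fˣ) : R.gradSymbol (k : F) (R.ψ b) =
    SymbolSeq.prepend b (SymbolSeq.const (k * b : F)) := by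
  rw [SymbolSeq.prepend_const_mul]
  generalize (b : F) = b
  induction R.span b using AddSubgroup.closure_induction with
  | mem x hx =>
    obtain ⟨g, α, hx⟩ := hx
    by_cases hx0 : x = 0
    · rw [hx0]; simp
    have h1 := R.gradSymbol_of_eigen (k : F) (x := R.ψ x) (α := α) (fun i => by
      rw [hx, D_ψ_pow_mul_prod, map_mul, map_natCast])
    rw [h1, ← map_mul, τ_ψ, ← R.prepend_pow_mul_prod (h := Units.mk0 x hx0) hx]
    exact SymbolSeq.prepend_const_mul (Units.mk0 x hx0) k
  | zero => simp
  | add x y _ _ hx hy => rw [map_add, map_add, hx, hy, mul_add, map_add, map_add, neg_add]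
  | neg x _ hx => rw [map_neg, map_neg, hx, mul_neg, map_neg, map_neg]

/-- An identity `∑ τ(v_i a) ⊗ s_i = τ(c) ⊗ b` remains true after multiplication by the units `s_j`,
`j ∈ S`. -/
theorem sum_prepend_coordSymbol {v : I →₀ K} {a c : K} {b : Fˣ}
    (h : (v.sum fun i x => SymbolSeq.prepend (p := p) (R.s i) (SymbolSeq.const (R.τ (x * a)))) =
      SymbolSeq.prepend b (SymbolSeq.const (R.τ c))) (S : Finset I) :
    (v.sum fun i x => SymbolSeq.prepend (R.s i) (R.coordSymbol S (x * a))) =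
      SymbolSeq.prepend b (R.coordSymbol S c) := by
  induction S using Finset.induction_on_max with
  | empty => simpa only [coordSymbol_empty] using h
  | insert m T hmax ih =>
    simp only [R.coordSymbol_insert hmax]
    rw [SymbolSeq.prepend_comm b, ← ih, Finsupp.sum, Finsupp.sum, map_sum, ← Finset.sum_neg_distrib]
    exact Finset.sum_congr rfl fun i _ => SymbolSeq.prepend_comm _ _ _

theorem formSymbol_wedge_single (v : I →₀ K) (S : Finset I) (a : K) :
    R.formSymbol (wedge I K v (Finsupp.single S a)) =
      v.sum fun i x => SymbolSeq.prepend (R.s i) (R.coordSymbol S (x * a)) := by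
  rw [wedge_apply, Finsupp.sum, map_sum, Finsupp.sum]
  refine Finset.sum_congr rfl fun i _ => ?_
  rw [← map_smul, formSymbol_wedgeVar, Finsupp.smul_single, formSymbol_single, smul_eq_mul]

theorem formSymbol_d (w : Form I K) : R.formSymbol (P.d w) = 0 := by
  induction w using Finsupp.induction_linear with
  | zero => simp
  | add v w hv hw => rw [map_add, map_add, hv, hw, add_zero]
  | single S a =>
    have h := R.gradSymbol_one a
    rw [gradSymbol_apply, map_one] at h
    rw [LogDer.d_single, formSymbol_wedge_single, R.sum_prepend_coordSymbol (c := 0) (b := 1),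
      SymbolSeq.prepend_one]
    simpa only [SymbolSeq.prepend_one, one_mul, mul_one] using h

theorem formSymbol_map_frobenius (w : Form I K) :
    R.formSymbol (Form.map I (frobenius K p : K →+ K) w) = R.formSymbol w := by
  induction w using Finsupp.induction_linear with
  | zero => simp
  | add v w hv hw => rw [map_add, map_add, map_add, hv, hw]
  | single S a =>
    rw [Form.map_single, formSymbol_single, formSymbol_single]
    change R.coordSymbol S (a ^ p) = _
    induction S using Finset.induction_on_max with
    | empty => rw [coordSymbol_empty, coordSymbol_empty, R.τ_pow, SymbolSeq.const_pow]
    | insert m T hmax ih => rw [R.coordSymbol_insert hmax, ih, R.coordSymbol_insert hmax]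

theorem formSymbol_wedge_dlog (b : Fˣ) (w : Form I F) :
    R.formSymbol (wedge I K (P.dlog (Units.map (R.ψ : F →* K) b)) (Form.map I (R.ψ : F →+ K) w)) =
      SymbolSeq.prepend b (R.formSymbol (Form.map I (R.ψ : F →+ K) w)) := by
  induction w using Finsupp.induction_linear with
  | zero => simp
  | add v w hv hw => rw [map_add, map_add, map_add, map_add, map_add, hv, hw]
  | single S a =>
    rw [Form.map_single, formSymbol_single, formSymbol_wedge_single]
    refine R.sum_prepend_coordSymbol ?_ S
    by_cases ha : a = 0
    · rw [ha]; simp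
    -- `a dlog b = k db` with `k = a / b`
    have h := R.gradSymbol_ψ (Units.mk0 a ha * b⁻¹) b
    rw [gradSymbol_apply, ← Units.val_mul, inv_mul_cancel_right, Units.val_mk0] at h
    change _ = SymbolSeq.prepend b (SymbolSeq.const (R.τ (R.ψ a)))
    rw [τ_ψ, ← h, LogDer.dlog, Finsupp.sum_smul_index' (by simp)]
    refine Finsupp.sum_congr fun i _ => ?_
    congr 3
    simp only [smul_eq_mul, Units.val_mul, Units.val_mk0, map_mul,
      ← map_inv, Units.coe_map]
    change R.ψ (↑b⁻¹ : F) * _ * R.ψ a = _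
    ring

theorem exists_dlog_ψ (b : Fˣ) : ∃ v : I →₀ F,
    P.dlog (Units.map (R.ψ : F →* K) b) = v.mapRange R.ψ (map_zero _) := by
  refine ⟨(P.dlog (Units.map (R.ψ : F →* K) b)).mapRange R.τ (map_zero _), ?_⟩
  ext i
  obtain ⟨g, hg⟩ := R.exists_D_ψ i b
  have h : P.dlog (Units.map (R.ψ : F →* K) b) i = R.ψ (↑b⁻¹ * g) := by
    rw [map_mul, ← hg, ← LogDer.grad_apply, LogDer.dlog, Finsupp.smul_apply, ← map_inv]
    rfl
  rw [Finsupp.mapRange_apply, Finsupp.mapRange_apply, h, τ_ψ]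

theorem formSymbol_wedgeMulti_dlog {n : ℕ} (b : Fin n → Fˣ) :
    (∃ w : Form I F, (wedgeMulti I K n fun k => P.dlog (Units.map (R.ψ : F →* K) (b k))) =
      Form.map I (R.ψ : F →+ K) w) ∧
    ∀ a, R.formSymbol (R.ψ a •
      wedgeMulti I K n fun k => P.dlog (Units.map (R.ψ : F →* K) (b k))) =
        Pi.single n (wittHMk 1 n (wittSymbol (wittTeich p 1 a) b)) := by
  induction n with
  | zero =>
    refine ⟨⟨Finsupp.single ∅ 1, by rw [wedgeMulti_zero, Form.map_single]; simp⟩, fun a => ?_⟩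
    rw [wedgeMulti_zero, Finsupp.smul_single, smul_eq_mul, mul_one, formSymbol_single,
      coordSymbol_empty, τ_ψ, SymbolSeq.const_apply, Subsingleton.elim b Fin.elim0]
  | succ n ih =>
    obtain ⟨⟨w, hw⟩, h⟩ := ih fun k => b k.succ
    refine ⟨?_, fun a => ?_⟩
    · obtain ⟨v, hv⟩ := R.exists_dlog_ψ (b 0)
      exact ⟨wedge I F v w, by rw [wedgeMulti_succ, hw, hv, Form.map_wedge]⟩
    · rw [wedgeMulti_succ, ← map_smul, hw, ← Form.map_smul, formSymbol_wedge_dlog, Form.map_smul,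
        ← hw, h, SymbolSeq.prepend_single, wittHPrepend_mk]
      congr 3
      exact Fin.cons_self_tail b

/-- The composition of the differential symbol `a ⊗ b_1 ⊗ ⋯ ⊗ b_n ↦ a dlog b_1 ∧ ⋯ ∧ dlog b_n` with
`formSymbol` is the identity on `H_p^{n+1}(F)`. -/
theorem formSymbol_symbolForm {n : ℕ} (X : WittTensor p F 1 n) :
    R.formSymbol (P.symbolForm R.ψ n X) = Pi.single n (wittHMk 1 n X) := by
  induction X using wittTensor_induction with
  | h0 => simp
  | hadd X Y hX hY => rw [map_add, map_add, hX, hY, map_add, Pi.single_add]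
  | h w b =>
    rw [PCoord.symbolForm_symbol, (R.formSymbol_wedgeMulti_dlog b).2]
    congr 3
    ext k
    obtain rfl : k = 0 := Subsingleton.elim _ _
    simp [wittTeich]

/-- A symbol of `H_p^{n+1}(F)` is trivial if its differential form is. -/
theorem mem_wittJ_of_symbolForm {n : ℕ} {X : WittTensor p F 1 n} {z v : Form I K}
    (h : P.symbolForm R.ψ n X = P.d z + (Form.map I (frobenius K p : K →+ K) v - v)) :
    X ∈ wittJ p F 1 n := by
  have h1 := R.formSymbol_symbolForm X
  rw [h, map_add, map_sub, formSymbol_d, formSymbol_map_frobenius, sub_self, add_zero, eq_comm,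
    Pi.single_eq_zero_iff, wittHMk_eq_zero_iff] at h1
  exact h1

end PCoordRetract

/-! ### `p`-bases and polynomials over the Witt vectors -/

/-- The monomial `t^α`. -/
abbrev monom {I K : Type*} [Field K] (t : I → Kˣ) (α : I →₀ ℕ) : Kˣ := α.prod fun i k => t i ^ k

theorem monom_add {I K : Type*} [Field K] (t : I → Kˣ) (α β : I →₀ ℕ) :
    monom t (α + β) = monom t α * monom t β :=
  Finsupp.prod_add_index' (by simp) (by simp [pow_add])

theorem monom_nsmul {I K : Type*} [Field K] (t : I → Kˣ) (n : ℕ) (α : I →₀ ℕ) :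
    monom t (n • α) = monom t α ^ n := by
  induction n with
  | zero => simp [monom]
  | succ n ih => rw [succ_nsmul, monom_add, ih, pow_succ]

/-- The `t_i` form a `p`-basis of the field `K` of characteristic `p`: the monomials in the `t_i`
with exponents less than `p` form a basis of `K` over `K^p`. -/
structure IsPBasis (p : ℕ) {I K : Type*} [Field K] (t : I → Kˣ) : Prop where
  indep : ∀ c : (I →₀ ℕ) →₀ K, (∀ α ∈ c.support, ∀ i, α i < p) →
    (c.sum fun α g => g ^ p * (monom t α : K)) = 0 → c = 0
  span : ∀ f : K, f ∈ AddSubgroup.closure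
    {x : K | ∃ (g : K) (α : I →₀ ℕ), x = g ^ p * (monom t α : K)}

namespace IsPBasis

variable {p : ℕ} [hp : Fact p.Prime] {I : Type*} {K : Type*} [Field K] [CharP K p] {t : I → Kˣ}

/-- The monomials span `K` over `K^(p^M)`. -/
theorem span_pow (h : IsPBasis p t) (M : ℕ) (f : K) : f ∈ AddSubgroup.closure
    {x : K | ∃ (g : K) (α : I →₀ ℕ), x = g ^ p ^ M * (monom t α : K)} := by
  induction M generalizing f with
  | zero => exact AddSubgroup.subset_closure ⟨f, 0, by simp [monom]⟩
  | succ M ih =>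
    induction h.span f using AddSubgroup.closure_induction with
    | mem f hf =>
      obtain ⟨g, α, rfl⟩ := hf
      induction ih g using AddSubgroup.closure_induction with
      | mem g hg =>
        obtain ⟨g, β, rfl⟩ := hg
        refine AddSubgroup.subset_closure ⟨g, p • β + α, ?_⟩
        rw [monom_add, monom_nsmul, Units.val_mul, Units.val_pow_eq_pow_val, pow_succ p M, pow_mul]
        ring
      | zero => rw [zero_pow hp.out.ne_zero, zero_mul]; exact zero_mem _
      | add x y _ _ hx hy =>
        change frobenius K p (x + y) * _ ∈ _
        rw [map_add, add_mul]
        exact add_mem hx hy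
      | neg x _ hx =>
        change frobenius K p (-x) * _ ∈ _
        rw [map_neg, neg_mul]
        exact neg_mem hx
    | zero => exact zero_mem _
    | add x y _ _ hx hy => exact add_mem hx hy
    | neg x _ hx => exact neg_mem hx

/-- The monomials with exponents less than `p^M` are linearly independent over `K^(p^M)`. -/
theorem indep_pow (h : IsPBasis p t) (M : ℕ) (c : (I →₀ ℕ) →₀ K)
    (hc : ∀ α ∈ c.support, ∀ i, α i < p ^ M)
    (h0 : (c.sum fun α g => g ^ p ^ M * (monom t α : K)) = 0) : c = 0 := by
  induction M generalizing c with
  | zero =>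
    have h1 : ∀ α ∈ c.support, α = 0 := fun α hα => by
      ext i
      have := hc α hα i
      simpa using this
    have h2 : c = Finsupp.single 0 (c 0) := by
      ext α
      by_cases hα : α ∈ c.support
      · obtain rfl := h1 α hα; simp
      · rw [Finsupp.notMem_support_iff.1 hα]
        by_cases h3 : α = 0
        · subst h3; rw [Finsupp.notMem_support_iff.1 hα]; simp
        · rw [Finsupp.single_eq_of_ne h3]
    rw [h2, Finsupp.sum_single_index (by simp)] at h0
    simp [monom] at h0
    rw [h2, h0, Finsupp.single_zero]
  | succ M ih =>
    classical
    set lo : (I →₀ ℕ) → (I →₀ ℕ) := fun α => α.mapRange (· % p) (Nat.zero_mod p) with hlo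
    set hi : (I →₀ ℕ) → (I →₀ ℕ) := fun α => α.mapRange (· / p) (Nat.zero_div p) with hhi
    have hdec : ∀ α, α = lo α + p • hi α := fun α => by
      ext i
      simp only [hlo, hhi, Finsupp.add_apply, Finsupp.smul_apply, Finsupp.mapRange_apply,
        smul_eq_mul]
      exact (Nat.mod_add_div _ _).symm
    -- the coefficients with respect to the monomials with exponents less than `p`
    set y : (I →₀ ℕ) →₀ K := c.sum fun α g =>
      Finsupp.single (lo α) (g ^ p ^ M * (monom t (hi α) : K)) with hy
    have hF : ∀ c' : (I →₀ ℕ) →₀ K, (c'.sum fun α g => g ^ p * (monom t α : K)) =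
        Finsupp.liftAddHom (fun α => (AddMonoidHom.mulRight (monom t α : K)).comp
          (frobenius K p : K →+ K)) c' := fun _ => rfl
    have hy0 : y = 0 := by
      apply h.indep
      · intro β hβ i
        obtain ⟨α, -, hα⟩ := Finset.mem_biUnion.1 (Finsupp.support_sum hβ)
        rw [Finset.mem_singleton.1 (Finsupp.support_single_subset hα)]
        exact Nat.mod_lt _ hp.out.pos
      · rw [hF, hy, Finsupp.sum, map_sum, ← h0]
        refine Finset.sum_congr rfl fun α _ => ?_
        rw [Finsupp.liftAddHom_apply_single]
        have hm : (monom t α : K) = monom t (lo α) * (monom t (hi α) : K) ^ p := by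
          conv_lhs => rw [hdec α]
          rw [monom_add, monom_nsmul, Units.val_mul, Units.val_pow_eq_pow_val]
        change (c α ^ p ^ M * (monom t (hi α) : K)) ^ p * (monom t (lo α) : K) =
          c α ^ p ^ (M + 1) * (monom t α : K)
        rw [hm, pow_succ p M, pow_mul]
        ring
    ext α₀
    have hz := ih (c.sum fun α g => if lo α = lo α₀ then Finsupp.single (hi α) g else 0) (by
        intro β hβ i
        obtain ⟨α, hα, hβ⟩ := Finset.mem_biUnion.1 (Finsupp.support_sum hβ)
        split_ifs at hβ with hl
        · rw [Finset.mem_singleton.1 (Finsupp.support_single_subset hβ)]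
          have := hc α hα i
          rw [pow_succ] at this
          exact Nat.div_lt_of_lt_mul (by rwa [mul_comm])
        · simp at hβ) (by
        have h1 : ∀ c' : (I →₀ ℕ) →₀ K, (c'.sum fun α g => g ^ p ^ M * (monom t α : K)) =
          Finsupp.liftAddHom (fun α => (AddMonoidHom.mulRight (monom t α : K)).comp
            (iterateFrobenius K p M : K →+ K)) c' := fun _ => rfl
        have h2 := DFunLike.congr_fun hy0 (lo α₀)
        rw [hy, Finsupp.sum_apply, Finsupp.zero_apply, Finsupp.sum] at h2
        rw [h1, Finsupp.sum, map_sum, ← h2]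
        refine Finset.sum_congr rfl fun α _ => ?_
        split_ifs with hl
        · rw [Finsupp.liftAddHom_apply_single, hl, Finsupp.single_eq_same]; rfl
        · rw [map_zero, Finsupp.single_eq_of_ne (Ne.symm hl)])
    have h3 := DFunLike.congr_fun hz (hi α₀)
    rw [Finsupp.sum_apply, Finsupp.zero_apply, Finsupp.sum] at h3
    rw [Finsupp.zero_apply, ← h3, eq_comm]
    by_cases hα₀ : α₀ ∈ c.support
    · rw [Finset.sum_eq_single_of_mem α₀ hα₀]
      · simp
      · intro α _ hne
        split_ifs with hl
        · rw [Finsupp.single_eq_of_ne]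
          intro he
          apply hne
          rw [hdec α, hdec α₀, hl, ← he]
        · rfl
    · rw [Finsupp.notMem_support_iff.1 hα₀]
      refine Finset.sum_eq_zero fun α hα => ?_
      split_ifs with hl
      · rw [Finsupp.single_eq_of_ne]
        intro he
        apply hα₀
        rwa [hdec α₀, ← hl, he, ← hdec α]
      · rfl

end IsPBasis

section Witt

open MvPolynomial

variable {p : ℕ} [hp : Fact p.Prime] {I : Type*} {K : Type*} [Field K] [CharP K p]

variable (p K) in
/-- Witt vectors over a perfect field that contains `K`. -/
abbrev BigWitt := WittVector p (AlgebraicClosure K)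

theorem map_iterateFrobenius_verschiebung (M : ℕ) (v : WittVector p K) :
    WittVector.map ((algebraMap K (AlgebraicClosure K)).comp (iterateFrobenius K p (M + 1)))
        (WittVector.verschiebung v) =
      (p : BigWitt p K) *
        WittVector.map ((algebraMap K (AlgebraicClosure K)).comp (iterateFrobenius K p M)) v := by
  have h1 : iterateFrobenius K p (M + 1) = (iterateFrobenius K p M).comp (frobenius K p) := by
    ext x
    simp only [iterateFrobenius_def, RingHom.comp_apply, frobenius_def]
    rw [← pow_mul, pow_succ']
  have h2 : WittVector.map ((algebraMap K (AlgebraicClosure K)).comp (iterateFrobenius K p (M + 1)))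
      (WittVector.verschiebung v) = WittVector.map ((algebraMap K (AlgebraicClosure K)).comp
        (iterateFrobenius K p M)) (WittVector.map (frobenius K p) (WittVector.verschiebung v)) := by
    ext k
    simp only [WittVector.map_coeff, h1, RingHom.comp_apply]
  rw [h2, ← WittVector.frobenius_eq_map_frobenius, WittVector.frobenius_verschiebung, map_mul,
    map_natCast, mul_comm]

theorem p_dvd_iff_coeff_zero (x : BigWitt p K) : (p : BigWitt p K) ∣ x ↔ x.coeff 0 = 0 := by
  rw [← WittVector.mem_span_p_iff_coeff_zero_eq_zero, Ideal.mem_span_singleton]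

theorem eq_verschiebung_shift {x : WittVector p K} (h : x.coeff 0 = 0) :
    x = WittVector.verschiebung (x.shift 1) := by
  have := WittVector.verschiebung_shift x 0 (by simpa using h)
  rw [this]
  ext k
  rw [WittVector.shift_coeff, zero_add]

variable (t : I → Kˣ)

/-- The evaluation `∑ c_α X^α ↦ ∑ φ^M(c_α) [t]^α` of polynomials over the Witt vectors of `K`. Its
image is a lift of `K = K^(p^M)[t]`. -/
def wittEval (M : ℕ) : MvPolynomial I (WittVector p K) →+* BigWitt p K :=
  eval₂Hom (WittVector.map ((algebraMap K (AlgebraicClosure K)).comp (iterateFrobenius K p M)))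
    fun i => WittVector.teichmuller p (algebraMap K (AlgebraicClosure K) (t i))

/-- The reduction of `wittEval` modulo `p`. -/
def wittEvalRes (M : ℕ) : MvPolynomial I (WittVector p K) →+* K :=
  eval₂Hom ((iterateFrobenius K p M).comp WittVector.constantCoeff) fun i => t i

theorem wittEval_monomial (M : ℕ) (α : I →₀ ℕ) (c : WittVector p K) :
    wittEval t M (monomial α c) =
      WittVector.map ((algebraMap K (AlgebraicClosure K)).comp (iterateFrobenius K p M)) c *
        WittVector.teichmuller p (algebraMap K (AlgebraicClosure K) (monom t α : K)) := by
  rw [wittEval, eval₂Hom_monomial]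
  congr 1
  rw [monom, Finsupp.prod, Finsupp.prod, Units.coe_prod, map_prod, map_prod]
  refine Finset.prod_congr rfl fun i _ => ?_
  rw [Units.val_pow_eq_pow_val, map_pow, map_pow]

theorem wittEvalRes_monomial (M : ℕ) (α : I →₀ ℕ) (c : WittVector p K) :
    wittEvalRes t M (monomial α c) = c.coeff 0 ^ p ^ M * (monom t α : K) := by
  rw [wittEvalRes, eval₂Hom_monomial, RingHom.comp_apply, iterateFrobenius_def]
  congr 1
  rw [monom, Finsupp.prod, Finsupp.prod, Units.coe_prod]
  exact Finset.prod_congr rfl fun i _ => (Units.val_pow_eq_pow_val _ _).symm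

theorem coeff_zero_wittEval (M : ℕ) (f : MvPolynomial I (WittVector p K)) :
    (wittEval t M f).coeff 0 = algebraMap K (AlgebraicClosure K) (wittEvalRes t M f) := by
  have h : (WittVector.constantCoeff (p := p)).comp (wittEval t M) =
      (algebraMap K (AlgebraicClosure K)).comp (wittEvalRes t M) := by
    apply MvPolynomial.ringHom_ext
    · intro c
      simp [wittEval, wittEvalRes]
    · intro i
      simp [wittEval, wittEvalRes]
  exact RingHom.congr_fun h f

theorem p_dvd_wittEval_iff (M : ℕ) (f : MvPolynomial I (WittVector p K)) :
    (p : BigWitt p K) ∣ wittEval t M f ↔ wittEvalRes t M f = 0 := by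
  rw [p_dvd_iff_coeff_zero, coeff_zero_wittEval, map_eq_zero]

variable (p K) in
/-- The derivation `X_i ∂/∂X_i`. -/
def eulerDer (i : I) :
    Derivation ℤ (MvPolynomial I (WittVector p K)) (MvPolynomial I (WittVector p K)) :=
  Derivation.restrictScalars ℤ ((X i : MvPolynomial I (WittVector p K)) • pderiv i)

theorem eulerDer_monomial (i : I) (α : I →₀ ℕ) (c : WittVector p K) :
    eulerDer p K i (monomial α c) = α i • monomial α c := by
  classical
  change X i * pderiv i (monomial α c) = _
  rw [pderiv_monomial, X, monomial_mul, one_mul]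
  by_cases h : α i = 0
  · rw [h]; simp
  · rw [add_tsub_cancel_of_le (by
      rw [Finsupp.single_le_iff]; omega), ← nsmul_eq_mul', map_nsmul]

/-- Exponents can be reduced modulo `p^M`. -/
theorem exists_reduced (M : ℕ) (f : MvPolynomial I (WittVector p K)) :
    ∃ f', (∀ α ∈ f'.support, ∀ i, α i < p ^ M) ∧ wittEval t M f' = wittEval t M f ∧
      ∀ i, (p : BigWitt p K) ^ M ∣
        wittEval t M (eulerDer p K i f) - wittEval t M (eulerDer p K i f') := by
  classical
  induction f using MvPolynomial.induction_on' with
  | monomial α c =>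
    set lo := α.mapRange (· % p ^ M) (Nat.zero_mod _) with hlo
    set hi := α.mapRange (· / p ^ M) (Nat.zero_div _) with hhi
    have hdec : α = lo + p ^ M • hi := by
      ext i
      simp only [hlo, hhi, Finsupp.add_apply, Finsupp.smul_apply, Finsupp.mapRange_apply,
        smul_eq_mul]
      exact (Nat.mod_add_div _ _).symm
    have hev : wittEval t M (monomial lo (c * WittVector.teichmuller p (monom t hi : K))) =
        wittEval t M (monomial α c) := by
      rw [wittEval_monomial, wittEval_monomial, map_mul, WittVector.map_teichmuller, mul_assoc,
        ← map_mul, RingHom.comp_apply, ← map_mul, iterateFrobenius_def]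
      conv_rhs => rw [hdec]
      rw [monom_add, monom_nsmul, Units.val_mul, Units.val_pow_eq_pow_val,
        mul_comm (monom t lo : K)]
    refine ⟨monomial lo (c * WittVector.teichmuller p (monom t hi : K)), fun β hβ i => ?_, hev,
      fun i => ?_⟩
    · rw [Finset.mem_singleton.1 (support_monomial_subset hβ)]
      exact Nat.mod_lt _ (pow_pos hp.out.pos _)
    · rw [eulerDer_monomial, eulerDer_monomial, map_nsmul, map_nsmul, hev, nsmul_eq_mul,
        nsmul_eq_mul, ← sub_mul]
      refine Dvd.dvd.mul_right ⟨(hi i : BigWitt p K), ?_⟩ _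
      have h := DFunLike.congr_fun hdec i
      rw [Finsupp.add_apply, Finsupp.smul_apply, smul_eq_mul] at h
      rw [h]
      push_cast
      ring
  | add f g hf hg =>
    obtain ⟨f', h1, h2, h3⟩ := hf
    obtain ⟨g', h1', h2', h3'⟩ := hg
    refine ⟨f' + g', fun α hα i => ?_, by rw [map_add, map_add, h2, h2'], fun i => ?_⟩
    · rcases Finset.mem_union.1 (MvPolynomial.support_add hα) with h | h
      · exact h1 α h i
      · exact h1' α h i
    · rw [map_add, map_add, map_add, map_add, add_sub_add_comm]
      exact dvd_add (h3 i) (h3' i)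

variable {t}

/-- If `wittEval f` is divisible by `p`, the quotient is a value of `wittEval` with one Frobenius
twist less, compatibly with the derivations. -/
theorem exists_div_p (h : IsPBasis p t) (M : ℕ) {f : MvPolynomial I (WittVector p K)}
    (hf : (p : BigWitt p K) ∣ wittEval t (M + 1) f) :
    ∃ f', wittEval t (M + 1) f = p * wittEval t M f' ∧ ∀ i, (p : BigWitt p K) ^ (M + 1) ∣
      wittEval t (M + 1) (eulerDer p K i f) - p * wittEval t M (eulerDer p K i f') := by
  -- once the exponents are reduced, all coefficients are divisible by the Verschiebung, because the
  -- reduced monomials are independent over `K^(p^(M+1))`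
  obtain ⟨g, h1, h2, h3⟩ := exists_reduced t (M + 1) f
  rw [← h2, p_dvd_wittEval_iff] at hf
  have hg0 : ∀ α, (coeff α g).coeff 0 = 0 := by
    have h4 := h.indep_pow (M + 1)
      (Finsupp.onFinset g.support (fun α => (coeff α g).coeff 0) fun α hα => by
        rw [mem_support_iff]
        rintro h0
        rw [h0] at hα
        exact hα (WittVector.zero_coeff p K 0))
      (fun α hα => h1 α (Finsupp.support_onFinset_subset hα)) (by
        rw [Finsupp.onFinset_sum _ (fun α => by
          rw [zero_pow (pow_ne_zero _ hp.out.ne_zero), zero_mul]), ← hf]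
        conv_rhs => rw [← support_sum_monomial_coeff g, map_sum]
        exact Finset.sum_congr rfl fun α _ => (wittEvalRes_monomial t _ _ _).symm)
    exact fun α => DFunLike.congr_fun h4 α
  refine ⟨∑ α ∈ g.support, monomial α ((coeff α g).shift 1), ?_, fun i => ?_⟩
  · rw [← h2]
    conv_lhs => rw [← support_sum_monomial_coeff g]
    rw [map_sum, map_sum, Finset.mul_sum]
    refine Finset.sum_congr rfl fun α _ => ?_
    rw [wittEval_monomial, wittEval_monomial, ← mul_assoc, ← map_iterateFrobenius_verschiebung,
      ← eq_verschiebung_shift (hg0 α)]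
  · convert h3 i using 2
    conv_rhs => rw [← support_sum_monomial_coeff g]
    rw [map_sum, map_sum, map_sum, map_sum, Finset.mul_sum]
    refine Finset.sum_congr rfl fun α _ => ?_
    rw [eulerDer_monomial, eulerDer_monomial, map_nsmul, map_nsmul, mul_smul_comm,
      wittEval_monomial, wittEval_monomial, ← mul_assoc, ← map_iterateFrobenius_verschiebung,
      ← eq_verschiebung_shift (hg0 α)]

theorem p_mul_dvd_iff {k : ℕ} {x : BigWitt p K} :
    (p : BigWitt p K) ^ (k + 1) ∣ p * x ↔ (p : BigWitt p K) ^ k ∣ x := by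
  rw [pow_succ']
  exact mul_dvd_mul_iff_left (WittVector.p_nonzero p (AlgebraicClosure K))

/-- The derivations preserve divisibility by `p^k`. -/
theorem pow_dvd_wittEval_eulerDer (h : IsPBasis p t) {M k : ℕ} (hk : k ≤ M)
    {f : MvPolynomial I (WittVector p K)} (hf : (p : BigWitt p K) ^ k ∣ wittEval t M f) (i : I) :
    (p : BigWitt p K) ^ k ∣ wittEval t M (eulerDer p K i f) := by
  induction k generalizing M f with
  | zero => rw [pow_zero]; exact one_dvd _
  | succ k ih =>
    obtain ⟨M, rfl⟩ : ∃ M', M = M' + 1 := ⟨M - 1, by omega⟩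
    obtain ⟨f', h1, h2⟩ := exists_div_p h M ((dvd_pow_self _ (Nat.succ_ne_zero k)).trans hf)
    rw [h1, p_mul_dvd_iff] at hf
    have h3 := p_mul_dvd_iff.2 (ih (by omega) hf)
    exact (dvd_sub_left h3).1 ((pow_dvd_pow _ hk).trans (h2 i))

theorem wittEvalRes_surjective (h : IsPBasis p t) (M : ℕ) :
    Function.Surjective (wittEvalRes (p := p) t M) := by
  intro x
  induction h.span_pow M x using AddSubgroup.closure_induction with
  | mem x hx =>
    obtain ⟨g, α, rfl⟩ := hx
    refine ⟨monomial α (WittVector.teichmuller p g), ?_⟩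
    rw [wittEvalRes_monomial, WittVector.teichmuller_coeff_zero]
  | zero => exact ⟨0, map_zero _⟩
  | add x y _ _ hx hy =>
    obtain ⟨f, rfl⟩ := hx
    obtain ⟨g, rfl⟩ := hy
    exact ⟨f + g, map_add _ _ _⟩
  | neg x _ hx =>
    obtain ⟨f, rfl⟩ := hx
    exact ⟨-f, map_neg _ _⟩

theorem p_dvd_sub_iff (x y : BigWitt p K) :
    (p : BigWitt p K) ∣ x - y ↔ x.coeff 0 = y.coeff 0 := by
  rw [p_dvd_iff_coeff_zero, ← sub_eq_zero (a := x.coeff 0)]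
  exact Eq.congr_left (map_sub (WittVector.constantCoeff (p := p)) x y)

theorem exists_eq_teichmuller_add (c : WittVector p K) :
    ∃ v, c = WittVector.teichmuller p (c.coeff 0) + WittVector.verschiebung v := by
  refine ⟨(c - WittVector.teichmuller p (c.coeff 0)).shift 1, ?_⟩
  rw [← eq_verschiebung_shift, add_sub_cancel]
  refine (map_sub (WittVector.constantCoeff (p := p)) _ _).trans ?_
  exact sub_eq_zero.2 (WittVector.teichmuller_coeff_zero p _).symm

theorem exists_wittEval_approx_teichmuller (h : IsPBasis p t) (M m : ℕ) (a : K) :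
    ∃ g, (p : BigWitt p K) ^ (m + 1) ∣ WittVector.map
      ((algebraMap K (AlgebraicClosure K)).comp (iterateFrobenius K p m))
        (WittVector.teichmuller p a) - wittEval t M g := by
  obtain ⟨g, hg⟩ := wittEvalRes_surjective h M a
  refine ⟨g ^ p ^ m, ?_⟩
  rw [WittVector.map_teichmuller, RingHom.comp_apply, iterateFrobenius_def, map_pow, map_pow,
    map_pow]
  apply dvd_sub_pow_of_dvd_sub
  rw [p_dvd_sub_iff, coeff_zero_wittEval, WittVector.teichmuller_coeff_zero, hg]

/-- `φ^m(c)` is approximated by values of `wittEval` modulo `p^(m+1)`, because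
`φ^m(V^k [a]) = p^k [a]^(p^(m-k))`. -/
theorem exists_wittEval_approx_map (h : IsPBasis p t) (M m : ℕ) (c : WittVector p K) :
    ∃ g, (p : BigWitt p K) ^ (m + 1) ∣ WittVector.map
      ((algebraMap K (AlgebraicClosure K)).comp (iterateFrobenius K p m)) c - wittEval t M g := by
  induction m generalizing c with
  | zero =>
    obtain ⟨g, hg⟩ := exists_wittEval_approx_teichmuller h M 0 (c.coeff 0)
    obtain ⟨v, hv⟩ := exists_eq_teichmuller_add c
    refine ⟨g, ?_⟩
    generalize WittVector.teichmuller p (c.coeff 0) = T at hg hv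
    rw [hv, map_add, add_sub_right_comm]
    refine dvd_add hg ?_
    rw [zero_add, pow_one, p_dvd_iff_coeff_zero, WittVector.map_coeff,
      WittVector.verschiebung_coeff_zero, map_zero]
  | succ m ih =>
    obtain ⟨g, hg⟩ := exists_wittEval_approx_teichmuller h M (m + 1) (c.coeff 0)
    obtain ⟨v, hv⟩ := exists_eq_teichmuller_add c
    obtain ⟨g', hg'⟩ := ih v
    refine ⟨g + p * g', ?_⟩
    generalize WittVector.teichmuller p (c.coeff 0) = T at hg hv
    rw [hv, map_add, map_iterateFrobenius_verschiebung, map_add, map_mul, map_natCast,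
      add_sub_add_comm, ← mul_sub]
    exact dvd_add hg (p_mul_dvd_iff.2 hg')

theorem exists_wittEval_approx (h : IsPBasis p t) (M m : ℕ) (f : MvPolynomial I (WittVector p K)) :
    ∃ g, (p : BigWitt p K) ^ (m + 1) ∣ wittEval t m f - wittEval t M g := by
  induction f using MvPolynomial.induction_on' with
  | monomial α c =>
    obtain ⟨g, hg⟩ := exists_wittEval_approx_map h M m c
    refine ⟨g * monomial α 1, ?_⟩
    rw [wittEval_monomial, map_mul, wittEval_monomial, map_one, one_mul, ← sub_mul]
    exact Dvd.dvd.mul_right hg _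
  | add f g hf hg =>
    obtain ⟨f', hf'⟩ := hf
    obtain ⟨g', hg'⟩ := hg
    refine ⟨f' + g', ?_⟩
    rw [map_add, map_add, add_sub_add_comm]
    exact dvd_add hf' hg'

/-- The image of `wittEval` modulo `p^M` is flat over `ℤ/p^M`: a value divisible by `p` is `p` times
a value. -/
theorem exists_wittEval_eq_p_mul (h : IsPBasis p t) {M : ℕ} (hM : M ≠ 0)
    {f : MvPolynomial I (WittVector p K)} (hf : (p : BigWitt p K) ∣ wittEval t M f) :
    ∃ g, (p : BigWitt p K) ^ M ∣ wittEval t M (f - p * g) := by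
  obtain ⟨M, rfl⟩ := Nat.exists_eq_succ_of_ne_zero hM
  obtain ⟨f', h1, -⟩ := exists_div_p h M hf
  obtain ⟨g, hg⟩ := exists_wittEval_approx h (M + 1) M f'
  refine ⟨g, ?_⟩
  rw [map_sub, map_mul, map_natCast, h1, ← mul_sub]
  exact Dvd.dvd.mul_left hg _

theorem exists_wittEval_eq_pow_mul (h : IsPBasis p t) {M k : ℕ} (hk : k ≤ M)
    {f : MvPolynomial I (WittVector p K)} (hf : (p : BigWitt p K) ^ k ∣ wittEval t M f) :
    ∃ g, (p : BigWitt p K) ^ M ∣ wittEval t M (f - p ^ k * g) := by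
  induction k generalizing f with
  | zero => exact ⟨f, by simp⟩
  | succ k ih =>
    obtain ⟨g, hg⟩ := exists_wittEval_eq_p_mul h (by omega : M ≠ 0)
      ((dvd_pow_self _ (Nat.succ_ne_zero k)).trans hf)
    have h1 : (p : BigWitt p K) ^ (k + 1) ∣ p * wittEval t M g := by
      rw [map_sub, map_mul, map_natCast] at hg
      exact (dvd_sub_right hf).1 ((pow_dvd_pow _ hk).trans hg)
    obtain ⟨g', hg'⟩ := ih (by omega) (p_mul_dvd_iff.1 h1)
    refine ⟨g', ?_⟩
    have h2 : f - p ^ (k + 1) * g' = (f - p * g) + p * (g - p ^ k * g') := by ring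
    rw [h2, map_add, map_mul]
    exact dvd_add hg (Dvd.dvd.mul_left hg' _)

end Witt

/-! ### The lift defined by a `p`-basis -/

section Coordinates

open MvPolynomial

variable {p : ℕ} [hp : Fact p.Prime] {I : Type*} {K : Type*} [Field K] [CharP K p] {t : I → Kˣ}

theorem eulerDer_comm (i j : I) (f : MvPolynomial I (WittVector p K)) :
    eulerDer p K i (eulerDer p K j f) = eulerDer p K j (eulerDer p K i f) := by
  induction f using MvPolynomial.induction_on' with
  | monomial α c =>
    rw [eulerDer_monomial, eulerDer_monomial, map_nsmul, map_nsmul, eulerDer_monomial,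
      eulerDer_monomial, smul_comm]
  | add f g hf hg => simp only [map_add, hf, hg]

theorem finite_eulerDer (f : MvPolynomial I (WittVector p K)) :
    {i | eulerDer p K i f ≠ 0}.Finite := by
  induction f using MvPolynomial.induction_on' with
  | monomial α c =>
    refine α.support.finite_toSet.subset fun i hi => ?_
    rw [Finset.mem_coe, Finsupp.mem_support_iff]
    intro h0
    exact hi (by rw [eulerDer_monomial, h0, zero_smul])
  | add f g hf hg =>
    refine (hf.union hg).subset fun i hi => ?_
    by_contra h
    rw [Set.mem_union, not_or, Set.mem_ofPred, Set.mem_ofPred, not_not, not_not] at h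
    exact hi (by rw [map_add, h.1, h.2, add_zero])

theorem IsPBasis.wittEvalRes_eulerDer_eq_zero (h : IsPBasis p t) (i : I)
    (x : MvPolynomial I (WittVector p K)) (hx : wittEvalRes t 1 x = 0) :
    wittEvalRes t 1 (eulerDer p K i x) = 0 := by
  rw [← p_dvd_wittEval_iff] at hx ⊢
  have := pow_dvd_wittEval_eulerDer h (M := 1) le_rfl (f := x) (by rwa [pow_one]) i
  rwa [pow_one] at this

/-- The derivations of `K` induced by `X_i ∂/∂X_i`. -/
def IsPBasis.der (h : IsPBasis p t) (i : I) : Derivation ℤ K K :=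
  Derivation.liftOfSurjective (f := (wittEvalRes t 1).toIntAlgHom) (wittEvalRes_surjective h 1)
    (d := eulerDer p K i) (h.wittEvalRes_eulerDer_eq_zero i)

theorem IsPBasis.der_wittEvalRes_one (h : IsPBasis p t) (i : I)
    (f : MvPolynomial I (WittVector p K)) :
    h.der i (wittEvalRes t 1 f) = wittEvalRes t 1 (eulerDer p K i f) :=
  Derivation.liftOfSurjective_apply (f := (wittEvalRes t 1).toIntAlgHom)
    (wittEvalRes_surjective h 1) (h.wittEvalRes_eulerDer_eq_zero i) f

theorem IsPBasis.der_wittEvalRes (h : IsPBasis p t) (M : ℕ) (i : I)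
    (f : MvPolynomial I (WittVector p K)) :
    h.der i (wittEvalRes t (M + 1) f) = wittEvalRes t (M + 1) (eulerDer p K i f) := by
  have h1 : ∀ f : MvPolynomial I (WittVector p K), wittEvalRes t (M + 1) f =
      wittEvalRes t 1 (MvPolynomial.map (WittVector.map (iterateFrobenius K p M)) f) := fun f => by
    induction f using MvPolynomial.induction_on' with
    | monomial α c =>
      rw [map_monomial, wittEvalRes_monomial, wittEvalRes_monomial, WittVector.map_coeff,
        iterateFrobenius_def, ← pow_mul, pow_one, ← pow_succ]
    | add f g hf hg => simp only [map_add, hf, hg]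
  rw [h1, h1, h.der_wittEvalRes_one]
  congr 1
  induction f using MvPolynomial.induction_on' with
  | monomial α c => simp only [map_monomial, eulerDer_monomial, map_nsmul]
  | add f g hf hg => simp only [map_add, hf, hg]

theorem IsPBasis.exists_pow_of_der_eq_zero (h : IsPBasis p t) {f : K} (hf : ∀ i, h.der i f = 0) :
    ∃ g, f = g ^ p := by
  obtain ⟨f, rfl⟩ := wittEvalRes_surjective (p := p) h 1 f
  obtain ⟨g, hg, hgf, -⟩ := exists_reduced t 1 f
  have hres : wittEvalRes t 1 f = wittEvalRes t 1 g := by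
    apply (algebraMap K (AlgebraicClosure K)).injective
    rw [← coeff_zero_wittEval, ← coeff_zero_wittEval, hgf]
  rw [hres] at hf ⊢
  have hsum : ∀ D : MvPolynomial I (WittVector p K) →+ MvPolynomial I (WittVector p K),
      wittEvalRes t 1 (D g) =
        ∑ α ∈ g.support, wittEvalRes t 1 (D (monomial α (coeff α g))) := fun D => by
    conv_lhs => rw [← support_sum_monomial_coeff g]
    rw [map_sum, map_sum]
  have h0 : ∀ i α, (α i : K) * (coeff α g).coeff 0 = 0 := by
    intro i
    have h1 := h.indep (Finsupp.onFinset g.support (fun α => (α i : K) * (coeff α g).coeff 0)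
      fun α hα => by
        rw [mem_support_iff]
        rintro h0
        rw [h0] at hα
        exact hα (mul_eq_zero_of_right _ (WittVector.zero_coeff p K 0)))
      (fun α hα j => by
        have := hg α (Finsupp.support_onFinset_subset hα) j
        rwa [pow_one] at this) (by
        rw [Finsupp.onFinset_sum _ (fun α => by rw [zero_pow hp.out.ne_zero, zero_mul]), ← hf i,
          h.der_wittEvalRes_one]
        refine Eq.trans ?_ (hsum (eulerDer p K i).toLinearMap.toAddMonoidHom).symm
        refine Finset.sum_congr rfl fun α _ => ?_
        change _ = wittEvalRes t 1 (eulerDer p K i _)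
        rw [eulerDer_monomial, map_nsmul, wittEvalRes_monomial, mul_pow, natCast_pow_char, pow_one,
          nsmul_eq_mul, mul_assoc])
    exact fun α => DFunLike.congr_fun h1 α
  refine ⟨(coeff 0 g).coeff 0, ?_⟩
  have h2 := hsum (AddMonoidHom.id _)
  rw [AddMonoidHom.id_apply] at h2
  rw [h2, Finset.sum_eq_single 0]
  · rw [AddMonoidHom.id_apply, wittEvalRes_monomial]; simp [monom]
  · intro α hα hα0
    obtain ⟨i, hi⟩ := Finsupp.ne_iff.1 hα0
    rw [Finsupp.zero_apply] at hi
    have h3 : (α i : K) ≠ 0 := by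
      rw [Ne, CharP.cast_eq_zero_iff K p]
      have := hg α hα i
      rw [pow_one] at this
      exact Nat.not_dvd_of_pos_of_lt (Nat.pos_of_ne_zero hi) this
    rw [AddMonoidHom.id_apply, wittEvalRes_monomial, (mul_eq_zero.1 (h0 i α)).resolve_left h3,
      zero_pow (pow_ne_zero _ hp.out.ne_zero), zero_mul]
  · intro h0
    rw [notMem_support_iff.1 h0]; simp

/-- The coordinates on `K` defined by a `p`-basis. -/
def IsPBasis.pcoord [DecidableEq I] (h : IsPBasis p t) : PCoord p I K where
  D := h.der
  comm i j a := by
    obtain ⟨f, rfl⟩ := wittEvalRes_surjective (p := p) h 1 a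
    simp only [h.der_wittEvalRes_one, eulerDer_comm i j]
  finite a := by
    obtain ⟨f, rfl⟩ := wittEvalRes_surjective (p := p) h 1 a
    refine (finite_eulerDer f).subset fun i hi h0 => hi ?_
    rw [h.der_wittEvalRes_one, h0, map_zero]
  t := t
  D_t i j := by
    have hX : wittEvalRes t 1 (X j : MvPolynomial I (WittVector p K)) = t j := by
      simp [wittEvalRes]
    have hD : eulerDer p K i (X j : MvPolynomial I (WittVector p K)) =
        (Finsupp.single j 1) i • (X j : MvPolynomial I (WittVector p K)) :=
      eulerDer_monomial i (Finsupp.single j 1) 1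
    rw [← hX, h.der_wittEvalRes_one, hD, map_nsmul, hX, Finsupp.single_apply]
    by_cases hij : i = j
    · rw [if_pos hij, if_pos hij.symm, one_smul]
    · rw [if_neg hij, if_neg (Ne.symm hij), zero_smul]
  span := h.span
  exists_pow _ := h.exists_pow_of_der_eq_zero

variable (t) in
/-- The polynomials whose value under `wittEval` is divisible by `p^L`. -/
def wittEvalIdeal (L : ℕ) : Ideal (MvPolynomial I (WittVector p K)) :=
  (Ideal.span {(p : BigWitt p K) ^ L}).comap (wittEval t L)

theorem mem_wittEvalIdeal {L : ℕ} {f : MvPolynomial I (WittVector p K)} :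
    f ∈ wittEvalIdeal t L ↔ (p : BigWitt p K) ^ L ∣ wittEval t L f := by
  rw [wittEvalIdeal, Ideal.mem_comap, Ideal.mem_span_singleton]

variable (p I K) in
/-- The Frobenius lift on polynomials with `X_i ↦ X_i^p`. -/
def polyFrob : MvPolynomial I (WittVector p K) →+* MvPolynomial I (WittVector p K) :=
  eval₂Hom (C.comp WittVector.frobenius) fun i => X i ^ p

theorem polyFrob_monomial (α : I →₀ ℕ) (c : WittVector p K) :
    polyFrob p I K (monomial α c) = monomial (p • α) (WittVector.frobenius c) := by
  have h : monomial (p • α) (WittVector.frobenius c) =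
      C (WittVector.frobenius c) * (monomial α 1 : MvPolynomial I (WittVector p K)) ^ p := by
    rw [monomial_pow, one_pow, C_mul_monomial, mul_one]
  rw [h, polyFrob, eval₂Hom_monomial, RingHom.comp_apply, monomial_eq, C_1, one_mul, Finsupp.prod,
    Finsupp.prod, ← Finset.prod_pow]
  congr 1
  exact Finset.prod_congr rfl fun i _ => by rw [← pow_mul, ← pow_mul, mul_comm]

theorem eulerDer_polyFrob (i : I) (f : MvPolynomial I (WittVector p K)) :
    eulerDer p K i (polyFrob p I K f) = p * polyFrob p I K (eulerDer p K i f) := by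
  induction f using MvPolynomial.induction_on' with
  | monomial α c =>
    rw [polyFrob_monomial, eulerDer_monomial, eulerDer_monomial, map_nsmul, polyFrob_monomial,
      Finsupp.smul_apply, smul_eq_mul, mul_smul, nsmul_eq_mul p]
  | add f g hf hg => simp only [map_add, hf, hg, mul_add]

theorem wittEval_polyFrob (M : ℕ) (f : MvPolynomial I (WittVector p K)) :
    wittEval t M (polyFrob p I K f) = WittVector.frobenius (wittEval t M f) := by
  induction f using MvPolynomial.induction_on' with
  | monomial α c =>
    rw [polyFrob_monomial, wittEval_monomial, wittEval_monomial, map_mul, monom_nsmul,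
      Units.val_pow_eq_pow_val]
    ext k
    congr 2
    · ext k
      simp only [WittVector.map_coeff, WittVector.coeff_frobenius_charP, map_pow]
    · rw [WittVector.frobenius_eq_map_frobenius, WittVector.map_teichmuller, frobenius_def, map_pow]
  | add f g hf hg => simp only [map_add, hf, hg]

theorem wittEvalRes_polyFrob (M : ℕ) (f : MvPolynomial I (WittVector p K)) :
    wittEvalRes t M (polyFrob p I K f) = wittEvalRes t M f ^ p := by
  apply (algebraMap K (AlgebraicClosure K)).injective
  rw [← coeff_zero_wittEval, wittEval_polyFrob, WittVector.coeff_frobenius_charP,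
    coeff_zero_wittEval, map_pow]

variable (p t) in
/-- A flat lift of `K` modulo `p^L`: the image of `wittEval` modulo `p^L`. -/
def WittLift (L : ℕ) : Type _ := MvPolynomial I (WittVector p K) ⧸ wittEvalIdeal (p := p) t L

instance (L : ℕ) : CommRing (WittLift p t L) :=
  inferInstanceAs (CommRing (MvPolynomial I (WittVector p K) ⧸ wittEvalIdeal (p := p) t L))

variable (t) in
/-- The projection onto the lift of `K`. -/
def wittLiftMk (L : ℕ) : MvPolynomial I (WittVector p K) →+* WittLift p t L :=
  Ideal.Quotient.mk (wittEvalIdeal t L)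

theorem wittLiftMk_surjective (L : ℕ) : Function.Surjective (wittLiftMk (p := p) t L) :=
  Ideal.Quotient.mk_surjective

theorem wittLiftMk_eq_zero_iff {L : ℕ} {f : MvPolynomial I (WittVector p K)} :
    wittLiftMk t L f = 0 ↔ (p : BigWitt p K) ^ L ∣ wittEval t L f :=
  Ideal.Quotient.eq_zero_iff_mem.trans mem_wittEvalIdeal

theorem wittLiftMk_eq_iff {L : ℕ} {f g : MvPolynomial I (WittVector p K)} :
    wittLiftMk t L f = wittLiftMk t L g ↔ (p : BigWitt p K) ^ L ∣ wittEval t L (f - g) := by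
  rw [← wittLiftMk_eq_zero_iff, map_sub, sub_eq_zero]

theorem IsPBasis.wittLiftMk_eulerDer_eq_zero (h : IsPBasis p t) (L : ℕ) (i : I)
    (x : MvPolynomial I (WittVector p K)) (hx : wittLiftMk t L x = 0) :
    wittLiftMk t L (eulerDer p K i x) = 0 := by
  rw [wittLiftMk_eq_zero_iff] at hx ⊢
  exact pow_dvd_wittEval_eulerDer h le_rfl hx i

/-- The derivations of the lift induced by `X_i ∂/∂X_i`. -/
def IsPBasis.liftDer (h : IsPBasis p t) (L : ℕ) (i : I) :
    Derivation ℤ (WittLift p t L) (WittLift p t L) :=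
  Derivation.liftOfSurjective (f := (wittLiftMk t L).toIntAlgHom)
    (wittLiftMk_surjective L) (d := eulerDer p K i) (h.wittLiftMk_eulerDer_eq_zero L i)

theorem IsPBasis.liftDer_mk (h : IsPBasis p t) (L : ℕ) (i : I)
    (f : MvPolynomial I (WittVector p K)) :
    h.liftDer L i (wittLiftMk t L f) = wittLiftMk t L (eulerDer p K i f) :=
  Derivation.liftOfSurjective_apply (f := (wittLiftMk t L).toIntAlgHom)
    (wittLiftMk_surjective L) (h.wittLiftMk_eulerDer_eq_zero L i) f

variable (t) in
/-- The reduction of the lift modulo `p`. -/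
def wittLiftRes (L : ℕ) : WittLift p t (L + 1) →+* K :=
  Ideal.Quotient.lift _ (wittEvalRes t (L + 1)) fun f hf => by
    rw [← p_dvd_wittEval_iff]
    exact (dvd_pow_self _ (Nat.succ_ne_zero L)).trans (mem_wittEvalIdeal.1 hf)

theorem wittLiftRes_mk (L : ℕ) (f : MvPolynomial I (WittVector p K)) :
    wittLiftRes t L (wittLiftMk t (L + 1) f) = wittEvalRes t (L + 1) f := rfl

variable (t) in
/-- The lift of Frobenius. -/
def wittLiftFrob (L : ℕ) : WittLift p t L →+* WittLift p t L :=
  Ideal.quotientMap _ (polyFrob p I K) fun f hf => by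
    rw [Ideal.mem_comap, mem_wittEvalIdeal, wittEval_polyFrob]
    obtain ⟨y, hy⟩ := mem_wittEvalIdeal.1 hf
    exact ⟨WittVector.frobenius y, by rw [hy, map_mul, map_pow, map_natCast]⟩

theorem wittLiftFrob_mk (L : ℕ) (f : MvPolynomial I (WittVector p K)) :
    wittLiftFrob t L (wittLiftMk t L f) = wittLiftMk t L (polyFrob p I K f) := rfl

/-- A `p`-basis of `K` defines a lift of `K` modulo `p^(L+1)` with a lift of Frobenius. -/
def IsPBasis.frobLift [LinearOrder I] (h : IsPBasis p t) (L : ℕ) :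
    FrobLift h.pcoord (L + 1) (WittLift p t (L + 1)) where
  D := h.liftDer (L + 1)
  comm i j a := by
    obtain ⟨f, rfl⟩ := wittLiftMk_surjective _ a
    simp only [h.liftDer_mk, eulerDer_comm i j]
  finite a := by
    obtain ⟨f, rfl⟩ := wittLiftMk_surjective _ a
    refine (finite_eulerDer f).subset fun i hi h0 => hi ?_
    rw [h.liftDer_mk, h0, map_zero]
  π := wittLiftRes t L
  φ := wittLiftFrob t (L + 1)
  π_surjective x := by
    obtain ⟨f, rfl⟩ := wittEvalRes_surjective (p := p) h (L + 1) x
    exact ⟨wittLiftMk t (L + 1) f, rfl⟩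
  exists_of_π_eq_zero a ha := by
    obtain ⟨f, rfl⟩ := wittLiftMk_surjective _ a
    rw [wittLiftRes_mk, ← p_dvd_wittEval_iff] at ha
    obtain ⟨g, hg⟩ := exists_wittEval_eq_p_mul h (Nat.succ_ne_zero L) ha
    refine ⟨wittLiftMk t (L + 1) g, ?_⟩
    rw [← map_natCast (wittLiftMk t (L + 1)), ← map_mul, wittLiftMk_eq_iff]
    exact hg
  p_pow_eq_zero := by
    rw [← map_natCast (wittLiftMk t (L + 1)), ← map_pow, wittLiftMk_eq_zero_iff, map_pow,
      map_natCast]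
  exists_of_p_mul_eq_zero a ha := by
    obtain ⟨f, rfl⟩ := wittLiftMk_surjective _ a
    rw [← map_natCast (wittLiftMk t (L + 1)), ← map_mul, wittLiftMk_eq_zero_iff, map_mul,
      map_natCast, p_mul_dvd_iff] at ha
    obtain ⟨g, hg⟩ := exists_wittEval_eq_pow_mul h (Nat.le_succ L) ha
    refine ⟨wittLiftMk t (L + 1) g, ?_⟩
    rw [← map_natCast (wittLiftMk t (L + 1)), ← map_pow, ← map_mul, wittLiftMk_eq_iff]
    exact hg
  φ_eq a := by
    obtain ⟨f, rfl⟩ := wittLiftMk_surjective _ a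
    obtain ⟨g, hg⟩ := exists_wittEval_eq_p_mul h (Nat.succ_ne_zero L)
      (f := polyFrob p I K f - f ^ p) (by
        rw [p_dvd_wittEval_iff, map_sub, map_pow, wittEvalRes_polyFrob, sub_self])
    refine ⟨wittLiftMk t (L + 1) g, ?_⟩
    rw [wittLiftFrob_mk, ← map_natCast (wittLiftMk t (L + 1)), ← map_pow, ← map_mul, ← map_add,
      wittLiftMk_eq_iff, ← sub_sub]
    exact hg
  D_φ i a := by
    obtain ⟨f, rfl⟩ := wittLiftMk_surjective _ a
    rw [wittLiftFrob_mk, h.liftDer_mk, h.liftDer_mk, wittLiftFrob_mk, eulerDer_polyFrob, map_mul,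
      map_natCast]
  π_D i a := by
    obtain ⟨f, rfl⟩ := wittLiftMk_surjective _ a
    rw [h.liftDer_mk, wittLiftRes_mk, wittLiftRes_mk]
    exact (h.der_wittEvalRes L i f).symm

end Coordinates

/-! ### Existence of `p`-bases -/

section PBasisExistence

open Polynomial

variable {p : ℕ} [hp : Fact p.Prime] {I : Type*} {K : Type*} [Field K] [CharP K p]

variable (p) in
/-- The ring `K^p[t]`, described as the additive group generated by the multiples of the monomials
in `t` by `p`-th powers. -/
def monomSubring (t : I → Kˣ) : Subring K where
  __ := AddSubgroup.closure {x : K | ∃ (g : K) (α : I →₀ ℕ), x = g ^ p * (monom t α : K)}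
  one_mem' := AddSubgroup.subset_closure ⟨1, 0, by simp [monom]⟩
  mul_mem' {x y} hx hy := by
    change x * y ∈ AddSubgroup.closure _
    induction hx using AddSubgroup.closure_induction with
    | mem x hx =>
      obtain ⟨g, α, rfl⟩ := hx
      induction hy using AddSubgroup.closure_induction with
      | mem y hy =>
        obtain ⟨h, β, rfl⟩ := hy
        refine AddSubgroup.subset_closure ⟨g * h, α + β, ?_⟩
        rw [monom_add, Units.val_mul]
        ring
      | zero => rw [mul_zero]; exact zero_mem _
      | add y z _ _ hy hz => rw [mul_add]; exact add_mem hy hz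
      | neg y _ hy => rw [mul_neg]; exact neg_mem hy
    | zero => rw [zero_mul]; exact zero_mem _
    | add x z _ _ hx hz => rw [add_mul]; exact add_mem hx hz
    | neg x _ hx => rw [neg_mul]; exact neg_mem hx

theorem pow_mem_monomSubring (t : I → Kˣ) (g : K) : g ^ p ∈ monomSubring p t :=
  AddSubgroup.subset_closure ⟨g, 0, by simp [monom]⟩

variable (p) in
/-- The field `K^p(t) = K^p[t]`. -/
def monomSubfield (t : I → Kˣ) : Subfield K where
  __ := monomSubring p t
  inv_mem' x hx := by
    change x⁻¹ ∈ monomSubring p t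
    by_cases hx0 : x = 0
    · rw [hx0, inv_zero]; exact zero_mem _
    · have := mul_mem (pow_mem_monomSubring t x⁻¹) (pow_mem (S := monomSubring p t) hx (p - 1))
      rwa [inv_pow, ← pow_sub_one_mul hp.out.ne_zero x, mul_inv_rev, mul_assoc, inv_mul_cancel₀
        (pow_ne_zero _ hx0), mul_one] at this

theorem pow_mem_monomSubfield (t : I → Kˣ) (g : K) : g ^ p ∈ monomSubfield p t :=
  pow_mem_monomSubring t g

theorem mem_monomSubfield (t : I → Kˣ) (i : I) : (t i : K) ∈ monomSubfield p t :=
  AddSubgroup.subset_closure ⟨1, Finsupp.single i 1, by simp [monom]⟩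

variable (p) in
/-- The subfield `K^p(y : y < x)`, for a linear order on `K`. -/
def lowerSubfield (r : LinearOrder K) (x : K) : Subfield K :=
  Subfield.closure (Set.range (frobenius K p) ∪ {y | r.lt y x})

/-- An element outside a subfield that contains its `p`-th power has degree `p` over it. -/
theorem eq_zero_of_aeval_eq_zero {M : Subfield K} {x : K} (hx : x ∉ M) (hM : ∀ y : K, y ^ p ∈ M)
    {P : M[X]} (hP : aeval x P = 0) (hdeg : ∀ n, p ≤ n → P.coeff n = 0) : P = 0 := by
  by_contra hne
  have hirr : Irreducible (X ^ p - C (⟨x ^ p, hM x⟩ : M)) := by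
    apply X_pow_sub_C_irreducible_of_prime hp.out
    intro b hb
    have h1 : (b : K) ^ p = x ^ p := congrArg Subtype.val hb
    have h2 : (b : K) = x := frobenius_inj K p h1
    exact hx (h2 ▸ b.2)
  have hmin := minpoly.eq_of_irreducible_of_monic (x := x) hirr (by
    rw [map_sub, map_pow, aeval_X, aeval_C]
    exact sub_self _) (monic_X_pow_sub_C _ hp.out.ne_zero)
  have h1 := minpoly.degree_le_of_ne_zero M x hne hP
  rw [← hmin, degree_X_pow_sub_C hp.out.pos] at h1
  have h2 : P.coeff P.natDegree ≠ 0 := by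
    rw [coeff_natDegree]; exact leadingCoeff_ne_zero.2 hne
  apply h2
  apply hdeg
  rw [degree_eq_natDegree hne] at h1
  exact_mod_cast h1

/-- Every field of characteristic `p` has a `p`-basis: for a well-ordering of the field, the
elements `x` that do not belong to `K^p(y : y < x)`. -/
theorem exists_isPBasis.{v} (p : ℕ) [hp : Fact p.Prime] (K : Type v) [Field K] [CharP K p] :
    ∃ (I : Type v) (_ : LinearOrder I) (_ : WellFoundedLT I) (t : I → Kˣ),
      IsPBasis p t := by
  classical
  obtain ⟨r, hr⟩ := exists_wellFoundedLT K
  have hpow : ∀ x y : K, y ^ p ∈ lowerSubfield p r x := fun x y =>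
    Subfield.subset_closure (Or.inl ⟨y, rfl⟩)
  set J := {x : K // x ∉ lowerSubfield p r x} with hJ
  have hne : ∀ x : J, (x : K) ≠ 0 := fun x h => x.2 (h ▸ zero_mem _)
  set t : J → Kˣ := fun x => Units.mk0 x (hne x) with ht
  refine ⟨J, inferInstance, inferInstance, t, ?_, ?_⟩
  · have key : ∀ (T : Finset J) (c : (J →₀ ℕ) →₀ K), (∀ α ∈ c.support, ∀ i, α i < p) →
        (∀ α ∈ c.support, α.support ⊆ T) →
        (c.sum fun α g => g ^ p * (monom t α : K)) = 0 → c = 0 := by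
      intro T
      induction T using Finset.induction_on_max with
      | empty =>
        intro c _ hT h0
        have h2 : c = Finsupp.single 0 (c 0) := by
          ext α
          by_cases hα : α = 0
          · subst hα; simp
          · rw [Finsupp.single_eq_of_ne hα, ← Finsupp.notMem_support_iff]
            intro h
            exact hα (Finsupp.support_eq_empty.1 (Finset.subset_empty.1 (hT α h)))
        rw [h2, Finsupp.sum_single_index (by simp [hp.out.ne_zero])] at h0
        simp [monom] at h0
        rw [h2, h0.1, Finsupp.single_zero]
      | insert m T hmax ih =>
        intro c hc hT h0
        set M := lowerSubfield p r (m : K) with hM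
        have hsub : ∀ α ∈ c.support, (α.erase m).support ⊆ T := fun α hα i hi => by
          rw [Finsupp.support_erase, Finset.mem_erase] at hi
          exact (Finset.mem_insert.1 (hT α hα hi.2)).resolve_left hi.1
        have hmem : ∀ α ∈ c.support, (monom t (α.erase m) : K) ∈ M := fun α hα => by
          rw [monom, Finsupp.prod, Units.coe_prod]
          refine prod_mem fun i hi => ?_
          rw [Units.val_pow_eq_pow_val]
          have hi' : (t i : K) ∈ M := Subfield.subset_closure (Or.inr (hmax i (hsub α hα hi)))
          exact pow_mem hi' _
        have hmon : ∀ α, (monom t α : K) = (m : K) ^ α m * monom t (α.erase m) := fun α => by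
          rw [monom, ← Finsupp.mul_prod_erase' α m _ (by simp), Units.val_mul,
            Units.val_pow_eq_pow_val]
          rfl
        -- a relation, as a polynomial relation of degree less than `p` for the largest basis element `m`
        -- over the field `M` generated by the preceding elements
        set P : M[X] := ∑ α ∈ c.support.attach, monomial ((α : J →₀ ℕ) m)
          (⟨c α ^ p * monom t ((α : J →₀ ℕ).erase m),
            mul_mem (hpow _ _) (hmem α α.2)⟩ : M) with hP
        have hP0 : P = 0 := by
          refine eq_zero_of_aeval_eq_zero (x := (m : K)) m.2 (hpow _) ?_ ?_
          · rw [hP, map_sum, ← h0, Finsupp.sum, ← Finset.sum_attach c.support]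
            refine Finset.sum_congr rfl fun α _ => ?_
            rw [aeval_monomial, hmon α]
            change c α ^ p * (monom t ((α : J →₀ ℕ).erase m) : K) * _ = _
            ring
          · intro n hn
            rw [hP, finsetSum_coeff]
            refine Finset.sum_eq_zero fun α _ => ?_
            rw [coeff_monomial, if_neg]
            have := hc α α.2 m
            omega
        ext α₀
        have h1 := ih (c.sum fun α g => if α m = α₀ m then Finsupp.single (α.erase m) g else 0)
          (by
            intro β hβ i
            obtain ⟨α, hα, hβ⟩ := Finset.mem_biUnion.1 (Finsupp.support_sum hβ)
            split_ifs at hβ with hl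
            · rw [Finset.mem_singleton.1 (Finsupp.support_single_subset hβ), Finsupp.erase_apply]
              split_ifs
              · exact hp.out.pos
              · exact hc α hα i
            · simp at hβ)
          (by
            intro β hβ
            obtain ⟨α, hα, hβ⟩ := Finset.mem_biUnion.1 (Finsupp.support_sum hβ)
            split_ifs at hβ with hl
            · rw [Finset.mem_singleton.1 (Finsupp.support_single_subset hβ)]
              exact hsub α hα
            · simp at hβ)
          (by
            have h1 : ∀ c' : (J →₀ ℕ) →₀ K, (c'.sum fun α g => g ^ p * (monom t α : K)) =
              Finsupp.liftAddHom (fun α => (AddMonoidHom.mulRight (monom t α : K)).comp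
                (frobenius K p : K →+ K)) c' := fun _ => rfl
            have h2 := congrArg (fun Q : M[X] => ((Q.coeff (α₀ m) : M) : K)) hP0
            simp only [hP, finsetSum_coeff, coeff_zero, coeff_monomial] at h2
            rw [← Subfield.coe_subtype, map_sum, map_zero] at h2
            rw [h1, Finsupp.sum, map_sum, ← h2, ← Finset.sum_attach c.support]
            refine Finset.sum_congr rfl fun α _ => ?_
            split_ifs with hl
            · rw [Finsupp.liftAddHom_apply_single]; rfl
            · rw [map_zero, map_zero])
        have h3 := DFunLike.congr_fun h1 (α₀.erase m)
        rw [Finsupp.sum_apply, Finsupp.zero_apply, Finsupp.sum] at h3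
        rw [Finsupp.zero_apply, ← h3, eq_comm]
        have hinj : ∀ α, α m = α₀ m → α.erase m = α₀.erase m → α = α₀ := fun α h4 h5 => by
          ext i
          by_cases hi : i = m
          · rw [hi, h4]
          · have := DFunLike.congr_fun h5 i
            rwa [Finsupp.erase_ne hi, Finsupp.erase_ne hi] at this
        by_cases hα₀ : α₀ ∈ c.support
        · rw [Finset.sum_eq_single_of_mem α₀ hα₀]
          · simp
          · intro α _ hne
            split_ifs with hl
            · rw [Finsupp.single_eq_of_ne]
              exact fun he => hne (hinj α hl he.symm)
            · rfl
        · rw [Finsupp.notMem_support_iff.1 hα₀]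
          refine Finset.sum_eq_zero fun α hα => ?_
          split_ifs with hl
          · rw [Finsupp.single_eq_of_ne]
            intro he
            exact hα₀ (hinj α hl he.symm ▸ hα)
          · rfl
    intro c hc h0
    exact key (c.support.biUnion Finsupp.support) c hc
      (fun α hα => Finset.subset_biUnion_of_mem Finsupp.support hα) h0
  · intro x
    change x ∈ monomSubfield p t
    induction x using WellFoundedLT.induction with
    | ind x ih =>
      by_cases hx : x ∈ lowerSubfield p r x
      · have h1 : lowerSubfield p r x ≤ monomSubfield p t := by
          rw [lowerSubfield, Subfield.closure_le]
          rintro y (⟨z, rfl⟩ | hy)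
          · exact pow_mem_monomSubfield t z
          · exact ih y hy
        exact h1 hx
      · exact mem_monomSubfield t (⟨x, hx⟩ : J)

end PBasisExistence

/-! ### Extensions of degree prime to `p` and the injectivity on `H_p^{n+1}(F)` -/

section Retraction

variable {p : ℕ} [hp : Fact p.Prime]

/-- The trace of a separable extension of fields of characteristic `p` commutes with Frobenius. -/
theorem trace_pow_char {E L : Type*} [Field E] [Field L] [Algebra E L] [FiniteDimensional E L]
    [Algebra.IsSeparable E L] [CharP E p] (x : L) :
    Algebra.trace E L (x ^ p) = Algebra.trace E L x ^ p := by
  apply (algebraMap E (AlgebraicClosure E)).injective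
  rw [trace_eq_sum_embeddings, map_pow, trace_eq_sum_embeddings, sum_pow_char p]
  exact Finset.sum_congr rfl fun σ _ => map_pow σ x p

variable (p)

/-- A partially defined linear map `f` on an extension of `F` is a Frobenius-equivariant retraction
of a subring onto `F`. -/
structure IsFrobRetraction {F Ω : Type*} [Field F] [Field Ω] [Algebra F Ω] (f : Ω →ₗ.[F] F) :
    Prop where
  mul_mem : ∀ x ∈ f.domain, ∀ y ∈ f.domain, x * y ∈ f.domain
  one_mem : 1 ∈ f.domain
  map_one : f ⟨1, one_mem⟩ = 1
  map_pow : ∀ x y : f.domain, (y : Ω) = (x : Ω) ^ p → f y = f x ^ p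

variable {p} {F Ω : Type*} [Field F] [CharP F p] [Field Ω] [Algebra F Ω]

theorem exists_isFrobRetraction : ∃ f : Ω →ₗ.[F] F, IsFrobRetraction p f := by
  set ι : F →ₗ[F] Ω := Algebra.linearMap F Ω
  have hinj : Function.Injective ι := (algebraMap F Ω).injective
  set e := LinearEquiv.ofInjective ι hinj
  have he : ∀ (a : F) (x : ι.range), (x : Ω) = algebraMap F Ω a → e.symm x = a := fun a x hx => by
    rw [LinearEquiv.symm_apply_eq]; exact Subtype.ext hx
  refine ⟨⟨ι.range, e.symm.toLinearMap⟩, ?_, ⟨1, map_one (algebraMap F Ω)⟩, ?_, ?_⟩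
  · rintro _ ⟨a, rfl⟩ _ ⟨b, rfl⟩
    exact ⟨a * b, map_mul (algebraMap F Ω) a b⟩
  · exact he 1 _ (map_one (algebraMap F Ω)).symm
  · rintro ⟨_, ⟨a, rfl⟩⟩ y hy
    exact (he (a ^ p) y (hy.trans (_root_.map_pow (algebraMap F Ω) a p).symm)).trans
      (congrArg (· ^ p) (he a ⟨ι a, ⟨a, rfl⟩⟩ rfl).symm)

variable (p F Ω) in
theorem exists_maximal_isFrobRetraction :
    ∃ f : Ω →ₗ.[F] F, Maximal (fun f => IsFrobRetraction p f) f := by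
  obtain ⟨f₀, hf₀⟩ := exists_isFrobRetraction (p := p) (F := F) (Ω := Ω)
  have hub : ∀ c ⊆ {f : Ω →ₗ.[F] F | IsFrobRetraction p f}, IsChain (· ≤ ·) c → ∀ y ∈ c,
      ∃ ub ∈ {f : Ω →ₗ.[F] F | IsFrobRetraction p f}, ∀ z ∈ c, z ≤ ub := by
    intro c hc hchain g hg
    have hdir : DirectedOn (· ≤ ·) c := hchain.directedOn
    have hdom : ∀ {x : Ω}, x ∈ (LinearPMap.sSup c hdir).domain ↔ ∃ f ∈ c, x ∈ f.domain :=
      LinearPMap.mem_domain_sSup_iff ⟨g, hg⟩ hdir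
    have h1 : (1 : Ω) ∈ (LinearPMap.sSup c hdir).domain := hdom.2 ⟨g, hg, (hc hg).one_mem⟩
    refine ⟨LinearPMap.sSup c hdir, ⟨?_, h1, ?_, ?_⟩, fun z hz => LinearPMap.le_sSup hdir hz⟩
    · intro x hx y hy
      obtain ⟨f, hf, hx⟩ := hdom.1 hx
      obtain ⟨f', hf', hy⟩ := hdom.1 hy
      obtain ⟨k, hk, hfk, hfk'⟩ := hdir f hf f' hf'
      exact hdom.2 ⟨k, hk, (hc hk).mul_mem x (hfk.1 hx) y (hfk'.1 hy)⟩
    · exact (LinearPMap.sSup_apply hdir hg ⟨1, (hc hg).one_mem⟩).trans (hc hg).map_one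
    · rintro ⟨x, hx⟩ ⟨y, hy⟩ hxy
      obtain ⟨f, hf, hx'⟩ := hdom.1 hx
      obtain ⟨f', hf', hy'⟩ := hdom.1 hy
      obtain ⟨k, hk, hfk, hfk'⟩ := hdir f hf f' hf'
      have hx'' := hfk.1 hx'
      have hy'' := hfk'.1 hy'
      refine (LinearPMap.sSup_apply hdir hk ⟨y, hy''⟩).trans (Eq.trans ?_
        (congrArg (· ^ p) (LinearPMap.sSup_apply hdir hk ⟨x, hx''⟩).symm))
      exact (hc hk).map_pow ⟨x, hx''⟩ ⟨y, hy''⟩ hxy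
  obtain ⟨f, -, hf⟩ := zorn_le_nonempty₀ _ hub f₀ hf₀
  exact ⟨f, hf⟩

/-- The domain of a retraction of an algebraic extension is a field. -/
def IsFrobRetraction.field [Algebra.IsAlgebraic F Ω] {f : Ω →ₗ.[F] F} (hf : IsFrobRetraction p f) :
    IntermediateField F Ω :=
  Subalgebra.toIntermediateField
    { f.domain with
      mul_mem' := fun {x y} hx hy => hf.mul_mem x hx y hy
      one_mem' := hf.one_mem
      algebraMap_mem' := fun a => by
        change algebraMap F Ω a ∈ f.domain
        rw [Algebra.algebraMap_eq_smul_one]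
        exact f.domain.smul_mem a hf.one_mem } fun x hx =>
    Subalgebra.inv_mem_of_algebraic _ (x := ⟨x, hx⟩) (Algebra.IsAlgebraic.isAlgebraic x)

/-- A retraction onto `F` extends to an extension of degree prime to `p`, by means of the trace
divided by the degree. -/
theorem IsFrobRetraction.exists_extension [Algebra.IsSeparable F Ω]
    {f : Ω →ₗ.[F] F} (hf : IsFrobRetraction p f) (y : Ω)
    (hdeg : ¬p ∣ (minpoly hf.field y).natDegree) :
    ∃ g : Ω →ₗ.[F] F, IsFrobRetraction p g ∧ f ≤ g ∧ y ∈ g.domain := by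
  set E := hf.field with hE
  have hsep : Algebra.IsSeparable E Ω := Algebra.isSeparable_tower_top_of_isSeparable F E Ω
  have hint : IsIntegral E y := Algebra.IsIntegral.isIntegral y
  set L := IntermediateField.adjoin E {y} with hL
  have hfin : FiniteDimensional E L := IntermediateField.adjoin.finiteDimensional hint
  have hchar : CharP E p := charP_of_injective_algebraMap (algebraMap F E).injective p
  set m := Module.finrank E L with hm
  have hm0 : (m : E) ≠ 0 := by
    rw [Ne, CharP.cast_eq_zero_iff E p, hm, IntermediateField.adjoin.finrank hint]
    exact hdeg
  set τ : E →ₗ[F] F := f.toFun with hτ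
  have hτ1 : τ 1 = 1 := hf.map_one
  have hτp : ∀ x : E, τ (x ^ p) = τ x ^ p := fun x => hf.map_pow x (x ^ p) rfl
  set tr : L →ₗ[F] E := ((m : E)⁻¹ • Algebra.trace E L).restrictScalars F with htr
  have htrp : ∀ x : L, tr (x ^ p) = tr x ^ p := fun x => by
    change (m : E)⁻¹ * _ = ((m : E)⁻¹ * _) ^ p
    rw [trace_pow_char, mul_pow, inv_pow, natCast_pow_char]
  have htrE : ∀ x : E, tr (algebraMap E L x) = x := fun x => by
    change (m : E)⁻¹ * _ = _
    rw [Algebra.trace_algebraMap, nsmul_eq_mul, ← hm, inv_mul_cancel_left₀ hm0]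
  refine ⟨⟨(L.restrictScalars F).toSubmodule, τ.comp tr⟩, ⟨?_, ?_, ?_, ?_⟩, ⟨?_, ?_⟩, ?_⟩
  · exact fun x hx y hy => L.mul_mem hx hy
  · exact L.one_mem
  · change τ (tr 1) = 1
    rw [← _root_.map_one (algebraMap E L), htrE, hτ1]
  · rintro ⟨x, hx⟩ ⟨y, hy⟩ hxy
    have h1 : (⟨y, hy⟩ : L) = (⟨x, hx⟩ : L) ^ p := Subtype.ext hxy
    exact (congrArg (fun w : L => τ (tr w)) h1).trans
      ((congrArg τ (htrp ⟨x, hx⟩)).trans (hτp _))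
  · intro x hx
    exact L.algebraMap_mem (⟨x, hx⟩ : E)
  · rintro ⟨x, hx⟩ ⟨z, hz⟩ hxz
    change τ (⟨x, hx⟩ : E) = τ (tr (⟨z, hz⟩ : L))
    have h1 : (⟨z, hz⟩ : L) = algebraMap E L ⟨x, hx⟩ := Subtype.ext hxz.symm
    rw [h1, htrE]
  · exact IntermediateField.mem_adjoin_simple_self E y

/-- Every field `F` of characteristic `p` has a separable algebraic extension that is closed under
roots of order `p - 1` and admits a Frobenius-equivariant retraction onto `F`. -/
theorem exists_rootClosed_retraction.{v} (p : ℕ) [hp : Fact p.Prime] (F : Type v) [Field F]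
    [CharP F p] :
    ∃ (K : Type v) (_ : Field K) (_ : Algebra F K) (τ : K →ₗ[F] F),
      Algebra.IsSeparable F K ∧ (∀ x : K, ∃ y, y ^ (p - 1) = x) ∧ τ 1 = 1 ∧
      ∀ x, τ (x ^ p) = τ x ^ p := by
  obtain ⟨f, hf, hmax⟩ := exists_maximal_isFrobRetraction p F (SeparableClosure F)
  refine ⟨hf.field, inferInstance, inferInstance, f.toFun,
    Algebra.isSeparable_tower_bot_of_isSeparable F hf.field (SeparableClosure F), fun x => ?_,
    hf.map_one, fun x => hf.map_pow x (x ^ p) rfl⟩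
  have hp1 : 0 < p - 1 := Nat.sub_pos_of_lt hp.out.one_lt
  have hchar : CharP (SeparableClosure F) p :=
    charP_of_injective_algebraMap (algebraMap F (SeparableClosure F)).injective p
  have hne : NeZero ((p - 1 : ℕ) : SeparableClosure F) := ⟨by
    rw [Ne, CharP.cast_eq_zero_iff (SeparableClosure F) p]
    exact Nat.not_dvd_of_pos_of_lt hp1 (Nat.sub_lt hp.out.pos one_pos)⟩
  obtain ⟨y, hy⟩ := IsSepClosed.exists_pow_nat_eq (x : SeparableClosure F) (p - 1)
  have hroot : Polynomial.aeval y (Polynomial.X ^ (p - 1) - Polynomial.C x : Polynomial hf.field)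
      = 0 := by
    rw [map_sub, map_pow, Polynomial.aeval_X, Polynomial.aeval_C, hy]
    exact sub_self _
  have hdeg : ¬p ∣ (minpoly hf.field y).natDegree := by
    have hint : IsIntegral hf.field y := ⟨_, Polynomial.monic_X_pow_sub_C x hp1.ne', hroot⟩
    have h1 := Polynomial.natDegree_le_of_dvd (minpoly.dvd _ _ hroot)
      (Polynomial.monic_X_pow_sub_C x hp1.ne').ne_zero
    rw [Polynomial.natDegree_X_pow_sub_C] at h1
    exact Nat.not_dvd_of_pos_of_lt (minpoly.natDegree_pos hint) (by omega)
  obtain ⟨g, hg, hfg, hyg⟩ := hf.exists_extension y hdeg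
  exact ⟨⟨y, (hmax hg hfg).1 hyg⟩, Subtype.ext hy⟩

end Retraction

section Transfer

variable {p : ℕ} [hp : Fact p.Prime] {I : Type*} {F : Type*} [Field F] [CharP F p]
  {K : Type*} [Field K] [CharP K p] [Algebra F K]

/-- A `p`-basis of `F` remains a `p`-basis of a separable algebraic extension `K` with a
Frobenius-equivariant retraction onto `F`. -/
theorem IsPBasis.of_retraction [Algebra.IsSeparable F K] {s : I → Fˣ} (h : IsPBasis p s)
    {τ : K →ₗ[F] F} (hτ1 : τ 1 = 1) (hτp : ∀ x, τ (x ^ p) = τ x ^ p) :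
    IsPBasis p fun i => Units.map (algebraMap F K : F →* K) (s i) := by
  have hmon : ∀ α : I →₀ ℕ, (monom (fun i => Units.map (algebraMap F K : F →* K) (s i)) α : K) =
      algebraMap F K (monom s α) := fun α => by
    change _ = ((Units.map (algebraMap F K : F →* K) (monom s α) : Kˣ) : K)
    rw [map_finsuppProd]
    simp only [map_pow]
  refine ⟨fun c hc h0 => ?_, fun x => ?_⟩
  · -- multiplication of a relation by `b^p` and application of `τ` give a relation over `F`
    have key : ∀ b : K, ∀ α, τ (b * c α) = 0 := fun b => by
      have h1 := h.indep (c.mapRange (fun x => τ (b * x)) (by rw [mul_zero, map_zero]))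
        (fun α hα => hc α (Finsupp.support_mapRange hα)) (by
          rw [Finsupp.sum_mapRange_index (by simp [hp.out.ne_zero])]
          have h2 := congrArg (fun x => τ (b ^ p * x)) h0
          simp only [mul_zero, map_zero] at h2
          rw [← h2, Finsupp.sum, Finsupp.sum, Finset.mul_sum, map_sum]
          refine Finset.sum_congr rfl fun α _ => ?_
          rw [hmon, ← mul_assoc, ← mul_pow, mul_comm (_ ^ p) (algebraMap F K _), ← Algebra.smul_def,
            map_smul, hτp, smul_eq_mul, mul_comm])
      exact fun α => DFunLike.congr_fun h1 α
    ext α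
    by_contra hα
    have := key (c α)⁻¹ α
    rw [inv_mul_cancel₀ hα, hτ1] at this
    exact one_ne_zero this
  · set t := fun i => Units.map (algebraMap F K : F →* K) (s i)
    change x ∈ monomSubfield p t
    have hF : ∀ a : F, algebraMap F K a ∈ monomSubfield p t := fun a => by
      induction h.span a using AddSubgroup.closure_induction with
      | mem a ha =>
        obtain ⟨g, α, rfl⟩ := ha
        rw [map_mul, map_pow, ← hmon]
        exact AddSubgroup.subset_closure ⟨_, α, rfl⟩
      | zero => rw [map_zero]; exact zero_mem _
      | add a b _ _ ha hb => rw [map_add]; exact add_mem ha hb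
      | neg a _ ha => rw [map_neg]; exact neg_mem ha
    -- `F(x) = F(x^p)` by separability
    have h1 := IntermediateField.adjoin_eq_adjoin_pow_expChar_of_isSeparable F K {x} p
    have h2 : IntermediateField.adjoin F {x} ≤ (monomSubfield p t).toIntermediateField hF := by
      rw [h1, Set.image_singleton, IntermediateField.adjoin_simple_le_iff]
      exact pow_mem_monomSubfield t x
    exact h2 (IntermediateField.mem_adjoin_simple_self F x)

end Transfer

/-- The injectivity of `H_p^{n+1}(F) → H_{p^(j+1)}^{n+1}(F)`. -/
theorem mem_wittJ_of_shift_mem.{v} (p : ℕ) [hp : Fact p.Prime] (F : Type v) [Field F] [CharP F p]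
    (j n : ℕ) {X : WittTensor p F 1 n}
    (hX : wittTensorShift p (Nat.le_add_left 1 j) n X ∈ wittJ p F (j + 1) n) :
    X ∈ wittJ p F 1 n := by
  obtain ⟨I, _, _, s, hs⟩ := exists_isPBasis p F
  obtain ⟨K, _, _, τ, hsep, hroot, hτ1, hτp⟩ := exists_rootClosed_retraction p F
  have hchar : CharP K p := charP_of_injective_algebraMap (algebraMap F K).injective p
  have h := hs.of_retraction hτ1 hτp
  obtain ⟨z, v, hzv⟩ := (h.frobLift (j + 1)).symbolForm_of_shift_mem (algebraMap F K) hroot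
    le_rfl hX
  exact PCoordRetract.mem_wittJ_of_symbolForm (P := h.pcoord)
    { ψ := algebraMap F K
      τ := τ
      τ_mul := fun a x => by
        rw [← Algebra.smul_def]; exact map_smul τ a x
      τ_one := hτ1
      τ_pow := hτp
      s := s
      t_eq := fun _ => rfl
      span := hs.span } hzv

/-! ### Truncation, shift and multiplication by powers of `p` -/

section Truncation

variable (p : ℕ) [hp : Fact p.Prime] {F : Type*} [Field F]

theorem wittShift_truncate {i j : ℕ} (hij : i ≤ j) (x : WittVector p F) :
    wittShift p hij (WittVector.truncate i x) =
      WittVector.truncate j (WittVector.verschiebung^[j - i] x) :=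
  wittShiftFun_truncate p hij x

theorem wittShift_wittShift {i j k : ℕ} (hij : i ≤ j) (hjk : j ≤ k)
    (w : TruncatedWittVector p i F) :
    wittShift p hjk (wittShift p hij w) = wittShift p (hij.trans hjk) w := by
  obtain ⟨x, rfl⟩ := WittVector.truncate_surjective p i F w
  rw [wittShift_truncate, wittShift_truncate, wittShift_truncate, ← Function.iterate_add_apply]
  congr 3
  omega

theorem wittShift_self {i : ℕ} (w : TruncatedWittVector p i F) : wittShift p le_rfl w = w := by
  obtain ⟨x, rfl⟩ := WittVector.truncate_surjective p i F w
  rw [wittShift_truncate, Nat.sub_self, Function.iterate_zero_apply]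

/-- The homomorphism `(a_1, …, a_k) ⊗ b_1 ⊗ ⋯ ⊗ b_n ↦ (a_1, …, a_j) ⊗ b_1 ⊗ ⋯ ⊗ b_n`. -/
def wittTensorTrunc {j k : ℕ} (hjk : j ≤ k) (n : ℕ) : WittTensor p F k n →+ WittTensor p F j n :=
  (TensorProduct.map (TruncatedWittVector.truncate hjk).toAddMonoidHom.toIntLinearMap
    LinearMap.id).toAddMonoidHom

variable {p}

theorem wittTensorTrunc_symbol {j k : ℕ} (hjk : j ≤ k) {n : ℕ} (w : TruncatedWittVector p k F)
    (b : Fin n → Fˣ) : wittTensorTrunc p hjk n (wittSymbol w b) =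
      wittSymbol (TruncatedWittVector.truncate hjk w) b := TensorProduct.map_tmul _ _ _ _

theorem truncate_wittShift_eq_zero {i j k : ℕ} (hk : i + j = k) (w : TruncatedWittVector p i F) :
    TruncatedWittVector.truncate (hk ▸ Nat.le_add_left j i)
      (wittShift p (hk ▸ Nat.le_add_right i j) w) = 0 := by
  subst hk
  obtain ⟨x, rfl⟩ := WittVector.truncate_surjective p i F w
  rw [wittShift_truncate, TruncatedWittVector.truncate_wittVector_truncate]
  ext l
  rw [WittVector.coeff_truncate, WittVector.iterate_verschiebung_coeff_eq_zero,
    TruncatedWittVector.coeff_zero]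
  have := l.isLt
  omega

theorem exists_wittShift_eq {i j k : ℕ} (hk : i + j = k) {w : TruncatedWittVector p k F}
    (hw : TruncatedWittVector.truncate (hk ▸ Nat.le_add_left j i : j ≤ k) w = 0) :
    ∃ v, wittShift p (hk ▸ Nat.le_add_right i j : i ≤ k) v = w := by
  subst hk
  refine ⟨TruncatedWittVector.mk p fun l => w.coeff ⟨l + j, by omega⟩, ?_⟩
  ext l
  change (wittShiftFun p _).coeff l = _
  rw [wittShiftFun, TruncatedWittVector.coeff_mk]
  split_ifs with h
  · rw [TruncatedWittVector.coeff_mk]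
    congr 1
    exact Fin.ext (by dsimp only; omega)
  · have hl : (l : ℕ) < j := by have := l.isLt; omega
    have h1 := congrArg (TruncatedWittVector.coeff ⟨l, hl⟩) hw
    rw [TruncatedWittVector.coeff_truncate, TruncatedWittVector.coeff_zero] at h1
    exact h1.symm

/-- Right exactness of the tensor product, applied to
`0 → W_i(F) → W_(i + j)(F) → W_j(F) → 0`. -/
theorem exists_wittTensorShift_eq {i j k n : ℕ} (hk : i + j = k) {X : WittTensor p F k n}
    (hX : wittTensorTrunc p (hk ▸ Nat.le_add_left j i : j ≤ k) n X = 0) :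
    ∃ Y, wittTensorShift p (hk ▸ Nat.le_add_right i j : i ≤ k) n Y = X := by
  have hexact : Function.Exact
      (wittShift p (F := F) (hk ▸ Nat.le_add_right i j : i ≤ k)).toIntLinearMap
      (TruncatedWittVector.truncate (p := p) (R := F)
        (hk ▸ Nat.le_add_left j i : j ≤ k)).toAddMonoidHom.toIntLinearMap := fun w => by
    constructor
    · exact fun hw => exists_wittShift_eq hk hw
    · rintro ⟨v, rfl⟩
      exact truncate_wittShift_eq_zero hk v
  exact (rTensor_exact (PiTensorProduct ℤ fun _ : Fin n => Additive Fˣ) hexact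
    (TruncatedWittVector.truncate_surjective (hk ▸ Nat.le_add_left j i : j ≤ k)) X).1 hX

theorem truncate_wittTeich {j k : ℕ} (hjk : j ≤ k) (a : F) :
    TruncatedWittVector.truncate hjk (wittTeich p k a) = wittTeich p j a := by
  rw [wittTeich_eq, wittTeich_eq, TruncatedWittVector.truncate_wittVector_truncate]

theorem truncate_wittFrob {j k : ℕ} (hjk : j ≤ k) (w : TruncatedWittVector p k F) :
    TruncatedWittVector.truncate hjk (wittFrob w) =
      wittFrob (TruncatedWittVector.truncate hjk w) := by
  ext l
  rw [TruncatedWittVector.coeff_truncate]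
  simp only [wittFrob, TruncatedWittVector.coeff_mk, TruncatedWittVector.coeff_truncate]

theorem wittJ_le_comap_trunc {j k : ℕ} (hjk : j ≤ k) (n : ℕ) :
    wittJ p F k n ≤ (wittJ p F j n).comap (wittTensorTrunc p hjk n) := by
  rw [wittJ, AddSubgroup.closure_le]
  rintro _ (⟨w, b⟩ | ⟨b, l, hl⟩ | ⟨w, b, l, m, hlm, h⟩)
  all_goals
    change wittTensorTrunc p hjk n _ ∈ wittJ p F j n
    rw [wittTensorTrunc_symbol]
  · rw [map_sub, truncate_wittFrob]
    exact AddSubgroup.subset_closure (IsWittRelation.frob _ _)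
  · rw [truncate_wittTeich]
    exact AddSubgroup.subset_closure (IsWittRelation.teich _ _ hl)
  · exact AddSubgroup.subset_closure (IsWittRelation.alt _ b l m hlm h)

theorem wittJ_le_map_trunc {j k : ℕ} (hjk : j ≤ k) (n : ℕ) :
    wittJ p F j n ≤ (wittJ p F k n).map (wittTensorTrunc p hjk n) := by
  rw [wittJ, AddSubgroup.closure_le]
  rintro _ (⟨w, b⟩ | ⟨b, l, hl⟩ | ⟨w, b, l, m, hlm, h⟩)
  · obtain ⟨w, rfl⟩ := TruncatedWittVector.truncate_surjective hjk w
    refine ⟨_, AddSubgroup.subset_closure (IsWittRelation.frob w b), ?_⟩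
    rw [wittTensorTrunc_symbol, map_sub, truncate_wittFrob]
  · refine ⟨_, AddSubgroup.subset_closure (IsWittRelation.teich b l hl), ?_⟩
    rw [wittTensorTrunc_symbol, truncate_wittTeich]
  · obtain ⟨w, rfl⟩ := TruncatedWittVector.truncate_surjective hjk w
    exact ⟨_, AddSubgroup.subset_closure (IsWittRelation.alt w b l m hlm h),
      wittTensorTrunc_symbol _ _ _⟩

variable (p F)

/-- The homomorphism `H_{p^k}^{n+1}(F) → H_{p^j}^{n+1}(F)` induced by the truncation of Witt
vectors, for `j ≤ k`. -/
def wittHTrunc {j k : ℕ} (hjk : j ≤ k) (n : ℕ) : WittH p F k n →+ WittH p F j n :=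
  QuotientAddGroup.map _ _ (wittTensorTrunc p hjk n) (wittJ_le_comap_trunc hjk n)

variable {p F}

theorem wittHTrunc_mk {j k : ℕ} (hjk : j ≤ k) {n : ℕ} (X : WittTensor p F k n) :
    wittHTrunc p F hjk n (wittHMk k n X) = wittHMk j n (wittTensorTrunc p hjk n X) := rfl

variable [CharP F p]

theorem wittHTrans_mk {i j : ℕ} (hij : i ≤ j) {n : ℕ} (X : WittTensor p F i n) :
    wittHTrans p F hij n (wittHMk i n X) = wittHMk j n (wittTensorShift p hij n X) := rfl

theorem wittHTrans_wittHTrans {i j k : ℕ} (hij : i ≤ j) (hjk : j ≤ k) (n : ℕ) (x : WittH p F i n) :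
    wittHTrans p F hjk n (wittHTrans p F hij n x) = wittHTrans p F (hij.trans hjk) n x := by
  induction x using wittH_induction with
  | h0 => simp only [map_zero]
  | hadd x y hx hy => simp only [map_add, hx, hy]
  | h w b =>
    rw [wittHTrans_mk, wittHTrans_mk, wittHTrans_mk, wittTensorShift_symbol,
      wittTensorShift_symbol, wittTensorShift_symbol, wittShift_wittShift]

theorem wittHTrans_self {i : ℕ} (n : ℕ) (x : WittH p F i n) :
    wittHTrans p F le_rfl n x = x := by
  induction x using wittH_induction with
  | h0 => simp only [map_zero]
  | hadd x y hx hy => simp only [map_add, hx, hy]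
  | h w b => rw [wittHTrans_mk, wittTensorShift_symbol, wittShift_self]

theorem wittHTrunc_wittHTrans {i j : ℕ} (hij : i ≤ j) (n : ℕ) (x : WittH p F (i + 1) n) :
    wittHTrunc p F (Nat.le_succ j) n (wittHTrans p F (Nat.succ_le_succ hij) n x) =
      wittHTrans p F hij n (wittHTrunc p F (Nat.le_succ i) n x) := by
  induction x using wittH_induction with
  | h0 => simp only [map_zero]
  | hadd x y hx hy => simp only [map_add, hx, hy]
  | h w b =>
    rw [wittHTrans_mk, wittHTrunc_mk, wittHTrunc_mk, wittHTrans_mk, wittTensorShift_symbol,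
      wittTensorTrunc_symbol, wittTensorTrunc_symbol, wittTensorShift_symbol]
    obtain ⟨y, rfl⟩ := WittVector.truncate_surjective p _ F w
    rw [wittShift_truncate, TruncatedWittVector.truncate_wittVector_truncate,
      TruncatedWittVector.truncate_wittVector_truncate, wittShift_truncate, Nat.succ_sub_succ]

/-- Exactness of `H_{p^i} → H_{p^(i + j)} → H_{p^j}` in the middle. -/
theorem exists_wittHTrans_eq {i j k n : ℕ} (hk : i + j = k) {x : WittH p F k n}
    (hx : wittHTrunc p F (hk ▸ Nat.le_add_left j i : j ≤ k) n x = 0) :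
    ∃ y, wittHTrans p F (hk ▸ Nat.le_add_right i j : i ≤ k) n y = x := by
  obtain ⟨X, rfl⟩ := wittHMk_surjective k n x
  rw [wittHTrunc_mk, wittHMk_eq_zero_iff] at hx
  obtain ⟨Y, hY, hYX⟩ := wittJ_le_map_trunc _ n hx
  obtain ⟨Z, hZ⟩ := exists_wittTensorShift_eq hk (X := X - Y) (by rw [map_sub, hYX, sub_self])
  refine ⟨wittHMk i n Z, ?_⟩
  rw [wittHTrans_mk, hZ, map_sub, wittHMk_eq_zero_iff.2 hY, sub_zero]

theorem wittH_zero_eq_zero {n : ℕ} (x : WittH p F 0 n) : x = 0 := by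
  induction x using wittH_induction with
  | h0 => rfl
  | hadd x y hx hy => rw [hx, hy, add_zero]
  | h w b =>
    have hw : w = 0 := by ext l; exact l.elim0
    rw [hw, wittSymbol, TensorProduct.zero_tmul, map_zero]

theorem wittHMk_wittFrob_iterate {j n : ℕ} (w : TruncatedWittVector p j F) (b : Fin n → Fˣ)
    (k : ℕ) : wittHMk j n (wittSymbol (wittFrob^[k] w) b) = wittHMk j n (wittSymbol w b) := by
  rw [← sub_eq_zero, ← map_sub, wittHMk_eq_zero_iff]
  exact wittFrob_iterate_sub_mem p w b k

/-- Multiplication by `p^i` on `H_{p^j}` factors through the truncation to `H_{p^(j - i)}`: on Witt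
vectors `p = 𝐕𝐅`, and `𝐅` induces the identity. -/
theorem wittHTrans_wittHTrunc {i j : ℕ} (hij : i ≤ j) (n : ℕ) (x : WittH p F j n) :
    wittHTrans p F (Nat.sub_le j i) n (wittHTrunc p F (Nat.sub_le j i) n x) = p ^ i • x := by
  induction x using wittH_induction with
  | h0 => simp only [map_zero, smul_zero]
  | hadd x y hx hy => simp only [map_add, hx, hy, smul_add]
  | h w b =>
    rw [wittHTrunc_mk, wittHTrans_mk, wittTensorTrunc_symbol, wittTensorShift_symbol,
      ← wittHMk_wittFrob_iterate _ b i, ← map_nsmul, ← wittSymbol_nsmul]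
    congr 2
    obtain ⟨y, rfl⟩ := WittVector.truncate_surjective p _ F w
    have hF : ∀ (k : ℕ) (x : WittVector p F), wittFrob^[k] (WittVector.truncate j x) =
        WittVector.truncate j (WittVector.frobenius^[k] x) := fun k x =>
      ((Function.Semiconj.iterate_right (f := WittVector.truncate j)
        (ga := WittVector.frobenius) (gb := wittFrob)
        (fun x => (wittFrob_truncate p j x).symm) k).eq x).symm
    rw [TruncatedWittVector.truncate_wittVector_truncate, wittShift_truncate,
      Nat.sub_sub_self hij, hF, ← map_nsmul]
    congr 1
    have hc := ((WittVector.verschiebung_frobenius_comm (p := p) (R := F)).iterate_iterate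
      i i).eq y
    rw [← hc, WittVector.iterate_verschiebung_iterate_frobenius, nsmul_eq_mul, mul_comm]
    push_cast
    rfl

theorem pow_smul_wittH {i j n : ℕ} (hji : j ≤ i) (x : WittH p F j n) : p ^ i • x = 0 := by
  obtain ⟨k, rfl⟩ := Nat.exists_eq_add_of_le hji
  have h0 : ∀ y : WittH p F (j - j) n, y = 0 := by
    rw [Nat.sub_self]; exact wittH_zero_eq_zero
  rw [pow_add, mul_comm, mul_smul, ← wittHTrans_wittHTrunc le_rfl, h0 (wittHTrunc _ _ _ _ _),
    map_zero, smul_zero]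

/-- The maps `H_{p^i}^{n+1}(F) → H_{p^j}^{n+1}(F)` are injective: the truncations reduce this to
the case `i = 1`. -/
theorem wittHTrans_injective {i j : ℕ} (hij : i ≤ j) (n : ℕ) :
    Function.Injective (wittHTrans p F hij n) := by
  rw [injective_iff_map_eq_zero]
  induction i generalizing j with
  | zero => exact fun x _ => wittH_zero_eq_zero x
  | succ i ih =>
    intro x hx
    obtain ⟨j, rfl⟩ : ∃ k, j = k + 1 := ⟨j - 1, by omega⟩
    have hij' : i ≤ j := Nat.le_of_succ_le_succ hij
    have h1 : wittHTrunc p F (Nat.le_succ i) n x = 0 := by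
      apply ih hij'
      rw [← wittHTrunc_wittHTrans, hx, map_zero]
    obtain ⟨y, rfl⟩ := exists_wittHTrans_eq (add_comm 1 i) h1
    rw [wittHTrans_wittHTrans] at hx
    obtain ⟨Y, rfl⟩ := wittHMk_surjective 1 n y
    rw [wittHMk_eq_zero_iff.2 (mem_wittJ_of_shift_mem p F j n (wittHMk_eq_zero_iff.1 hx)),
      map_zero]

theorem exists_wittHTrans_eq_of_smul {i j n : ℕ} (hij : i ≤ j) {x : WittH p F j n}
    (hx : p ^ i • x = 0) : ∃ y, wittHTrans p F hij n y = x := by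
  rw [← wittHTrans_wittHTrunc hij] at hx
  exact exists_wittHTrans_eq (Nat.add_sub_cancel' hij)
    (wittHTrans_injective _ n (hx.trans (map_zero _).symm))

end Truncation

/-! ### Torsion in the prime-to-`p` part -/

section TameTorsion

open CategoryTheory TopRep

/-- A torsion module has torsion cohomology: multiplication by `c` vanishes on the cochains, hence
on the cocycles, hence on the classes. -/
theorem smul_continuousCohomology_eq_zero {G : Type*} [Group G] [TopologicalSpace G]
    [IsTopologicalGroup G] (X : TopRep ℤ G) (c : ℤ) (hX : ∀ x : X, c • x = 0) (n : ℕ)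
    (x : continuousCohomology n X) : c • x = 0 := by
  have h1 : ∀ k, ∀ x : resolutionX X k, c • x = 0 := by
    intro k
    induction k with
    | zero => exact hX
    | succ k ih => exact fun f => ContinuousMap.ext fun g => ih _
  have h2 : c • 𝟙 ((homogeneousCochains X).X n) = 0 := by
    ext x
    exact Subtype.ext (h1 _ _)
  have h3 : c • 𝟙 ((homogeneousCochains X).cycles n) = 0 := by
    rw [← cancel_mono ((homogeneousCochains X).iCycles n), Preadditive.zsmul_comp,
      Category.id_comp, Limits.zero_comp, ← Category.comp_id ((homogeneousCochains X).iCycles n),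
      ← Preadditive.comp_zsmul, h2, Limits.comp_zero]
  have h4 : c • 𝟙 ((homogeneousCochains X).homology n) = 0 := by
    rw [← cancel_epi ((homogeneousCochains X).homologyπ n), Preadditive.comp_zsmul,
      Category.comp_id, Limits.comp_zero, ← Category.id_comp ((homogeneousCochains X).homologyπ n),
      ← Preadditive.zsmul_comp, h3, Limits.zero_comp]
  exact DFunLike.congr_fun (congrArg (fun f => f.hom) h4) x

theorem smul_tameH_eq_zero {F : Type*} [Field F] (m n : ℕ) (x : TameH F m n) : m • x = 0 := by
  rw [← natCast_zsmul]
  refine smul_continuousCohomology_eq_zero (muRep F m n) m (fun x => ?_) (n + 1) x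
  rw [natCast_zsmul]
  exact muTensor_nsmul_eq_zero F m n x

end TameTorsion

/-! ### The direct limit -/

section Colimit

instance : Nonempty DvdIndex := ⟨⟨1, one_pos⟩⟩

instance : IsDirectedOrder DvdIndex :=
  ⟨fun m m' => ⟨⟨m.val * m'.val, Nat.mul_pos m.pos m'.pos⟩, Nat.dvd_mul_right _ _,
    Nat.dvd_mul_left _ _⟩⟩

variable (p : ℕ) [hp : Fact p.Prime] (F : Type*) [Field F] [CharP F p]

/-- The direct limit of the groups `H_{p^i}^{n+1}(F)`. -/
abbrev WittHLim (n : ℕ) :=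
  AddCommGroup.DirectLimit (fun i => WittH p F i n) fun _ _ hij => wittHTrans p F hij n

instance (n : ℕ) : DirectedSystem (fun i => WittH p F i n) fun _ _ hij => wittHTrans p F hij n where
  map_self := fun _ x => wittHTrans_self n x
  map_map := fun _ _ _ hij hjk x => wittHTrans_wittHTrans hij hjk n x

variable {p F} in
theorem wittHLim_of_injective (n i : ℕ) : Function.Injective
    (AddCommGroup.DirectLimit.of (fun i => WittH p F i n) (fun _ _ hij => wittHTrans p F hij n)
      i) := by
  rw [injective_iff_map_eq_zero]
  intro x hx
  obtain ⟨j, hij, hj⟩ := AddCommGroup.DirectLimit.of.zero_exact _ _ hx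
  exact wittHTrans_injective hij n (hj.trans (map_zero _).symm)

/-- The projection of `H^{n+1}(F)` to its `p`-primary part. -/
def wittPart (n : ℕ) : HLim p F n →+ WittHLim p F n :=
  AddCommGroup.DirectLimit.lift (HMod p F n) (hTrans p F n) _
    (fun m => (AddCommGroup.DirectLimit.of (fun i => WittH p F i n)
      (fun _ _ hij => wittHTrans p F hij n) (m.val.factorization p)).comp (AddMonoidHom.snd _ _))
    fun _ _ h x => AddCommGroup.DirectLimit.of_f (G := fun i => WittH p F i n)
      (f := fun _ _ hij => wittHTrans p F hij n) (factorization_le_of_le p h) x.2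

/-- The projection of `H^{n+1}(F)` to its prime-to-`p` part. -/
def tamePart (n : ℕ) : HLim p F n →+ HLim p F n :=
  AddCommGroup.DirectLimit.map
    (fun _ => (AddMonoidHom.inl _ _).comp (AddMonoidHom.fst _ _))
    fun _ _ h => AddMonoidHom.ext fun _ =>
      Prod.ext rfl (map_zero (wittHTrans p F (factorization_le_of_le p h) n)).symm

variable {p F}

/-- The map `H_m^{n+1}(F) → H^{n+1}(F)`. -/
abbrev hLimOf (n : ℕ) (m : DvdIndex) : HMod p F n m →+ HLim p F n :=
  AddCommGroup.DirectLimit.of (HMod p F n) (hTrans p F n) m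

theorem wittPart_hLimOf (n : ℕ) (m : DvdIndex) (x : HMod p F n m) :
    wittPart p F n (hLimOf n m x) = AddCommGroup.DirectLimit.of (fun i => WittH p F i n)
      (fun _ _ hij => wittHTrans p F hij n) (m.val.factorization p) x.2 :=
  AddCommGroup.DirectLimit.lift_of _ _ _ _ _

theorem tamePart_hLimOf (n : ℕ) (m : DvdIndex) (x : HMod p F n m) :
    tamePart p F n (hLimOf n m x) = hLimOf n m (x.1, 0) :=
  AddCommGroup.DirectLimit.map_apply_of _ _ _

theorem hLimOf_eq (n : ℕ) {m m' : DvdIndex} {b : WittH p F (m.val.factorization p) n}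
    {b' : WittH p F (m'.val.factorization p) n}
    (h : ∀ k (hk : m.val.factorization p ≤ k) (hk' : m'.val.factorization p ≤ k),
      wittHTrans p F hk n b = wittHTrans p F hk' n b') :
    hLimOf n m (0, b) = hLimOf n m' (0, b') := by
  obtain ⟨M, hM, hM'⟩ := exists_ge_ge m m'
  rw [← AddCommGroup.DirectLimit.of_f (f := hTrans p F n) hM (0, b),
    ← AddCommGroup.DirectLimit.of_f (f := hTrans p F n) hM' (0, b')]
  congr 1
  exact Prod.ext ((map_zero (tameHTrans F _ _ n)).trans (map_zero (tameHTrans F _ _ n)).symm)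
    (h _ (factorization_le_of_le p hM) (factorization_le_of_le p hM'))

theorem wittHToLim_injective (n i : ℕ) : Function.Injective (wittHToLim p F n i) := by
  refine Function.Injective.of_comp (f := wittPart p F n) ?_
  have h : ∀ x, wittPart p F n (wittHToLim p F n i x) =
      AddCommGroup.DirectLimit.of (fun i => WittH p F i n) (fun _ _ hij => wittHTrans p F hij n)
        _ (wittHTrans p F (Nat.factorization_pow_self hp.out).ge n x) := fun x =>
    wittPart_hLimOf n _ _
  intro x y hxy
  rw [Function.comp_apply, Function.comp_apply, h, h] at hxy
  exact wittHTrans_injective _ n (wittHLim_of_injective n _ hxy)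

/-- The prime-to-`p` part of `H_m^{n+1}(F)` is killed by an integer prime to `p`, so it does not
contribute to the `p`-primary torsion. -/
theorem hLimOf_inl_eq_zero {n i : ℕ} {m : DvdIndex}
    (a : TameH F (m.val / p ^ m.val.factorization p) n)
    (ha : p ^ i • hLimOf n m (a, (0 : WittH p F (m.val.factorization p) n)) = 0) :
    hLimOf n m (a, (0 : WittH p F (m.val.factorization p) n)) = 0 := by
  have h1 : (m.val / p ^ m.val.factorization p) •
      hLimOf n m (a, (0 : WittH p F (m.val.factorization p) n)) = 0 := by
    rw [← map_nsmul, Prod.smul_mk, smul_tameH_eq_zero, smul_zero]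
    exact map_zero _
  have hcop : Nat.Coprime (p ^ i) (m.val / p ^ m.val.factorization p) :=
    Nat.Coprime.pow_left i (Nat.coprime_ordCompl hp.out m.pos.ne')
  rw [← AddMonoid.addOrderOf_eq_one_iff, ← Nat.dvd_one, ← hcop]
  exact Nat.dvd_gcd (addOrderOf_dvd_of_nsmul_eq_zero ha) (addOrderOf_dvd_of_nsmul_eq_zero h1)

theorem exists_wittHToLim_eq {n i : ℕ} {x : HLim p F n} (hx : p ^ i • x = 0) :
    ∃ y, wittHToLim p F n i y = x := by
  induction x using AddCommGroup.DirectLimit.induction_on with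
  | ih m ab =>
    obtain ⟨a, b⟩ := ab
    have ha : hLimOf n m (a, (0 : WittH p F (m.val.factorization p) n)) = 0 := by
      apply hLimOf_inl_eq_zero (i := i)
      have h := congrArg (tamePart p F n) hx
      rw [map_nsmul, map_zero] at h
      rw [← tamePart_hLimOf n m (a, b)]
      exact h
    have hb : p ^ i • b = 0 := by
      apply wittHLim_of_injective n _
      have h := congrArg (wittPart p F n) hx
      rw [map_nsmul, map_zero, wittPart_hLimOf n m (a, b)] at h
      rw [map_nsmul, map_zero]
      exact h
    have hab : hLimOf n m (a, b) = hLimOf n m (0, b) := by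
      rw [← zero_add (hLimOf n m (0, b)), ← ha, ← map_add, Prod.mk_add_mk, add_zero, zero_add]
    change ∃ y, _ = hLimOf n m (a, b)
    rw [hab]
    obtain ⟨c, hc⟩ : ∃ c : WittH p F i n, ∀ k (hk : m.val.factorization p ≤ k) (hk' : i ≤ k),
        wittHTrans p F hk' n c = wittHTrans p F hk n b := by
      rcases le_total i (m.val.factorization p) with h | h
      · obtain ⟨c, rfl⟩ := exists_wittHTrans_eq_of_smul h hb
        exact ⟨c, fun k hk hk' => (wittHTrans_wittHTrans _ _ n c).symm⟩
      · exact ⟨wittHTrans p F h n b, fun k hk hk' => wittHTrans_wittHTrans _ _ n b⟩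
    refine ⟨c, hLimOf_eq n fun k hk hk' => ?_⟩
    rw [← hc k hk' ((Nat.factorization_pow_self hp.out).ge.trans hk)]
    exact wittHTrans_wittHTrans _ _ n c

end Colimit

end IzhCoh

end

theorem theorem1 (p : ℕ) [Fact p.Prime] (F : Type*) [Field F] [CharP F p] (n i : ℕ) :
    Function.Injective (IzhCoh.wittHToLim p F n i) ∧
      ∀ x : IzhCoh.HLim p F n,
        x ∈ (IzhCoh.wittHToLim p F n i).range ↔ p ^ i • x = 0 := by
  refine ⟨IzhCoh.wittHToLim_injective n i, fun x => ⟨?_, IzhCoh.exists_wittHToLim_eq⟩⟩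
  rintro ⟨y, rfl⟩
  rw [← map_nsmul, IzhCoh.pow_smul_wittH le_rfl, map_zero]
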